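/- Let $L$ be a set of labels, given with an injective numbering $L\to\mathbb N$. Binary session types over $L$ are the closed, guarded terms of the grammar $$T ::= \oplus\{l_i:T_i\}_{i\in I} \mid \&\{l_i:T_i\}_{i\in I} \mid \mu t.T \mid t \mid \mathbf{end},$$ where $I$ is finite and non-empty and the labels of each output selection $\oplus$ and each input branching $\&$ are pairwise distinct (guarded: in $\mu t.T$ the variable $t$ occurs only within the scope of an output or an input). A type is *single-out* (*single-in*) if $|I|=1$ in every output selection (input branching) occurring in it. The dual $\overline T$ exchanges $\oplus$ and $\&$ throughout. Unfolding is given by $\mathrm{unf}^0(T)=T$, $\mathrm{unf}^n(T)=\mathrm{unf}^1(\mathrm{unf}^{n-1}(T))$, where $\mathrm{unf}^1(\mu t.T)=T\{\mu t.T/t\}$, $\mathrm{unf}^1(\mathbf{end})=\mathbf{end}$, and $\mathrm{unf}^1$ is applied to all continuations of a selection or branching. An input context $\mathcal A$ is a finite tree of input branchings whose leaves are holes numbered $1,\dots,m$; $\mathcal A[T_k]_k$ is obtained by filling hole $k$ with $T_k$. A relation $\mathcal R$ on session types is an *asynchronous subtyping relation* if $(T,S)\in\mathcal R$ implies: 1.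 if $T=\mathbf{end}$, then $\mathrm{unf}^n(S)=\mathbf{end}$ for some $n$; 2. if $T=\oplus\{l_i:T_i\}_{i\in I}$, then for some $n$ and some input context $\mathcal A$: $\mathrm{unf}^n(S)=\mathcal A[\oplus\{l_j:S_{kj}\}_{j\in J_k}]_k$; $I\subseteq J_k$ for all $k$; $(T_i,\mathcal A[S_{ki}]_k)\in\mathcal R$ for all $i\in I$; and (no orphan message constraint) if $\mathcal A$ is not a single hole, then every $T_i$, $i\in I$, contains at least one input branching; 3. if $T=\&\{l_i:T_i\}_{i\in I}$, then for some $n$: $\mathrm{unf}^n(S)=\&\{l_j:S_j\}_{j\in J}$, $J\subseteq I$, and $(T_j,S_j)\in\mathcal R$ for all $j\in J$; 4. if $T=\mu t.T'$, then $(T'\{T/t\},S)\in\mathcal R$. Write $T\le S$ if some asynchronous subtyping relation contains $(T,S)$. The relations $\le_{\mathsf{sin}}$ and $\le_{\mathsf{sout}}$ are obtained by additionally requiring, for $(T,S)\in\mathcal R$, that $T$ and $S$ are both single-in, respectively both single-out; $\le_{\mathsf{sin,tout}}$ is obtained from $\le_{\mathsf{sin}}$ by additionally requiring $I=J_k$ in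 item 2. An *asynchronous dual closed subtyping relation* is a relation $\mathcal R$ on session types satisfying items 1–4 without the no orphan message constraint and such that $(T,S)\in\mathcal R$ implies $(\overline S,\overline T)\in\mathcal R$; write $T\le_{\mathsf{DC}}S$ if some such relation contains $(T,S)$. Call a relation on session types decidable if there is a computable function which, given (codes of) two session types, tells whether they are related. **Theorem.** - $\le_{\mathsf{sin}}$ is decidable. - $\le_{\mathsf{sin}}\cup\le_{\mathsf{sout}}$ is decidable. - $\le_{\mathsf{sin,tout}}$ is decidable. - Let $T^{\mathrm{in}}$ and $T^{\mathrm{out}}$ be the sets of single-in and single-out session types. The relation $(\le_{\mathsf{DC}}\cap\, T^{\mathrm{in}}\times T^{\mathrm{in}})\cup(\le_{\mathsf{DC}}\cap\, T^{\mathrm{out}}\times T^{\mathrm{out}})$ is an asynchronous dual closed subtyping relation, and it is decidable. -/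

import Mathlib

/-- Raw terms of the syntax of binary session types over a set `L` of labels.
`out n l T` is the output selection `⊕{lᵢ : Tᵢ}` with `i` ranging over `Fin n`, `inp n l T` is the
input branching `&{lᵢ : Tᵢ}`, `mu x T` is the recursive type `μx.T`, `var x` is a recursion
variable (variable names are natural numbers) and `fin` is the terminated channel. -/
inductive Ty (L : Type*) where
  | out (n : ℕ) (l : Fin n → L) (T : Fin n → Ty L) : Ty L
  | inp (n : ℕ) (l : Fin n → L) (T : Fin n → Ty L) : Ty L
  | mu (x : ℕ) (T : Ty L) : Ty L
  | var (x : ℕ) : Ty L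
  | fin : Ty L

namespace Ty

variable {L : Type*}

/-- All recursion variables that occur free in the term belong to `Γ`. -/
def FreeIn : Ty L → Set ℕ → Prop
  | out _ _ T, Γ => ∀ i, (T i).FreeIn Γ
  | inp _ _ T, Γ => ∀ i, (T i).FreeIn Γ
  | mu x T, Γ => T.FreeIn (insert x Γ)
  | var x, Γ => x ∈ Γ
  | fin, _ => True

/-- Every free occurrence of the variable `x` is within the scope of an output or an input. -/
def GuardsVar (x : ℕ) : Ty L → Prop
  | out _ _ _ => True
  | inp _ _ _ => True
  | mu y T => y = x ∨ T.GuardsVar x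
  | var y => y ≠ x
  | fin => True

/-- In every subterm `μx.T` the variable `x` is guarded in `T`. -/
def Guarded : Ty L → Prop
  | out _ _ T => ∀ i, (T i).Guarded
  | inp _ _ T => ∀ i, (T i).Guarded
  | mu x T => T.GuardsVar x ∧ T.Guarded
  | var _ => True
  | fin => True

/-- Every choice has at least one alternative, and its labels are pairwise distinct. -/
def GoodChoices : Ty L → Prop
  | out n l T => 1 ≤ n ∧ Function.Injective l ∧ ∀ i, (T i).GoodChoices
  | inp n l T => 1 ≤ n ∧ Function.Injective l ∧ ∀ i, (T i).GoodChoices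
  | mu _ T => T.GoodChoices
  | var _ => True
  | fin => True

/-- Session types: closed, guarded terms with distinct labels in every choice. -/
structure IsSession (T : Ty L) : Prop where
  closed : T.FreeIn ∅
  guarded : T.Guarded
  choices : T.GoodChoices

/-- Every output selection that occurs in the term has exactly one choice. -/
def SingleOut : Ty L → Prop
  | out n _ T => n = 1 ∧ ∀ i, (T i).SingleOut
  | inp _ _ T => ∀ i, (T i).SingleOut
  | mu _ T => T.SingleOut
  | var _ => True
  | fin => True

/-- Every input branching that occurs in the term has exactly one choice. -/
def SingleIn : Ty L → Prop
  | out _ _ T => ∀ i, (T i).SingleIn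
  | inp n _ T => n = 1 ∧ ∀ i, (T i).SingleIn
  | mu _ T => T.SingleIn
  | var _ => True
  | fin => True

/-- `& ∈ T`: the term contains at least one input branching. -/
def HasInput : Ty L → Prop
  | out _ _ T => ∃ i, (T i).HasInput
  | inp _ _ _ => True
  | mu _ T => T.HasInput
  | var _ => False
  | fin => False

/-- Duality: exchange of outputs and inputs. -/
def dual : Ty L → Ty L
  | out n l T => inp n l fun i => (T i).dual
  | inp n l T => out n l fun i => (T i).dual
  | mu x T => mu x T.dual
  | var x => var x
  | fin => fin

/-- `subst x U T` is `T{U/x}`. It is only used for closed `U`, so that no capture can occur. -/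
def subst (x : ℕ) (U : Ty L) : Ty L → Ty L
  | out n l T => out n l fun i => subst x U (T i)
  | inp n l T => inp n l fun i => subst x U (T i)
  | mu y T => if y = x then mu y T else mu y (subst x U T)
  | var y => if y = x then U else var y
  | fin => fin

/-- One unfolding of all recursions that are not under another recursion. -/
def unfoldOnce : Ty L → Ty L
  | out n l T => out n l fun i => (T i).unfoldOnce
  | inp n l T => inp n l fun i => (T i).unfoldOnce
  | mu x T => subst x (mu x T) T
  | var x => var x
  | fin => fin

/-- The `n`-unfolding of a type. -/
def unfold : ℕ → Ty L → Ty L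
  | 0, T => T
  | n + 1, T => (unfold n T).unfoldOnce

/-- A standard numbering of terms, used as the input format of decision procedures. -/
def code [Encodable L] : Ty L → ℕ
  | fin => Nat.pair 0 0
  | var x => Nat.pair 1 x
  | mu x T => Nat.pair 2 (Nat.pair x T.code)
  | out _ l T => Nat.pair 3 (Encodable.encode (List.ofFn fun i => (Encodable.encode (l i), (T i).code)))
  | inp _ l T => Nat.pair 4 (Encodable.encode (List.ofFn fun i => (Encodable.encode (l i), (T i).code)))

/-- Distinct terms have distinct codes. -/
theorem code_injective [Encodable L] : Function.Injective (code : Ty L → ℕ) := by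
  have key : ∀ {n m : ℕ} {l : Fin n → L} {l' : Fin m → L} {T : Fin n → Ty L} {T' : Fin m → Ty L},
      (∀ i (S : Ty L), (T i).code = S.code → T i = S) →
      (List.ofFn fun i => (Encodable.encode (l i), (T i).code)) =
        (List.ofFn fun i => (Encodable.encode (l' i), (T' i).code)) →
      ∃ h : n = m, l = l' ∘ Fin.cast h ∧ T = T' ∘ Fin.cast h := by
    intro n m l l' T T' ih h
    have hn : n = m := by simpa using congrArg List.length h
    subst hn
    have h' := List.ofFn_injective h
    refine ⟨rfl, ?_, ?_⟩
    · funext i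
      exact Encodable.encode_injective (Prod.ext_iff.1 (congrFun h' i)).1
    · funext i
      exact ih i _ (Prod.ext_iff.1 (congrFun h' i)).2
  intro T
  induction T with
  | fin => intro S h; cases S <;> simp_all [code, Nat.pair_eq_pair]
  | var x => intro S h; cases S <;> simp_all [code, Nat.pair_eq_pair]
  | mu x T ih =>
    intro S h
    cases S <;> simp only [code, Nat.pair_eq_pair] at h <;>
      first
        | (exfalso; omega)
        | (obtain ⟨-, h1, h2⟩ := h
           rw [h1, ih h2])
  | out n l T ih =>
    intro S h
    cases S <;> simp only [code, Nat.pair_eq_pair] at h <;>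
      first
        | (exfalso; omega)
        | (obtain ⟨hn, h1, h2⟩ := key (fun i S hS => ih i hS) (Encodable.encode_injective h.2)
           subst hn; subst h1; subst h2; rfl)
  | inp n l T ih =>
    intro S h
    cases S <;> simp only [code, Nat.pair_eq_pair] at h <;>
      first
        | (exfalso; omega)
        | (obtain ⟨hn, h1, h2⟩ := key (fun i S hS => ih i hS) (Encodable.encode_injective h.2)
           subst hn; subst h1; subst h2; rfl)

end Ty

/-- Input contexts: trees of input branchings whose leaves are holes. -/
inductive InCtx (L : Type*) where
  | hole : InCtx L
  | inp (n : ℕ) (l : Fin n → L) (A : Fin n → InCtx L) : InCtx L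

namespace InCtx

variable {L : Type*}

/-- The holes of a context. Indexing fillers by this type enumerates every hole exactly once. -/
def Hole : InCtx L → Type
  | hole => Unit
  | inp n _ A => (i : Fin n) × (A i).Hole

/-- The type obtained by filling each hole `k` of the context with `F k`. -/
def fill : (A : InCtx L) → (A.Hole → Ty L) → Ty L
  | hole, F => F ()
  | inp n l A, F => Ty.inp n l fun i => (A i).fill fun k => F ⟨i, k⟩

end InCtx

/-- The subscripts that may be attached to the subtyping symbol. -/
structure Restriction where
  sin : Bool := false
  sout : Bool := false
  tin : Bool := false
  tout : Bool := false

section Subtyping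

variable {L : Type*}

/-- The conditions that a pair `(T, S)` of a subtyping relation `R` has to meet, with the
restrictions `r`; the no orphan message constraint is imposed if `orphan` is true. -/
def SubtypeStep (r : Restriction) (orphan : Bool) (R : Ty L → Ty L → Prop) : Ty L → Ty L → Prop
  | Ty.fin, S => ∃ n : ℕ, S.unfold n = Ty.fin
  | Ty.out _ l T, S =>
      ∃ (n : ℕ) (A : InCtx L) (q : A.Hole → ℕ) (l' : ∀ k, Fin (q k) → L)
        (S' : ∀ k, Fin (q k) → Ty L),
        S.unfold n = A.fill (fun k => Ty.out (q k) (l' k) (S' k)) ∧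
        (∀ k, Set.range l ⊆ Set.range (l' k)) ∧
        (r.tout → ∀ k, Set.range l = Set.range (l' k)) ∧
        (∀ i, ∀ j : ∀ k, Fin (q k), (∀ k, l' k (j k) = l i) →
          R (T i) (A.fill fun k => S' k (j k))) ∧
        (orphan → A ≠ InCtx.hole → ∀ i, (T i).HasInput)
  | Ty.inp _ l T, S =>
      ∃ (n q : ℕ) (l' : Fin q → L) (S' : Fin q → Ty L),
        S.unfold n = Ty.inp q l' S' ∧
        Set.range l' ⊆ Set.range l ∧
        (r.tin → Set.range l' = Set.range l) ∧
        (∀ i j, l i = l' j → R (T i) (S' j))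
  | Ty.mu x T, S => R (Ty.subst x (Ty.mu x T) T) S
  | Ty.var _, _ => False

/-- `R` is an asynchronous subtyping relation (on session types), with the restrictions `r`. -/
def IsSubtypingRel (r : Restriction) (R : Ty L → Ty L → Prop) : Prop :=
  ∀ T S, R T S →
    T.IsSession ∧ S.IsSession ∧
    (r.sin → T.SingleIn ∧ S.SingleIn) ∧
    (r.sout → T.SingleOut ∧ S.SingleOut) ∧
    SubtypeStep r true R T S

/-- Asynchronous subtyping `T ≤ S`, with the restrictions `r` as subscripts. -/
def AsyncSubtype (r : Restriction) (T S : Ty L) : Prop :=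
  ∃ R : Ty L → Ty L → Prop, IsSubtypingRel r R ∧ R T S

/-- `R` is an asynchronous dual closed subtyping relation: it is closed under duality, and the no
orphan message constraint is not imposed. -/
def IsDualClosedSubtypingRel (R : Ty L → Ty L → Prop) : Prop :=
  (∀ T S, R T S → R S.dual T.dual) ∧
  ∀ T S, R T S → T.IsSession ∧ S.IsSession ∧ SubtypeStep {} false R T S

/-- Asynchronous dual closed subtyping `T ≤_DC S`. -/
def DualClosedSubtype (T S : Ty L) : Prop :=
  ∃ R : Ty L → Ty L → Prop, IsDualClosedSubtypingRel R ∧ R T S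

/-- The part of `≤_DC` on single-in types together with its part on single-out types. -/
def DualClosedSinOrSout (T S : Ty L) : Prop :=
  (DualClosedSubtype T S ∧ T.SingleIn ∧ S.SingleIn) ∨
  (DualClosedSubtype T S ∧ T.SingleOut ∧ S.SingleOut)

/-- A relation on session types is decidable if a computable function, given the codes of any two
session types, tells whether they are related. -/
def DecidableOnSessionTypes [Encodable L] (R : Ty L → Ty L → Prop) : Prop :=
  ∃ f : ℕ → ℕ → Bool, Computable₂ f ∧
    ∀ T S : Ty L, T.IsSession → S.IsSession → (f T.code S.code = true ↔ R T S)

end Subtyping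

/-!
In general an output may overtake an unbounded tree of inputs of the supertype. For single-in types
this tree is a word, and the position of a pair in the subtyping game is a triple: the rest of the
subtype, a queue of pending labels, and the rest of the supertype.

* *Trees.* A session type is determined, as far as subtyping is concerned, by its infinite unfolding
  (`Ty.TreeEq`). Whether a type unfolds to an input context with output selections in its holes is a
  syntactic property `Ty.Emits`, see `Ty.IsSession.emits_iff`.
* *Reduction to single-in types.* All relations of the theorem are instances of one relation
  `Ty.Sub b P`, in which an output may overtake inputs only if its continuations satisfy `P`. For
  subtyping of single-in types `P` is the no orphan message constraint. For single-out types, whose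
  outputs do not branch, this constraint says that an input is reached on all paths
  (`Ty.EmitsDual`). With this second constraint `Ty.Sub` is dual closed subtyping on all types
  (`Ty.dualClosedSubtype_iff`), because an input of the supertype can then be matched on every path
  through the outputs of the subtype (`Ty.DSub.exists_fill`). Hence duality turns single-out types
  into single-in ones.
* *The queue machine.* For single-in types, `Ty.Sub` holds if and only if the machine `Conf.Move`
  reaches no violation `Conf.Bad` (`Ty.sub_iff_safe`). Its moves do not depend on the labels in the
  queue. Therefore a machine that knows the length of the queue only, and in addition follows one
  letter of the queue chosen when the letter is put there, still finds each violation, including the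
  mismatch of the first letter of the queue with an input of the subtype. This is a one-counter
  system with finitely many states, since a session type reaches only finitely many types
  (`Ty.IsSession.exists_states`).
* *A bound.* Reachable states of a one-counter system are reached by runs of a length bounded in
  terms of the number of states (`OneCounter.Reach.exists_short`). So the search for violations can
  be cut off at an explicit depth (`Ty.sub_iff_safe_bound`).
* *Computability.* The bounded search is primitive recursive on codes (`TyCode.primrec_subC`,
  `Ty.subC_code`).
-/

namespace Ty

variable {L : Type*}

/-! ### Substitution and unfolding -/

theorem FreeIn.mono {T : Ty L} {Γ Δ : Set ℕ} (h : T.FreeIn Γ) (hs : Γ ⊆ Δ) : T.FreeIn Δ := by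
  induction T generalizing Γ Δ with
  | out n l T ih => exact fun i => ih i (h i) hs
  | inp n l T ih => exact fun i => ih i (h i) hs
  | mu x T ih => exact ih (Γ := insert x Γ) h (Set.insert_subset_insert hs)
  | var x => exact hs h
  | fin => trivial

theorem subst_eq_self {T : Ty L} {Γ : Set ℕ} {x : ℕ} (U : Ty L) (h : T.FreeIn Γ) (hx : x ∉ Γ) :
    subst x U T = T := by
  induction T generalizing Γ with
  | out n l T ih => simp only [subst]; congr; funext i; exact ih i (h i) hx
  | inp n l T ih => simp only [subst]; congr; funext i; exact ih i (h i) hx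
  | mu y T ih =>
    simp only [subst]
    split_ifs with hy
    · rfl
    · rw [ih (Γ := insert y Γ) h (by simp [Ne.symm hy, hx])]
  | var y =>
    simp only [subst]
    split_ifs with hy
    · subst hy; exact absurd h hx
    · rfl
  | fin => rfl

theorem FreeIn.subst {T U : Ty L} {Γ : Set ℕ} {x : ℕ} (h : T.FreeIn (insert x Γ))
    (hU : U.FreeIn ∅) : (Ty.subst x U T).FreeIn Γ := by
  induction T generalizing Γ with
  | out n l T ih => exact fun i => ih i (h i)
  | inp n l T ih => exact fun i => ih i (h i)
  | mu y T ih =>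
    simp only [Ty.subst]
    simp only [FreeIn] at h
    split_ifs with hy
    · subst hy; simpa [FreeIn] using h
    · rw [Set.insert_comm] at h
      exact ih h
  | var y =>
    simp only [Ty.subst]
    split_ifs with hy
    · exact hU.mono (Set.empty_subset _)
    · exact h.resolve_left hy
  | fin => trivial

theorem FreeIn.guardsVar {T : Ty L} {Γ : Set ℕ} {x : ℕ} (h : T.FreeIn Γ) (hx : x ∉ Γ) :
    T.GuardsVar x := by
  induction T generalizing Γ with
  | out n l T ih => trivial
  | inp n l T ih => trivial
  | mu y T ih =>
    by_cases hy : y = x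
    · exact Or.inl hy
    · exact Or.inr (ih (Γ := insert y Γ) h (by simp [Ne.symm hy, hx]))
  | var y => rintro rfl; exact hx h
  | fin => trivial

theorem GuardsVar.subst {T U : Ty L} {x y : ℕ} (h : T.GuardsVar y) (hU : U.FreeIn ∅) :
    (Ty.subst x U T).GuardsVar y := by
  induction T with
  | out n l T ih => trivial
  | inp n l T ih => trivial
  | mu z T ih =>
    simp only [Ty.subst]
    split_ifs with hz
    · exact h
    · exact h.imp id ih
  | var z =>
    simp only [Ty.subst]
    split_ifs with hz
    · exact hU.guardsVar (by simp)
    · exact h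
  | fin => trivial

theorem Guarded.subst {T U : Ty L} {x : ℕ} (h : T.Guarded) (hU : U.FreeIn ∅) (hG : U.Guarded) :
    (Ty.subst x U T).Guarded := by
  induction T with
  | out n l T ih => exact fun i => ih i (h i)
  | inp n l T ih => exact fun i => ih i (h i)
  | mu z T ih =>
    simp only [Ty.subst]
    split_ifs with hz
    · exact h
    · exact ⟨h.1.subst hU, ih h.2⟩
  | var z =>
    simp only [Ty.subst]
    split_ifs with hz
    · exact hG
    · exact h
  | fin => trivial

theorem GoodChoices.subst {T U : Ty L} {x : ℕ} (h : T.GoodChoices) (hU : U.GoodChoices) :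
    (Ty.subst x U T).GoodChoices := by
  induction T with
  | out n l T ih => exact ⟨h.1, h.2.1, fun i => ih i (h.2.2 i)⟩
  | inp n l T ih => exact ⟨h.1, h.2.1, fun i => ih i (h.2.2 i)⟩
  | mu z T ih =>
    simp only [Ty.subst]
    split_ifs with hz
    · exact h
    · exact ih h
  | var z =>
    simp only [Ty.subst]
    split_ifs with hz
    · exact hU
    · exact h
  | fin => trivial

theorem SingleIn.subst {T U : Ty L} {x : ℕ} (h : T.SingleIn) (hU : U.SingleIn) :
    (Ty.subst x U T).SingleIn := by
  induction T with
  | out n l T ih => exact fun i => ih i (h i)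
  | inp n l T ih => exact ⟨h.1, fun i => ih i (h.2 i)⟩
  | mu z T ih =>
    simp only [Ty.subst]
    split_ifs with hz
    · exact h
    · exact ih h
  | var z =>
    simp only [Ty.subst]
    split_ifs with hz
    · exact hU
    · exact h
  | fin => trivial

theorem SingleIn.unfoldOnce {T : Ty L} (h : T.SingleIn) : T.unfoldOnce.SingleIn := by
  induction T with
  | out n l T ih => exact fun i => ih i (h i)
  | inp n l T ih => exact ⟨h.1, fun i => ih i (h.2 i)⟩
  | mu z T ih => exact SingleIn.subst (T := T) h h
  | var z => trivial
  | fin => trivial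

theorem SingleIn.unfold {T : Ty L} (h : T.SingleIn) (n : ℕ) : (T.unfold n).SingleIn := by
  induction n with
  | zero => exact h
  | succ n ih => exact ih.unfoldOnce

/-! ### Session types -/

theorem isSession_out {n : ℕ} {l : Fin n → L} {T : Fin n → Ty L} :
    (out n l T).IsSession ↔ 1 ≤ n ∧ Function.Injective l ∧ ∀ i, (T i).IsSession :=
  ⟨fun h => ⟨h.choices.1, h.choices.2.1, fun i => ⟨h.closed i, h.guarded i, h.choices.2.2 i⟩⟩,
    fun h => ⟨fun i => (h.2.2 i).closed, fun i => (h.2.2 i).guarded,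
      h.1, h.2.1, fun i => (h.2.2 i).choices⟩⟩

theorem isSession_inp {n : ℕ} {l : Fin n → L} {T : Fin n → Ty L} :
    (inp n l T).IsSession ↔ 1 ≤ n ∧ Function.Injective l ∧ ∀ i, (T i).IsSession :=
  ⟨fun h => ⟨h.choices.1, h.choices.2.1, fun i => ⟨h.closed i, h.guarded i, h.choices.2.2 i⟩⟩,
    fun h => ⟨fun i => (h.2.2 i).closed, fun i => (h.2.2 i).guarded,
      h.1, h.2.1, fun i => (h.2.2 i).choices⟩⟩

theorem isSession_fin : (fin : Ty L).IsSession := ⟨trivial, trivial, trivial⟩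

theorem IsSession.subst_mu {x : ℕ} {T : Ty L} (h : (mu x T).IsSession) :
    (subst x (mu x T) T).IsSession :=
  ⟨FreeIn.subst (T := T) h.closed h.closed, Guarded.subst h.guarded.2 h.closed h.guarded,
    GoodChoices.subst (T := T) h.choices h.choices⟩

theorem IsSession.unfoldOnce {T : Ty L} (h : T.IsSession) : T.unfoldOnce.IsSession := by
  induction T with
  | out n l T ih =>
    rw [isSession_out] at h
    exact isSession_out.2 ⟨h.1, h.2.1, fun i => ih i (h.2.2 i)⟩
  | inp n l T ih =>
    rw [isSession_inp] at h
    exact isSession_inp.2 ⟨h.1, h.2.1, fun i => ih i (h.2.2 i)⟩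
  | mu x T ih => exact h.subst_mu
  | var x => exact h
  | fin => exact h

theorem IsSession.unfold {T : Ty L} (h : T.IsSession) (n : ℕ) : (T.unfold n).IsSession := by
  induction n with
  | zero => exact h
  | succ n ih => exact ih.unfoldOnce

theorem unfold_add (T : Ty L) (m n : ℕ) : T.unfold (m + n) = (T.unfold m).unfold n := by
  induction n with
  | zero => rfl
  | succ n ih => exact congrArg unfoldOnce ih

theorem unfold_out (k n : ℕ) (l : Fin n → L) (T : Fin n → Ty L) :
    (out n l T).unfold k = out n l fun i => (T i).unfold k := by
  induction k with
  | zero => rfl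
  | succ k ih => exact congrArg unfoldOnce ih

theorem unfold_inp (k n : ℕ) (l : Fin n → L) (T : Fin n → Ty L) :
    (inp n l T).unfold k = inp n l fun i => (T i).unfold k := by
  induction k with
  | zero => rfl
  | succ k ih => exact congrArg unfoldOnce ih

/-- The number of recursions at the head of a term. -/
def headMus : Ty L → ℕ
  | mu _ T => T.headMus + 1
  | _ => 0

theorem headMus_subst {T U : Ty L} {x : ℕ} (h : T.GuardsVar x) :
    (subst x U T).headMus = T.headMus := by
  induction T with
  | out n l T ih => rfl
  | inp n l T ih => rfl
  | mu z T ih =>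
    simp only [Ty.subst]
    split_ifs with hz
    · rfl
    · simp only [headMus, ih (h.resolve_left hz)]
  | var z => simp only [Ty.subst, if_neg (show z ≠ x from h)]
  | fin => rfl

/-- Induction on the number of recursions at the head of a session type: guardedness makes the
head recursions disappear after finitely many unfoldings. -/
theorem IsSession.head_induction {motive : Ty L → Prop}
    (out : ∀ n l T, (out n l T).IsSession → motive (out n l T))
    (inp : ∀ n l T, (inp n l T).IsSession → motive (inp n l T))
    (mu : ∀ x T, (mu x T).IsSession → motive (subst x (mu x T) T) → motive (mu x T))
    (fin : motive fin) {T : Ty L} (h : T.IsSession) : motive T := by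
  induction hk : T.headMus generalizing T with
  | zero =>
    cases T with
    | out n l T => exact out _ _ _ h
    | inp n l T => exact inp _ _ _ h
    | mu x T => simp [headMus] at hk
    | var x => exact absurd h.closed (by simp [FreeIn])
    | fin => exact fin
  | succ k ih =>
    cases T with
    | mu x T =>
      refine mu _ _ h (ih h.subst_mu ?_)
      rw [headMus_subst h.guarded.1]
      simpa [headMus] using hk
    | _ => simp [headMus] at hk

/-! ### The infinite tree of a session type -/

/-- One unfolding of a recursion at the head of a term. -/
def topUnfold : Ty L → Ty L
  | mu x T => subst x (mu x T) T
  | T => T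

/-- The head normal form: all recursions at the head of the term are unfolded. -/
def hnf (T : Ty L) : Ty L := topUnfold^[T.headMus] T

theorem hnf_mu {x : ℕ} {T : Ty L} (h : (mu x T).IsSession) :
    (mu x T).hnf = (subst x (mu x T) T).hnf := by
  unfold hnf
  rw [headMus_subst h.guarded.1]
  rfl

/-- The labels of the nodes of the infinite tree of a type; `bot` marks the positions outside
the tree. -/
inductive Node (L : Type*) where
  | out (n : ℕ) (l : Fin n → L) : Node L
  | inp (n : ℕ) (l : Fin n → L) : Node L
  | fin : Node L
  | bot : Node L

/-- The node of the infinite unfolding of a type at a position. -/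
def tree : List ℕ → Ty L → Node L
  | [], T =>
    match T.hnf with
    | out n l _ => Node.out n l
    | inp n l _ => Node.inp n l
    | fin => Node.fin
    | _ => Node.bot
  | i :: p, T =>
    match T.hnf with
    | out n _ T' => if h : i < n then tree p (T' ⟨i, h⟩) else Node.bot
    | inp n _ T' => if h : i < n then tree p (T' ⟨i, h⟩) else Node.bot
    | _ => Node.bot

/-- Two types have the same infinite unfolding. -/
def TreeEq (T S : Ty L) : Prop := ∀ p, tree p T = tree p S

theorem TreeEq.refl (T : Ty L) : TreeEq T T := fun _ => rfl

theorem TreeEq.symm {T S : Ty L} (h : TreeEq T S) : TreeEq S T := fun p => (h p).symm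

theorem TreeEq.trans {T S U : Ty L} (h : TreeEq T S) (h' : TreeEq S U) : TreeEq T U :=
  fun p => (h p).trans (h' p)

theorem treeEq_mu {x : ℕ} {T : Ty L} (h : (mu x T).IsSession) :
    TreeEq (subst x (mu x T) T) (mu x T) := by
  intro p
  cases p <;> simp only [tree, hnf_mu h]

theorem treeEq_out {n : ℕ} {l : Fin n → L} {T T' : Fin n → Ty L} (h : ∀ i, TreeEq (T i) (T' i)) :
    TreeEq (out n l T) (out n l T') := by
  intro p
  cases p with
  | nil => rfl
  | cons i p =>
    change (if h : i < n then tree p (T ⟨i, h⟩) else Node.bot) =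
      (if h : i < n then tree p (T' ⟨i, h⟩) else Node.bot)
    split_ifs
    exacts [h _ p, rfl]

theorem treeEq_inp {n : ℕ} {l : Fin n → L} {T T' : Fin n → Ty L} (h : ∀ i, TreeEq (T i) (T' i)) :
    TreeEq (inp n l T) (inp n l T') := by
  intro p
  cases p with
  | nil => rfl
  | cons i p =>
    change (if h : i < n then tree p (T ⟨i, h⟩) else Node.bot) =
      (if h : i < n then tree p (T' ⟨i, h⟩) else Node.bot)
    split_ifs
    exacts [h _ p, rfl]

theorem TreeEq.inp_inv {n : ℕ} {l : Fin n → L} {T T' : Fin n → Ty L}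
    (h : TreeEq (inp n l T) (inp n l T')) (i : Fin n) : TreeEq (T i) (T' i) := by
  intro p
  have := h (i :: p)
  change (if h : (i : ℕ) < n then tree p (T ⟨i, h⟩) else Node.bot) =
      (if h : (i : ℕ) < n then tree p (T' ⟨i, h⟩) else Node.bot) at this
  simpa using this

theorem TreeEq.out_inv {n : ℕ} {l : Fin n → L} {T T' : Fin n → Ty L}
    (h : TreeEq (out n l T) (out n l T')) (i : Fin n) : TreeEq (T i) (T' i) := by
  intro p
  have := h (i :: p)
  change (if h : (i : ℕ) < n then tree p (T ⟨i, h⟩) else Node.bot) =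
      (if h : (i : ℕ) < n then tree p (T' ⟨i, h⟩) else Node.bot) at this
  simpa using this

theorem IsSession.treeEq_unfoldOnce {T : Ty L} (h : T.IsSession) : TreeEq T.unfoldOnce T := by
  induction T with
  | out n l T ih => exact treeEq_out fun i => ih i ((isSession_out.1 h).2.2 i)
  | inp n l T ih => exact treeEq_inp fun i => ih i ((isSession_inp.1 h).2.2 i)
  | mu x T ih => exact treeEq_mu h
  | var x => exact TreeEq.refl _
  | fin => exact TreeEq.refl _

theorem IsSession.treeEq_unfold {T : Ty L} (h : T.IsSession) (n : ℕ) : TreeEq (T.unfold n) T := by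
  induction n with
  | zero => exact TreeEq.refl _
  | succ n ih => exact (h.unfold n).treeEq_unfoldOnce.trans ih

/-- Finitely many unfoldings bring a session type into a form without a recursion at its head. -/
theorem IsSession.exists_unfold {T : Ty L} (h : T.IsSession) :
    (∃ k n l T', T.unfold k = out n l T') ∨ (∃ k n l T', T.unfold k = inp n l T') ∨
      ∃ k, T.unfold k = fin := by
  refine IsSession.head_induction (motive := fun T => (∃ k n l T', T.unfold k = out n l T') ∨
    (∃ k n l T', T.unfold k = inp n l T') ∨ ∃ k, T.unfold k = fin) ?_ ?_ ?_ ?_ h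
  · exact fun n l T _ => Or.inl ⟨0, n, l, T, rfl⟩
  · exact fun n l T _ => Or.inr (Or.inl ⟨0, n, l, T, rfl⟩)
  · intro x T _ ih
    have key (k : ℕ) : (mu x T).unfold (1 + k) = (subst x (mu x T) T).unfold k :=
      unfold_add (mu x T) 1 k
    rcases ih with ⟨k, ih⟩ | ⟨k, ih⟩ | ⟨k, ih⟩
    · exact Or.inl ⟨1 + k, by rw [key]; exact ih⟩
    · exact Or.inr (Or.inl ⟨1 + k, by rw [key]; exact ih⟩)
    · exact Or.inr (Or.inr ⟨1 + k, by rw [key]; exact ih⟩)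
  · exact Or.inr (Or.inr ⟨0, rfl⟩)

theorem IsSession.unfold_eq_out {S : Ty L} {n : ℕ} {l : Fin n → L}
    (hS : S.IsSession) (h : tree [] S = Node.out n l) : ∃ k T', S.unfold k = out n l T' := by
  rcases hS.exists_unfold with ⟨k, n', l', T', hk⟩ | ⟨k, n', l', T', hk⟩ | ⟨k, hk⟩ <;>
    have h' := (hS.treeEq_unfold k []).trans h <;> rw [hk] at h' <;> simp [tree, hnf, headMus] at h'
  obtain ⟨rfl, h'⟩ := h'
  cases h'
  exact ⟨k, T', hk⟩

theorem IsSession.unfold_eq_inp {S : Ty L} {n : ℕ} {l : Fin n → L}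
    (hS : S.IsSession) (h : tree [] S = Node.inp n l) : ∃ k T', S.unfold k = inp n l T' := by
  rcases hS.exists_unfold with ⟨k, n', l', T', hk⟩ | ⟨k, n', l', T', hk⟩ | ⟨k, hk⟩ <;>
    have h' := (hS.treeEq_unfold k []).trans h <;> rw [hk] at h' <;> simp [tree, hnf, headMus] at h'
  obtain ⟨rfl, h'⟩ := h'
  cases h'
  exact ⟨k, T', hk⟩

theorem IsSession.unfold_eq_fin {S : Ty L}
    (hS : S.IsSession) (h : tree [] S = Node.fin) : ∃ k, S.unfold k = fin := by
  rcases hS.exists_unfold with ⟨k, n', l', T', hk⟩ | ⟨k, n', l', T', hk⟩ | ⟨k, hk⟩ <;>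
    have h' := (hS.treeEq_unfold k []).trans h <;> rw [hk] at h' <;> simp [tree, hnf, headMus] at h'
  exact ⟨k, hk⟩

theorem IsSession.unfold_of_treeEq_out {S : Ty L} {n : ℕ} {l : Fin n → L} {T : Fin n → Ty L}
    (hS : S.IsSession) (h : TreeEq S (out n l T)) :
    ∃ k T', S.unfold k = out n l T' ∧ ∀ i, TreeEq (T' i) (T i) := by
  obtain ⟨k, T', hk⟩ := hS.unfold_eq_out (h [])
  exact ⟨k, T', hk, fun i => TreeEq.out_inv (hk ▸ (hS.treeEq_unfold k).trans h) i⟩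

theorem IsSession.unfold_of_treeEq_inp {S : Ty L} {n : ℕ} {l : Fin n → L} {T : Fin n → Ty L}
    (hS : S.IsSession) (h : TreeEq S (inp n l T)) :
    ∃ k T', S.unfold k = inp n l T' ∧ ∀ i, TreeEq (T' i) (T i) := by
  obtain ⟨k, T', hk⟩ := hS.unfold_eq_inp (h [])
  exact ⟨k, T', hk, fun i => TreeEq.inp_inv (hk ▸ (hS.treeEq_unfold k).trans h) i⟩

/-! ### Filling input contexts -/

theorem fill_isSession {A : InCtx L} {F : A.Hole → Ty L} (h : (A.fill F).IsSession)
    (k : A.Hole) : (F k).IsSession := by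
  induction A with
  | hole => exact h
  | inp n l A ih => exact ih k.1 ((isSession_inp.1 h).2.2 k.1) k.2

theorem fill_isSession_congr {A : InCtx L} {F G : A.Hole → Ty L} (h : (A.fill F).IsSession)
    (hG : ∀ k, (G k).IsSession) : (A.fill G).IsSession := by
  induction A with
  | hole => exact hG ()
  | inp n l A ih =>
    obtain ⟨h1, h2, h3⟩ := isSession_inp.1 h
    exact isSession_inp.2 ⟨h1, h2, fun i => ih i (h3 i) fun k => hG ⟨i, k⟩⟩

/-- Replacing the output selections in the holes of a context by alternatives of theirs keeps the
type a session type. -/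
theorem fill_isSession_select {A : InCtx L} {q : A.Hole → ℕ} {l : ∀ k, Fin (q k) → L}
    {S : ∀ k, Fin (q k) → Ty L} (h : (A.fill fun k => out (q k) (l k) (S k)).IsSession)
    (j : ∀ k, Fin (q k)) : (A.fill fun k => S k (j k)).IsSession :=
  fill_isSession_congr h fun k => (isSession_out.1 (fill_isSession h k)).2.2 _

theorem fill_singleIn_select {A : InCtx L} {q : A.Hole → ℕ} {l : ∀ k, Fin (q k) → L}
    {S : ∀ k, Fin (q k) → Ty L} (h : (A.fill fun k => out (q k) (l k) (S k)).SingleIn)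
    (j : ∀ k, Fin (q k)) : (A.fill fun k => S k (j k)).SingleIn := by
  induction A with
  | hole => exact h _
  | inp n l A ih => exact ⟨h.1, fun i => ih i (h.2 i) fun k => j ⟨i, k⟩⟩

theorem treeEq_fill {A : InCtx L} {F G : A.Hole → Ty L} (h : ∀ k, TreeEq (F k) (G k)) :
    TreeEq (A.fill F) (A.fill G) := by
  induction A with
  | hole => exact h ()
  | inp n l A ih => exact treeEq_inp fun i => ih i fun k => h ⟨i, k⟩

theorem unfold_fill_out (m : ℕ) (A : InCtx L) (q : A.Hole → ℕ) (l : ∀ k, Fin (q k) → L)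
    (S : ∀ k, Fin (q k) → Ty L) : (A.fill fun k => out (q k) (l k) (S k)).unfold m =
      A.fill fun k => out (q k) (l k) fun j => (S k j).unfold m := by
  induction A with
  | hole => exact unfold_out _ _ _ _
  | inp n l A ih =>
    refine (unfold_inp _ _ _ _).trans ?_
    exact congrArg (inp n _) (funext fun i => ih i _ _ _)

/-- A session type whose tree consists of an input context and output selections in its holes is
brought into this form by finitely many unfoldings. -/
theorem IsSession.unfold_of_treeEq_fill {S : Ty L} (hS : S.IsSession) {A : InCtx L}
    {q : A.Hole → ℕ} {l : ∀ k, Fin (q k) → L} {S' : ∀ k, Fin (q k) → Ty L}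
    (h : TreeEq S (A.fill fun k => out (q k) (l k) (S' k))) :
    ∃ (n : ℕ) (S'' : ∀ k, Fin (q k) → Ty L), S.unfold n = A.fill (fun k => out (q k) (l k) (S'' k)) ∧
      ∀ k j, TreeEq (S'' k j) (S' k j) := by
  induction A generalizing S with
  | hole =>
    obtain ⟨n, T', hn, hT'⟩ := hS.unfold_of_treeEq_out h
    exact ⟨n, fun _ => T', hn, fun _ => hT'⟩
  | inp n l A ih =>
    obtain ⟨m, T', hm, hT'⟩ := hS.unfold_of_treeEq_inp h
    have hs : ∀ i, (T' i).IsSession := (isSession_inp.1 (hm ▸ hS.unfold m)).2.2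
    choose N S'' hN hS'' using fun i => ih i (hs i) (hT' i)
    refine ⟨m + Finset.univ.sup N, fun k j => (S'' k.1 k.2 j).unfold (Finset.univ.sup N - N k.1),
      ?_, ?_⟩
    · rw [unfold_add, hm, unfold_inp]
      refine congrArg (inp n _) (funext fun i => ?_)
      have : Finset.univ.sup N = N i + (Finset.univ.sup N - N i) :=
        (Nat.add_sub_cancel' (Finset.le_sup (Finset.mem_univ i))).symm
      conv_lhs => rw [this, unfold_add, hN i, unfold_fill_out]
    · intro k j
      have := fill_isSession (hN k.1 ▸ (hs k.1).unfold (N k.1)) k.2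
      exact (((isSession_out.1 this).2.2 j).treeEq_unfold _).trans (hS'' k.1 k.2 j)

/-! ### Simultaneous substitution -/

/-- Simultaneous substitution of the types `σ x` for the variables `x`. -/
def msubst : (ℕ → Option (Ty L)) → Ty L → Ty L
  | σ, out n l T => out n l fun i => msubst σ (T i)
  | σ, inp n l T => inp n l fun i => msubst σ (T i)
  | σ, mu x T => mu x (msubst (Function.update σ x none) T)
  | σ, var x => (σ x).getD (var x)
  | _, fin => fin

theorem msubst_none (T : Ty L) : msubst (fun _ => none) T = T := by
  induction T with
  | out n l T ih => simp only [msubst, ih]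
  | inp n l T ih => simp only [msubst, ih]
  | mu x T ih =>
    simp only [msubst]
    rw [Function.update_eq_self_iff.2 rfl, ih]
  | var x => rfl
  | fin => rfl

/-- All types substituted by `σ` are closed. -/
def ClosedEnv (σ : ℕ → Option (Ty L)) : Prop := ∀ x, ∀ U ∈ σ x, U.FreeIn ∅

theorem ClosedEnv.update {σ : ℕ → Option (Ty L)} (h : ClosedEnv σ) {x : ℕ} {o : Option (Ty L)}
    (ho : ∀ U ∈ o, U.FreeIn ∅) : ClosedEnv (Function.update σ x o) := by
  intro y U hU
  by_cases hy : y = x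
  · subst hy; rw [Function.update_self] at hU; exact ho U hU
  · rw [Function.update_of_ne hy] at hU; exact h y U hU

theorem subst_msubst {σ : ℕ → Option (Ty L)} (hσ : ClosedEnv σ) (x : ℕ) (U T : Ty L) :
    subst x U (msubst (Function.update σ x none) T) =
      msubst (Function.update σ x (some U)) T := by
  induction T generalizing σ with
  | out n l T ih => simp only [msubst, subst, ih _ hσ]
  | inp n l T ih => simp only [msubst, subst, ih _ hσ]
  | mu y T ih =>
    simp only [msubst, subst]
    split_ifs with hy
    · subst hy; simp only [Function.update_idem]
    · rw [Function.update_comm (Ne.symm hy), Function.update_comm (Ne.symm hy), ih (hσ.update (by simp))]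
  | var y =>
    simp only [msubst]
    by_cases hy : y = x
    · subst hy; simp [subst]
    · rw [Function.update_of_ne hy, Function.update_of_ne hy]
      cases hv : σ y with
      | none => simp [subst, hy]
      | some V => exact subst_eq_self _ (hσ y V hv) (by simp)
  | fin => rfl

/-! ### Types that emit an output after finitely many inputs -/

/-- Every path through the input branchings at the head of the type leads to an output
selection. A path that ends in a variable leads to no output, since it loops back to a recursion
without having passed one. -/
def Emits : Ty L → Prop
  | out _ _ _ => True
  | inp _ _ T => ∀ i, (T i).Emits
  | mu _ T => T.Emits
  | var _ => False
  | fin => False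

theorem Emits.of_subst {x : ℕ} {U T : Ty L} (hU : ¬ U.Emits) (h : (subst x U T).Emits) :
    T.Emits := by
  induction T with
  | out n l T ih => trivial
  | inp n l T ih => exact fun i => ih i (h i)
  | mu y T ih =>
    simp only [subst] at h
    split_ifs at h with hy
    · exact h
    · exact ih h
  | var y =>
    simp only [subst] at h
    split_ifs at h with hy
    exacts [(hU h).elim, h]
  | fin => exact h

theorem Emits.of_unfoldOnce {T : Ty L} (h : T.unfoldOnce.Emits) : T.Emits := by
  induction T with
  | out n l T ih => trivial
  | inp n l T ih => exact fun i => ih i (h i)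
  | mu x T ih =>
    by_contra hT
    exact hT (Emits.of_subst (T := T) hT h)
  | var y => exact h
  | fin => exact h

theorem Emits.of_unfold {T : Ty L} {n : ℕ} (h : (T.unfold n).Emits) : T.Emits := by
  induction n with
  | zero => exact h
  | succ n ih => exact ih h.of_unfoldOnce

theorem fill_out_emits (A : InCtx L) (q : A.Hole → ℕ) (l : ∀ k, Fin (q k) → L)
    (S : ∀ k, Fin (q k) → Ty L) : (A.fill fun k => out (q k) (l k) (S k)).Emits := by
  induction A with
  | hole => trivial
  | inp n l A ih => exact fun i => ih i _ _ _

/-- The environment `σ` collects the unfoldings of the recursions that have been passed. The types in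
it need not emit, because a variable on a path to an output is never met. -/
theorem Emits.exists_fill_msubst {T : Ty L} (h : T.Emits) {σ : ℕ → Option (Ty L)}
    (hσ : ClosedEnv σ) (hT : (msubst σ T).IsSession) :
    ∃ (A : InCtx L) (q : A.Hole → ℕ) (l : ∀ k, Fin (q k) → L) (S : ∀ k, Fin (q k) → Ty L),
      TreeEq (msubst σ T) (A.fill fun k => out (q k) (l k) (S k)) := by
  induction T generalizing σ with
  | out n l T ih =>
    exact ⟨InCtx.hole, fun _ => n, fun _ => l, fun _ i => msubst σ (T i), TreeEq.refl _⟩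
  | inp n l T ih =>
    choose A q l' S hA using fun i => ih i (h i) hσ ((isSession_inp.1 hT).2.2 i)
    exact ⟨InCtx.inp n l A, fun k => q k.1 k.2, fun k => l' k.1 k.2, fun k => S k.1 k.2,
      treeEq_inp hA⟩
  | mu x T ih =>
    have hσ' := hσ.update (x := x) (o := some (msubst σ (mu x T)))
      (by rintro U ⟨⟩; exact hT.closed)
    have key := subst_msubst hσ x (msubst σ (mu x T)) T
    obtain ⟨A, q, l, S, hA⟩ := ih h hσ' (key ▸ hT.subst_mu)
    exact ⟨A, q, l, S, ((treeEq_mu hT).symm.trans (key ▸ TreeEq.refl _)).trans hA⟩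
  | var x => exact h.elim
  | fin => exact h.elim

/-- The syntactic property `Emits` decides whether the tree of a session type consists of a finite
input context with output selections in its holes. -/
theorem IsSession.emits_iff {T : Ty L} (hT : T.IsSession) : T.Emits ↔
    ∃ (A : InCtx L) (q : A.Hole → ℕ) (l : ∀ k, Fin (q k) → L) (S : ∀ k, Fin (q k) → Ty L),
      TreeEq T (A.fill fun k => out (q k) (l k) (S k)) := by
  constructor
  · intro h
    have := h.exists_fill_msubst (σ := fun _ => none) (by intro x U hU; simp at hU)
      (by rwa [msubst_none])
    rwa [msubst_none] at this
  · rintro ⟨A, q, l, S, h⟩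
    obtain ⟨n, S', hn, -⟩ := hT.unfold_of_treeEq_fill h
    exact Emits.of_unfold (n := n) (hn ▸ fill_out_emits A q l S')

theorem IsSession.emits_congr {T S : Ty L} (hT : T.IsSession) (hS : S.IsSession)
    (h : TreeEq T S) : T.Emits ↔ S.Emits := by
  rw [hT.emits_iff, hS.emits_iff]
  constructor
  · rintro ⟨A, q, l, U, hU⟩; exact ⟨A, q, l, U, h.symm.trans hU⟩
  · rintro ⟨A, q, l, U, hU⟩; exact ⟨A, q, l, U, h.trans hU⟩

/-! ### Duality -/

theorem dual_dual (T : Ty L) : T.dual.dual = T := by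
  induction T <;> simp_all [dual]

theorem dual_subst (x : ℕ) (U T : Ty L) : (subst x U T).dual = subst x U.dual T.dual := by
  induction T with
  | out n l T ih => simp only [dual, subst, ih]
  | inp n l T ih => simp only [dual, subst, ih]
  | mu y T ih =>
    simp only [dual, subst]
    split_ifs with hy
    · rfl
    · simp only [dual, ih]
  | var y =>
    simp only [dual, subst]
    split_ifs <;> rfl
  | fin => rfl

theorem dual_unfoldOnce (T : Ty L) : T.unfoldOnce.dual = T.dual.unfoldOnce := by
  induction T with
  | out n l T ih => simp only [dual, unfoldOnce, ih]
  | inp n l T ih => simp only [dual, unfoldOnce, ih]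
  | mu y T ih => exact dual_subst _ _ _
  | var y => rfl
  | fin => rfl

theorem dual_unfold (T : Ty L) (n : ℕ) : (T.unfold n).dual = T.dual.unfold n := by
  induction n with
  | zero => rfl
  | succ n ih => exact (dual_unfoldOnce _).trans (congrArg unfoldOnce ih)

theorem dual_freeIn {T : Ty L} {Γ : Set ℕ} : T.dual.FreeIn Γ ↔ T.FreeIn Γ := by
  induction T generalizing Γ <;> simp_all [dual, FreeIn]

theorem dual_guardsVar {T : Ty L} {x : ℕ} : T.dual.GuardsVar x ↔ T.GuardsVar x := by
  induction T <;> simp_all [dual, GuardsVar]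

theorem dual_guarded {T : Ty L} : T.dual.Guarded ↔ T.Guarded := by
  induction T <;> simp_all [dual, Guarded, dual_guardsVar]

theorem dual_goodChoices {T : Ty L} : T.dual.GoodChoices ↔ T.GoodChoices := by
  induction T <;> simp_all [dual, GoodChoices]

theorem dual_singleIn {T : Ty L} : T.dual.SingleIn ↔ T.SingleOut := by
  induction T <;> simp_all [dual, SingleIn, SingleOut]

theorem dual_singleOut {T : Ty L} : T.dual.SingleOut ↔ T.SingleIn := by
  rw [← dual_singleIn, dual_dual]

theorem IsSession.dual {T : Ty L} (h : T.IsSession) : T.dual.IsSession :=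
  ⟨dual_freeIn.2 h.closed, dual_guarded.2 h.guarded, dual_goodChoices.2 h.choices⟩

theorem dual_isSession {T : Ty L} : T.dual.IsSession ↔ T.IsSession :=
  ⟨fun h => dual_dual T ▸ h.dual, IsSession.dual⟩

/-- Exchange of outputs and inputs at a node. -/
def Node.dual : Node L → Node L
  | Node.out n l => Node.inp n l
  | Node.inp n l => Node.out n l
  | Node.fin => Node.fin
  | Node.bot => Node.bot

theorem tree_dual {T : Ty L} (hT : T.IsSession) (p : List ℕ) :
    tree p T.dual = (tree p T).dual := by
  induction p generalizing T with
  | nil =>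
    refine IsSession.head_induction (motive := fun T => tree [] T.dual = (tree [] T).dual)
      (fun _ _ _ _ => rfl) (fun _ _ _ _ => rfl) ?_ rfl hT
    intro x T h ih
    rw [← treeEq_mu h, ← ih, dual_subst]
    exact (treeEq_mu h.dual []).symm
  | cons i p ih =>
    refine IsSession.head_induction
      (motive := fun T => tree (i :: p) T.dual = (tree (i :: p) T).dual) ?_ ?_ ?_ rfl hT
    · intro n l T h
      change (if h : i < n then tree p (T ⟨i, h⟩).dual else Node.bot) =
        (if h : i < n then tree p (T ⟨i, h⟩) else Node.bot).dual
      split_ifs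
      exacts [ih ((isSession_out.1 h).2.2 _), rfl]
    · intro n l T h
      change (if h : i < n then tree p (T ⟨i, h⟩).dual else Node.bot) =
        (if h : i < n then tree p (T ⟨i, h⟩) else Node.bot).dual
      split_ifs
      exacts [ih ((isSession_inp.1 h).2.2 _), rfl]
    · intro x T h ih'
      rw [← treeEq_mu h, ← ih', dual_subst]
      exact (treeEq_mu h.dual _).symm

theorem TreeEq.dual {T S : Ty L} (h : TreeEq T S) (hT : T.IsSession) (hS : S.IsSession) :
    TreeEq T.dual S.dual := fun p => by rw [tree_dual hT, tree_dual hS, h p]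

/-! ### Subtyping relations with a constraint on anticipated outputs -/

theorem _root_.SubtypeStep.mono {r : Restriction} {o : Bool} {R R' : Ty L → Ty L → Prop}
    (hR : ∀ T S, R T S → R' T S) {T S : Ty L} (h : SubtypeStep r o R T S) :
    SubtypeStep r o R' T S := by
  cases T with
  | out n l T =>
    obtain ⟨n, A, q, l', S', h1, h2, h3, h4, h5⟩ := h
    exact ⟨n, A, q, l', S', h1, h2, h3, fun i j hj => hR _ _ (h4 i j hj), h5⟩
  | inp n l T =>
    obtain ⟨n, q, l', S', h1, h2, h3, h4⟩ := h
    exact ⟨n, q, l', S', h1, h2, h3, fun i j hj => hR _ _ (h4 i j hj)⟩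
  | mu x T => exact hR _ _ h
  | var x => exact h
  | fin => exact h

/-- The tree of the type starts with an input branching. -/
def HeadInp (S : Ty L) : Prop := ∃ n l, tree [] S = Node.inp n l

theorem HeadInp.congr {S S' : Ty L} (h : HeadInp S) (hS : TreeEq S S') : HeadInp S' := by
  obtain ⟨n, l, h⟩ := h
  exact ⟨n, l, (hS []).symm.trans h⟩

theorem headInp_fill {A : InCtx L} (F : A.Hole → Ty L) (hA : A ≠ InCtx.hole) :
    HeadInp (A.fill F) := by
  cases A with
  | hole => exact (hA rfl).elim
  | inp n l A => exact ⟨n, _, rfl⟩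

theorem headInp_fill_iff {A : InCtx L} {q : A.Hole → ℕ} {l : ∀ k, Fin (q k) → L}
    {S : ∀ k, Fin (q k) → Ty L} :
    HeadInp (A.fill fun k => out (q k) (l k) (S k)) ↔ A ≠ InCtx.hole := by
  refine ⟨?_, headInp_fill _⟩
  rintro ⟨n, l, h⟩ rfl
  cases h

/-- The condition that a pair `(T, S)` has to meet in a relation `R`: both are session types, the
rules of subtyping hold (with equal labels of matched selections if `b` is true), and an output
may overtake inputs only if all its continuations satisfy `P`. -/
def SubCond (b : Bool) (P : Ty L → Prop) (R : Ty L → Ty L → Prop) (T S : Ty L) : Prop :=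
  T.IsSession ∧ S.IsSession ∧ SubtypeStep { tout := b } false R T S ∧
    ∀ n l T', T = out n l T' → HeadInp S → ∀ i, P (T' i)

/-- The largest relation whose pairs meet `SubCond`. -/
def Sub (b : Bool) (P : Ty L → Prop) (T S : Ty L) : Prop :=
  ∃ R : Ty L → Ty L → Prop, (∀ T S, R T S → SubCond b P R T S) ∧ R T S

theorem SubCond.mono {b : Bool} {P : Ty L → Prop} {R R' : Ty L → Ty L → Prop}
    (hR : ∀ T S, R T S → R' T S) {T S : Ty L} (h : SubCond b P R T S) : SubCond b P R' T S :=
  ⟨h.1, h.2.1, h.2.2.1.mono hR, h.2.2.2⟩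

theorem Sub.cond {b : Bool} {P : Ty L → Prop} {T S : Ty L} (h : Sub b P T S) :
    SubCond b P (Sub b P) T S := by
  obtain ⟨R, hR, h⟩ := h
  exact (hR _ _ h).mono fun T S h => ⟨R, hR, h⟩

theorem SubCond.sub {b : Bool} {P : Ty L → Prop} {T S : Ty L} (h : SubCond b P (Sub b P) T S) :
    Sub b P T S := by
  refine ⟨fun T S => SubCond b P (Sub b P) T S, fun T S h => ?_, h⟩
  exact h.mono fun T S h => h.cond

theorem _root_.SubtypeStep.singleIn {r : Restriction} {o : Bool} {R : Ty L → Ty L → Prop}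
    {T S : Ty L} (h : SubtypeStep r o R T S) (hT : T.SingleIn) (hS : S.SingleIn) :
    SubtypeStep r o (fun T S => R T S ∧ T.SingleIn ∧ S.SingleIn) T S := by
  cases T with
  | out n l T =>
    obtain ⟨n, A, q, l', S', h1, h2, h3, h4, h5⟩ := h
    exact ⟨n, A, q, l', S', h1, h2, h3, fun i j hj => ⟨h4 i j hj, hT i,
      fill_singleIn_select (h1 ▸ hS.unfold n) j⟩, h5⟩
  | inp n l T =>
    obtain ⟨n, q, l', S', h1, h2, h3, h4⟩ := h
    have := h1 ▸ hS.unfold n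
    exact ⟨n, q, l', S', h1, h2, h3, fun i j hj => ⟨h4 i j hj, hT.2 i, this.2 j⟩⟩
  | mu x T => exact ⟨h, SingleIn.subst (T := T) hT hT, hS⟩
  | var x => exact h
  | fin => exact h

theorem fill_singleOut_select {A : InCtx L} {q : A.Hole → ℕ} {l : ∀ k, Fin (q k) → L}
    {S : ∀ k, Fin (q k) → Ty L} (h : (A.fill fun k => out (q k) (l k) (S k)).SingleOut)
    (j : ∀ k, Fin (q k)) : (A.fill fun k => S k (j k)).SingleOut := by
  induction A with
  | hole => exact h.2 _
  | inp n l A ih => exact fun i => ih i (h i) fun k => j ⟨i, k⟩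

theorem SingleOut.unfold {T : Ty L} (h : T.SingleOut) (n : ℕ) : (T.unfold n).SingleOut := by
  rw [← dual_singleIn, dual_unfold]
  exact (dual_singleIn.2 h).unfold n

theorem _root_.SubtypeStep.singleOut {r : Restriction} {o : Bool} {R : Ty L → Ty L → Prop}
    {T S : Ty L} (h : SubtypeStep r o R T S) (hT : T.SingleOut) (hS : S.SingleOut) :
    SubtypeStep r o (fun T S => R T S ∧ T.SingleOut ∧ S.SingleOut) T S := by
  cases T with
  | out n l T =>
    obtain ⟨n, A, q, l', S', h1, h2, h3, h4, h5⟩ := h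
    exact ⟨n, A, q, l', S', h1, h2, h3, fun i j hj => ⟨h4 i j hj, hT.2 i,
      fill_singleOut_select (h1 ▸ hS.unfold n) j⟩, h5⟩
  | inp n l T =>
    obtain ⟨n, q, l', S', h1, h2, h3, h4⟩ := h
    have := h1 ▸ hS.unfold n
    exact ⟨n, q, l', S', h1, h2, h3, fun i j hj => ⟨h4 i j hj, hT i, this j⟩⟩
  | mu x T =>
    refine ⟨h, ?_, hS⟩
    rw [← dual_singleIn, dual_subst]
    exact SingleIn.subst (dual_singleIn.2 hT) (dual_singleIn.2 hT)
  | var x => exact h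
  | fin => exact h

/-- The no orphan message constraint can be separated from the other rules. -/
theorem subtypeStep_orphan_iff {r : Restriction} {R : Ty L → Ty L → Prop} {T S : Ty L}
    (hS : S.IsSession) : SubtypeStep r true R T S ↔ SubtypeStep r false R T S ∧
      ∀ n l T', T = out n l T' → HeadInp S → ∀ i, (T' i).HasInput := by
  cases T with
  | out n l T =>
    constructor
    · rintro ⟨n, A, q, l', S', h1, h2, h3, h4, h5⟩
      refine ⟨⟨n, A, q, l', S', h1, h2, h3, h4, by simp⟩, ?_⟩
      rintro n' l'' T' ⟨⟩ hi
      exact h5 rfl (headInp_fill_iff.1 (h1 ▸ hi.congr (hS.treeEq_unfold n).symm))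
    · rintro ⟨⟨n, A, q, l', S', h1, h2, h3, h4, -⟩, h⟩
      refine ⟨n, A, q, l', S', h1, h2, h3, h4, fun _ hA => h _ _ _ rfl ?_⟩
      exact HeadInp.congr (h1 ▸ headInp_fill_iff.2 hA) (hS.treeEq_unfold n)
  | _ => exact ⟨fun h => ⟨h, by simp⟩, fun h => h.1⟩

theorem asyncSubtype_singleIn_iff {b : Bool} {T S : Ty L} :
    AsyncSubtype { sin := true, tout := b } T S ↔
      Sub b HasInput T S ∧ T.SingleIn ∧ S.SingleIn := by
  constructor
  · rintro ⟨R, hR, h⟩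
    refine ⟨⟨R, fun T S h => ?_, h⟩, (hR _ _ h).2.2.1 rfl⟩
    obtain ⟨hT, hS, -, -, hst⟩ := hR _ _ h
    obtain ⟨h1, h2⟩ := (subtypeStep_orphan_iff hS).1 hst
    exact ⟨hT, hS, h1, h2⟩
  · intro h
    refine ⟨fun T S => Sub b HasInput T S ∧ T.SingleIn ∧ S.SingleIn, fun T S h => ?_, h⟩
    obtain ⟨hT, hS, h1, h2⟩ := h.1.cond
    exact ⟨hT, hS, fun _ => h.2, by simp, (subtypeStep_orphan_iff hS).2
      ⟨SubtypeStep.singleIn h1 h.2.1 h.2.2, h2⟩⟩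

/-- Every path through the output selections at the head of the type leads to an input. -/
def EmitsDual (T : Ty L) : Prop := T.dual.Emits

theorem EmitsDual.hasInput {T : Ty L} (hT : T.GoodChoices) (h : T.EmitsDual) : T.HasInput := by
  induction T with
  | out n l T ih => exact ⟨⟨0, hT.1⟩, ih _ (hT.2.2 _) (h _)⟩
  | inp n l T ih => trivial
  | mu x T ih => exact ih hT h
  | var x => exact h
  | fin => exact h

theorem HasInput.emitsDual {T : Ty L} (hT : T.SingleOut) (h : T.HasInput) : T.EmitsDual := by
  induction T with
  | out n l T ih =>
    obtain ⟨rfl, hT⟩ := hT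
    obtain ⟨i, hi⟩ := h
    intro j
    rw [Subsingleton.elim j i]
    exact ih i (hT i) hi
  | inp n l T ih => trivial
  | mu x T ih => exact ih hT h
  | var x => exact h
  | fin => exact h

/-- On single-out types the no orphan message constraint says that an input is reached on all
paths, since there is just one path through the outputs. -/
theorem asyncSubtype_singleOut_iff {T S : Ty L} : AsyncSubtype { sout := true } T S ↔
    Sub false EmitsDual T S ∧ T.SingleOut ∧ S.SingleOut := by
  constructor
  · rintro ⟨R, hR, h⟩
    refine ⟨⟨R, fun T S h => ?_, h⟩, (hR _ _ h).2.2.2.1 rfl⟩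
    obtain ⟨hT, hS, -, hso, hst⟩ := hR _ _ h
    obtain ⟨h1, h2⟩ := (subtypeStep_orphan_iff hS).1 hst
    refine ⟨hT, hS, h1, ?_⟩
    rintro n l T' rfl hi i
    exact (h2 _ _ _ rfl hi i).emitsDual ((hso rfl).1.2 i)
  · intro h
    refine ⟨fun T S => Sub false EmitsDual T S ∧ T.SingleOut ∧ S.SingleOut,
      fun T S h => ?_, h⟩
    obtain ⟨hT, hS, h1, h2⟩ := h.1.cond
    refine ⟨hT, hS, by simp, fun _ => h.2, (subtypeStep_orphan_iff hS).2
      ⟨SubtypeStep.singleOut h1 h.2.1 h.2.2, ?_⟩⟩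
    rintro n l T' rfl hi i
    exact (h2 _ _ _ rfl hi i).hasInput (hT.choices.2.2 i)

/-- The recursions at the head of the subtype can be unfolded, as the rule for recursions does. -/
theorem Sub.head {b : Bool} {P : Ty L → Prop} {T S : Ty L} (h : Sub b P T S) :
    ∃ T', T'.headMus = 0 ∧ TreeEq T' T ∧ Sub b P T' S := by
  refine IsSession.head_induction (motive := fun T => Sub b P T S →
    ∃ T', T'.headMus = 0 ∧ TreeEq T' T ∧ Sub b P T' S) ?_ ?_ ?_ ?_ h.cond.1 h
  · exact fun n l T _ h => ⟨_, rfl, TreeEq.refl _, h⟩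
  · exact fun n l T _ h => ⟨_, rfl, TreeEq.refl _, h⟩
  · intro x T hT ih h
    obtain ⟨T', h1, h2, h3⟩ := ih h.cond.2.2.1
    exact ⟨T', h1, h2.trans (treeEq_mu hT), h3⟩
  · exact fun h => ⟨_, rfl, TreeEq.refl _, h⟩

theorem eq_out_of_headMus {T : Ty L} {n : ℕ} {l : Fin n → L} (h : T.headMus = 0)
    (ht : tree [] T = Node.out n l) : ∃ T', T = out n l T' := by
  cases T <;> simp [headMus, tree, hnf] at h ht
  obtain ⟨rfl, h⟩ := ht
  cases h
  exact ⟨_, rfl⟩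

theorem eq_inp_of_headMus {T : Ty L} {n : ℕ} {l : Fin n → L} (h : T.headMus = 0)
    (ht : tree [] T = Node.inp n l) : ∃ T', T = inp n l T' := by
  cases T <;> simp [headMus, tree, hnf] at h ht
  obtain ⟨rfl, h⟩ := ht
  cases h
  exact ⟨_, rfl⟩

theorem eq_fin_of_headMus {T : Ty L} (h : T.headMus = 0)
    (ht : tree [] T = Node.fin) : T = fin := by
  cases T <;> simp [headMus, tree, hnf] at h ht
  rfl

/-- `Sub` depends only on the trees of the two types if the constraint on outputs does. -/
theorem Sub.congr {b : Bool} {P : Ty L → Prop}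
    (hP : ∀ T T' : Ty L, T.IsSession → T'.IsSession → TreeEq T T' → P T → P T') {T T' S S' : Ty L}
    (h : Sub b P T S) (hT' : T'.IsSession) (hS' : S'.IsSession) (hT : TreeEq T' T)
    (hS : TreeEq S' S) : Sub b P T' S' := by
  refine ⟨fun T' S' => T'.IsSession ∧ S'.IsSession ∧ ∃ T S, Sub b P T S ∧ TreeEq T' T ∧
    TreeEq S' S, ?_, hT', hS', T, S, h, hT, hS⟩
  clear h hT hS hT' hS' T T' S S'
  rintro T' S' ⟨hT', hS', T0, S, h, hT0, hS⟩
  obtain ⟨T, hT1, hT2, h⟩ := h.head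
  replace hT0 := hT0.trans hT2.symm
  obtain ⟨hsT, hsS, hst, hor⟩ := h.cond
  refine ⟨hT', hS', ?_, ?_⟩
  · cases T' with
    | out n l T' =>
      obtain ⟨T, rfl⟩ := eq_out_of_headMus hT1 (hT0 []).symm
      obtain ⟨m, A, q, l', U, h1, h2, h3, h4, -⟩ := hst
      obtain ⟨m', U', h1', hU⟩ := hS'.unfold_of_treeEq_fill
        (hS.trans (h1 ▸ (hsS.treeEq_unfold m).symm))
      refine ⟨m', A, q, l', U', h1', h2, h3, fun i j hj => ?_, by simp⟩
      exact ⟨(isSession_out.1 hT').2.2 i, fill_isSession_select (h1' ▸ hS'.unfold m') j, _, _,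
        h4 i j hj, hT0.out_inv i, treeEq_fill fun k => hU k (j k)⟩
    | inp n l T' =>
      obtain ⟨T, rfl⟩ := eq_inp_of_headMus hT1 (hT0 []).symm
      obtain ⟨m, q, l', U, h1, h2, h3, h4⟩ := hst
      obtain ⟨m', U', h1', hU⟩ := hS'.unfold_of_treeEq_inp
        (hS.trans (h1 ▸ (hsS.treeEq_unfold m).symm))
      refine ⟨m', q, l', U', h1', h2, h3, fun i j hj => ?_⟩
      exact ⟨(isSession_inp.1 hT').2.2 i, (isSession_inp.1 (h1' ▸ hS'.unfold m')).2.2 j, _, _,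
        h4 i j hj, hT0.inp_inv i, hU j⟩
    | mu x T' => exact ⟨hT'.subst_mu, hS', _, _, h, (treeEq_mu hT').trans hT0, hS⟩
    | var x => exact absurd hT'.closed (by simp [FreeIn])
    | fin =>
      have := eq_fin_of_headMus hT1 (hT0 []).symm
      subst this
      obtain ⟨m, hm⟩ := hst
      refine hS'.unfold_eq_fin ((hS []).trans (((hsS.treeEq_unfold m).symm []).trans ?_))
      rw [hm]
      rfl
  · rintro n l T' rfl hi i
    obtain ⟨T, rfl⟩ := eq_out_of_headMus hT1 (hT0 []).symm
    exact hP _ _ ((isSession_out.1 hsT).2.2 i) ((isSession_out.1 hT').2.2 i)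
      (hT0.out_inv i).symm (hor _ _ _ rfl (hi.congr hS) i)

theorem emitsDual_congr (T T' : Ty L) (hT : T.IsSession) (hT' : T'.IsSession) (h : TreeEq T T') :
    T.EmitsDual → T'.EmitsDual :=
  (hT.dual.emits_congr hT'.dual (h.dual hT hT')).1

/-! ### Dual closed subtyping -/

/-- The relation `Sub` that turns out to be dual closed subtyping. -/
abbrev DSub (T S : Ty L) : Prop := Sub false EmitsDual T S

theorem DSub.congr {T T' S S' : Ty L} (h : DSub T S) (hT' : T'.IsSession) (hS' : S'.IsSession)
    (hT : TreeEq T' T) (hS : TreeEq S' S) : DSub T' S' :=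
  Sub.congr emitsDual_congr h hT' hS' hT hS

theorem DSub.emitsDual {T S : Ty L} (h : DSub T S) (hS : HeadInp S) : T.EmitsDual := by
  refine IsSession.head_induction (motive := fun T => DSub T S → T.EmitsDual) ?_ ?_ ?_ ?_
    h.cond.1 h
  · exact fun n l T _ h => h.cond.2.2.2 n l T rfl hS
  · exact fun n l T _ h => trivial
  · exact fun x T hT ih h => emitsDual_congr _ _ hT.subst_mu hT (treeEq_mu hT) (ih h.cond.2.2.1)
  · intro h
    obtain ⟨n, hn⟩ := h.cond.2.2.1
    obtain ⟨n', l', h'⟩ := hS.congr (h.cond.2.1.treeEq_unfold n).symm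
    rw [hn] at h'
    cases h'

/-- If the supertype starts with an input, then every path through the head outputs of the subtype
leads to a matching input, and that input may be consumed ahead of the outputs. -/
theorem DSub.exists_fill {T S : Ty L} (h : DSub T S) {q : ℕ} {l : Fin q → L} {S' : Fin q → Ty L}
    (hS : TreeEq S (inp q l S')) (hS' : ∀ j, (S' j).IsSession) :
    ∃ (A : InCtx L) (qA : A.Hole → ℕ) (lA : ∀ k, Fin (qA k) → L) (T' : ∀ k, Fin (qA k) → Ty L),
      TreeEq T.dual (A.fill fun k => out (qA k) (lA k) (T' k)) ∧
      (∀ k, Set.range l ⊆ Set.range (lA k)) ∧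
      ∀ (j : Fin q) (jA : ∀ k, Fin (qA k)), (∀ k, lA k (jA k) = l j) →
        DSub (A.fill fun k => T' k (jA k)).dual (S' j) := by
  obtain ⟨A, qA, lA, U, hA⟩ := (h.cond.1.dual.emits_iff).1 (h.emitsDual ⟨q, l, hS []⟩)
  induction A generalizing T S S' with
  | hole =>
    obtain ⟨n, T', hn, -⟩ := h.cond.1.dual.unfold_of_treeEq_out hA
    replace hn : T.unfold n = inp (qA ()) (lA ()) fun i => (T' i).dual := by
      rw [← dual_dual (T.unfold n), dual_unfold, hn]; rfl
    have hsT := h.cond.1.unfold n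
    have h' : DSub (T.unfold n) S :=
      h.congr hsT h.cond.2.1 (h.cond.1.treeEq_unfold n) (TreeEq.refl _)
    refine ⟨InCtx.hole, fun _ => qA (), fun _ => lA (), fun _ => T',
      ?_, ?_⟩
    · have := (h.cond.1.treeEq_unfold n).dual hsT h.cond.1
      rw [hn] at this
      simp only [dual, dual_dual] at this
      exact this.symm
    rw [hn] at h' hsT
    obtain ⟨m, q', l', S'', h1, h2, -, h4⟩ := h'.cond.2.2.1
    have he : TreeEq (inp q l S') (inp q' l' S'') :=
      hS.symm.trans (h1 ▸ (h.cond.2.1.treeEq_unfold m).symm)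
    obtain ⟨rfl, hl⟩ : q = q' ∧ HEq l l' := by
      have := he []
      simpa [tree, hnf, headMus] using this
    obtain rfl := eq_of_heq hl
    refine ⟨fun _ => h2, fun j jA hj => ?_⟩
    have := h4 (jA ()) j (hj ())
    exact DSub.congr this ((isSession_inp.1 hsT).2.2 _) (hS' j) (TreeEq.refl _) (he.inp_inv j)
  | inp n lT A ih =>
    obtain ⟨m, T', hm, hT'⟩ := h.cond.1.dual.unfold_of_treeEq_inp hA
    replace hm : T.unfold m = out n lT fun i => (T' i).dual := by
      rw [← dual_dual (T.unfold m), dual_unfold, hm]; rfl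
    have hsT := h.cond.1.unfold m
    have h' : DSub (T.unfold m) S :=
      h.congr hsT h.cond.2.1 (h.cond.1.treeEq_unfold m) (TreeEq.refl _)
    have hTd := (h.cond.1.treeEq_unfold m).dual hsT h.cond.1
    rw [hm] at h' hsT hTd
    simp only [dual, dual_dual] at hTd
    obtain ⟨k, B, qB, lB, S'', h1, h2, -, h4, -⟩ := h'.cond.2.2.1
    have hsB := h1 ▸ h.cond.2.1.unfold k
    have he : TreeEq (inp q l S') (B.fill fun k => out (qB k) (lB k) (S'' k)) :=
      hS.symm.trans (h1 ▸ (h.cond.2.1.treeEq_unfold k).symm)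
    cases B with
    | hole => cases he []
    | inp q' l' B =>
    obtain ⟨rfl, hl⟩ : q = q' ∧ HEq l l' := by
      have := he []
      simpa [tree, hnf, headMus, InCtx.fill] using this
    obtain rfl := eq_of_heq hl
    have hsB' := (isSession_inp.1 hsB).2.2
    -- the alternative of each selection of the supertype that carries the label `lT i`
    choose jB hjB using fun (i : Fin n) (k : (InCtx.inp q l B).Hole) => h2 k ⟨i, rfl⟩
    have hsel (i : Fin n) (j : Fin q) : ((B j).fill fun k => S'' ⟨j, k⟩ (jB i ⟨j, k⟩)).IsSession :=
      fill_isSession_select (hsB' j) fun k => jB i ⟨j, k⟩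
    choose A' q' l' U' hA' hr hsub using fun i => ih i (h4 i (jB i) (hjB i)) (TreeEq.refl _)
      (hsel i) (fun k => qA ⟨i, k⟩) (fun k => lA ⟨i, k⟩) (fun k => U ⟨i, k⟩)
      (by rw [dual_dual]; exact hT' i)
    refine ⟨InCtx.inp n lT A', fun k => q' k.1 k.2, fun k => l' k.1 k.2, fun k => U' k.1 k.2,
      ?_, fun k => hr k.1 k.2, fun j jA hj => ?_⟩
    · refine hTd.symm.trans (treeEq_inp fun i => ?_)
      have := hA' i
      rwa [dual_dual] at this
    · have hX (i : Fin n) := hsub i j (fun k => jA ⟨i, k⟩) fun k => hj ⟨i, k⟩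
      obtain ⟨hn1, hinj, -⟩ := isSession_out.1 hsT
      have heB := he.inp_inv j
      obtain ⟨k', V, hk', hV⟩ := (hS' j).unfold_of_treeEq_fill heB
      refine SubCond.sub ⟨isSession_out.2 ⟨hn1, hinj, fun i => (hX i).cond.1⟩, hS' j,
        ⟨k', B j, fun k => qB ⟨j, k⟩, fun k => lB ⟨j, k⟩, V, hk', fun k => h2 ⟨j, k⟩, by simp,
          fun i j' hj' => ?_, by simp⟩, ?_⟩
      · have hjj (k) : j' k = jB i ⟨j, k⟩ :=
          (isSession_out.1 (fill_isSession (hsB' j) k)).2.1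
            ((hj' k).trans (hjB i ⟨j, k⟩).symm)
        refine (hX i).congr (hX i).cond.1 (fill_isSession_select (hk' ▸ (hS' j).unfold k') j')
          (TreeEq.refl _) (treeEq_fill fun k => ?_)
        rw [hjj k]
        exact hV k _
      · rintro n' l'' T'' ⟨⟩ hi i
        refine (hX i).emitsDual ?_
        exact headInp_fill _ (headInp_fill_iff.1 (hi.congr heB))

/-- The dual of a pair in `DSub` meets the rules. The case that matters is an input at the head of the
supertype, where the dual is an output that has to overtake the dual of the outputs of the
subtype; this is `DSub.exists_fill`. -/
theorem DSub.dual_step {T S : Ty L} (h : DSub T S) :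
    SubtypeStep {} false (fun S' T' => DSub T'.dual S'.dual) S.dual T.dual := by
  obtain ⟨hsT, hsS, -, -⟩ := h.cond
  cases S with
  | mu x S =>
    change DSub T.dual.dual (subst x (mu x S.dual) S.dual).dual
    have : (subst x (mu x S.dual) S.dual).dual = subst x (mu x S) S := by
      rw [dual_subst]; simp only [dual, dual_dual]
    rw [this, dual_dual]
    exact h.congr hsT hsS.subst_mu (TreeEq.refl _) (treeEq_mu hsS)
  | var x => exact absurd hsS.closed (by simp [FreeIn])
  | fin =>
    have key (k : ℕ) : DSub (T.unfold k) fin :=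
      h.congr (hsT.unfold k) hsS (hsT.treeEq_unfold k) (TreeEq.refl _)
    have hf (n : ℕ) : (fin : Ty L).unfold n = fin := by
      induction n with
      | zero => rfl
      | succ n ih => exact congrArg unfoldOnce ih
    rcases hsT.exists_unfold with ⟨k, n, l, T', hk⟩ | ⟨k, n, l, T', hk⟩ | ⟨k, hk⟩
    · have := hk ▸ key k
      obtain ⟨m, A, q, l', U, h1, -⟩ := this.cond.2.2.1
      rw [hf] at h1
      cases A <;> cases h1
    · have := hk ▸ key k
      obtain ⟨m, q, l', U, h1, -⟩ := this.cond.2.2.1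
      rw [hf] at h1
      cases h1
    · exact ⟨k, by rw [← dual_unfold, hk]; rfl⟩
  | out m l S =>
    have key (k : ℕ) : DSub (T.unfold k) (out m l S) :=
      h.congr (hsT.unfold k) hsS (hsT.treeEq_unfold k) (TreeEq.refl _)
    rcases hsT.exists_unfold with ⟨k, n, lT, T', hk⟩ | ⟨k, n, lT, T', hk⟩ | ⟨k, hk⟩
    · have hkk := hk ▸ key k
      obtain ⟨n', A, q, l', U, h1, h2, -, h4, -⟩ := hkk.cond.2.2.1
      rw [unfold_out] at h1
      cases A with
      | inp _ _ _ => cases h1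
      | hole =>
      refine ⟨k, n, lT, fun i => (T' i).dual, by rw [← dual_unfold, hk]; rfl, ?_, by simp, ?_⟩
      · have main : ∀ (Q : ℕ) (lQ : Fin Q → L) (UQ : Fin Q → Ty L),
            out m l (fun i => (S i).unfold n') = out Q lQ UQ → Set.range lT ⊆ Set.range lQ →
              Set.range lT ⊆ Set.range l := by
          rintro Q lQ UQ ⟨⟩ h
          exact h
        exact main _ _ _ h1 (h2 ())
      · have main : ∀ (Q : ℕ) (lQ : Fin Q → L) (UQ : Fin Q → Ty L),
            out m l (fun i => (S i).unfold n') = out Q lQ UQ →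
            (∀ i j, lQ j = lT i → DSub (T' i) (UQ j)) →
              ∀ j i, l j = lT i → DSub (T' i) ((S j).unfold n') := by
          rintro Q lQ UQ ⟨⟩ h
          exact fun j i => h i j
        intro j i hij
        simp only [dual_dual]
        have hS := (isSession_out.1 hsS).2.2 j
        have := main _ _ _ h1 (fun i j hj => h4 i (fun _ => j) fun _ => hj) j i hij
        exact this.congr this.cond.1 hS (TreeEq.refl _) (hS.treeEq_unfold n').symm
    · have := hk ▸ key k
      obtain ⟨m', q, l', U, h1, -⟩ := this.cond.2.2.1
      rw [unfold_out] at h1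
      cases h1
    · have := hk ▸ key k
      obtain ⟨m', hm⟩ := this.cond.2.2.1
      rw [unfold_out] at hm
      cases hm
  | inp m l S =>
    obtain ⟨A, q, lA, T', h1, h2, h3⟩ := h.exists_fill (TreeEq.refl _) (isSession_inp.1 hsS).2.2
    obtain ⟨n, V, hV, hV'⟩ := hsT.dual.unfold_of_treeEq_fill h1
    refine ⟨n, A, q, lA, V, hV, h2, by simp, fun j jA hj => ?_, by simp⟩
    have := h3 j jA hj
    simp only [dual_dual]
    have hs := fill_isSession_select (hV ▸ hsT.dual.unfold n) jA
    refine this.congr hs.dual ((isSession_inp.1 hsS).2.2 j) ?_ (TreeEq.refl _)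
    have h' := this.cond.1.dual
    rw [dual_dual] at h'
    exact (treeEq_fill fun k => hV' k (jA k)).dual hs h'

/-- Closure under duality amounts to the constraint `EmitsDual`: an output that overtakes inputs
belongs to a subtype whose dual has to find an output behind its inputs. -/
theorem dualClosedSubtype_iff {T S : Ty L} : DualClosedSubtype T S ↔ DSub T S := by
  constructor
  · rintro ⟨R, ⟨hd, hR⟩, h⟩
    refine ⟨R, fun T S h => ⟨(hR _ _ h).1, (hR _ _ h).2.1, (hR _ _ h).2.2, ?_⟩, h⟩
    rintro n l T' rfl hi i
    suffices h' : (out n l T').EmitsDual from h' i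
    obtain ⟨hsT, hsS, -⟩ := hR _ _ h
    -- the dual pair shows that the inputs of the supertype are matched on all paths
    refine IsSession.head_induction (motive := fun S => HeadInp S → R S.dual (out n l T').dual →
      (out n l T').EmitsDual) ?_ ?_ ?_ ?_ hsS hi (hd _ _ h)
    · rintro m l' S _ ⟨_, _, hi⟩ _
      cases hi
    · intro m l' S _ _ h
      obtain ⟨k, A, q, l'', S', h1, -⟩ := (hR _ _ h).2.2
      exact Emits.of_unfold (h1 ▸ fill_out_emits A _ _ _)
    · intro x S hS ih hi h
      refine ih (hi.congr (treeEq_mu hS).symm) ?_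
      rw [dual_subst]
      exact (hR _ _ h).2.2
    · rintro ⟨_, _, hi⟩ _
      cases hi
  · intro h
    refine ⟨fun T S => DSub T S ∨ DSub S.dual T.dual, ⟨?_, ?_⟩, Or.inl h⟩
    · rintro T S (h | h)
      · exact Or.inr (by rwa [dual_dual, dual_dual])
      · exact Or.inl h
    · rintro T S (h | h)
      · exact ⟨h.cond.1, h.cond.2.1, h.cond.2.2.1.mono fun _ _ h => Or.inl h⟩
      · refine ⟨dual_isSession.1 h.cond.2.1, dual_isSession.1 h.cond.1, ?_⟩
        have := h.dual_step
        rw [dual_dual, dual_dual] at this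
        exact this.mono fun _ _ h => Or.inr h

theorem DSub.dual {T S : Ty L} (h : DSub T S) : DSub S.dual T.dual := by
  rw [← dualClosedSubtype_iff] at h ⊢
  obtain ⟨R, hR, h⟩ := h
  exact ⟨R, hR, hR.1 _ _ h⟩

theorem dSub_dual_iff {T S : Ty L} : DSub S.dual T.dual ↔ DSub T S :=
  ⟨fun h => by simpa only [dual_dual] using h.dual, DSub.dual⟩

theorem isDualClosedSubtypingRel_sinOrSout :
    IsDualClosedSubtypingRel (L := L) DualClosedSinOrSout := by
  have hiff (T S : Ty L) : DualClosedSinOrSout T S ↔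
      (DSub T S ∧ T.SingleIn ∧ S.SingleIn) ∨ (DSub T S ∧ T.SingleOut ∧ S.SingleOut) := by
    simp only [DualClosedSinOrSout, dualClosedSubtype_iff]
  refine ⟨fun T S h => ?_, fun T S h => ?_⟩
  · rw [hiff] at h ⊢
    rcases h with ⟨h, hT, hS⟩ | ⟨h, hT, hS⟩
    · exact Or.inr ⟨h.dual, dual_singleOut.2 hS, dual_singleOut.2 hT⟩
    · exact Or.inl ⟨h.dual, dual_singleIn.2 hS, dual_singleIn.2 hT⟩
  · rcases (hiff _ _).1 h with ⟨h, hT, hS⟩ | ⟨h, hT, hS⟩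
    · exact ⟨h.cond.1, h.cond.2.1, (SubtypeStep.singleIn h.cond.2.2.1 hT hS).mono
        fun _ _ h => (hiff _ _).2 (Or.inl h)⟩
    · exact ⟨h.cond.1, h.cond.2.1, (SubtypeStep.singleOut h.cond.2.2.1 hT hS).mono
        fun _ _ h => (hiff _ _).2 (Or.inr h)⟩

/-! ### The queue machine for single-in types -/

/-- `pre w S` is the type `S` preceded by the inputs `w`, each of them without alternative. -/
def pre (w : List L) (S : Ty L) : Ty L := w.foldr (fun a U => inp 1 (fun _ => a) fun _ => U) S

/-- The input context without branching that consists of the inputs `w`. -/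
def chain (w : List L) : InCtx L :=
  w.foldr (fun a A => InCtx.inp 1 (fun _ => a) fun _ => A) InCtx.hole

theorem fill_chain (w : List L) (S : Ty L) : (chain w).fill (fun _ => S) = pre w S := by
  induction w with
  | nil => rfl
  | cons a w ih => exact congrArg (inp 1 _) (funext fun _ => ih)

theorem pre_append (w : List L) (a : L) (S : Ty L) :
    pre (w ++ [a]) S = pre w (inp 1 (fun _ => a) fun _ => S) := by
  simp [pre]

theorem pre_append' (w w' : List L) (S : Ty L) : pre (w ++ w') S = pre w (pre w' S) := by
  simp [pre]

theorem treeEq_pre (w : List L) {S S' : Ty L} (h : TreeEq S S') :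
    TreeEq (pre w S) (pre w S') := by
  induction w with
  | nil => exact h
  | cons a w ih => exact treeEq_inp fun _ => ih

theorem pre_isSession (w : List L) {S : Ty L} (h : S.IsSession) : (pre w S).IsSession := by
  induction w with
  | nil => exact h
  | cons a w ih =>
    exact isSession_inp.2 ⟨le_rfl, Function.injective_of_subsingleton _, fun _ => ih⟩

theorem pre_emits (w : List L) (S : Ty L) : (pre w S).Emits ↔ S.Emits := by
  induction w with
  | nil => rfl
  | cons a w ih => exact ⟨fun h => ih.1 (h 0), fun h _ => ih.2 h⟩

theorem inp_one_eq {l : Fin 1 → L} {S : Fin 1 → Ty L} (i : Fin 1) :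
    inp 1 l S = inp 1 (fun _ => l i) fun _ => S i := by
  congr <;> funext j <;> rw [Subsingleton.elim j i]

theorem headInp_pre_out {w : List L} {m : ℕ} {l : Fin m → L} {S : Fin m → Ty L} :
    HeadInp (pre w (out m l S)) ↔ w ≠ [] := by
  cases w with
  | nil =>
    refine ⟨?_, fun h => (h rfl).elim⟩
    rintro ⟨_, _, h⟩
    cases h
  | cons a w => exact ⟨fun _ => by simp, fun _ => ⟨1, _, rfl⟩⟩

end Ty

/-- A configuration of the queue machine: what is left of the subtype, the inputs of the supertype
that have been overtaken by outputs and are still pending, and the rest of the supertype. -/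
structure Conf (L : Type*) where
  sub : Ty L
  queue : List L
  sup : Ty L

namespace Conf

open Ty

variable {L : Type*}

/-- The moves of the queue machine. The subtype is in command: in order to answer an output, the
supertype first puts the inputs in front of its next output into the queue; an input is taken
from the queue, or from the supertype if the queue is empty. Unfolding a recursion is a move of
its own. The labels of inputs are not compared here, but in `Bad`. -/
inductive Move : Conf L → Conf L → Prop
  | mu (x T w S) : Move ⟨mu x T, w, S⟩ ⟨subst x (mu x T) T, w, S⟩
  | outMu (n l T w x S) : Move ⟨out n l T, w, mu x S⟩ ⟨out n l T, w, subst x (mu x S) S⟩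
  | outInp (n l T w m l' S i) :
      Move ⟨out n l T, w, inp m l' S⟩ ⟨out n l T, w ++ [l' i], S i⟩
  | outOut (n l T w m l' S i j) : l i = l' j → Move ⟨out n l T, w, out m l' S⟩ ⟨T i, w, S j⟩
  | pop (n l T a w S i) : Move ⟨inp n l T, a :: w, S⟩ ⟨T i, w, S⟩
  | inpMu (n l T x S) : Move ⟨inp n l T, [], mu x S⟩ ⟨inp n l T, [], subst x (mu x S) S⟩
  | inpInp (n l T m l' S i j) : Move ⟨inp n l T, [], inp m l' S⟩ ⟨T i, [], S j⟩
  | finMu (x S) : Move ⟨fin, [], mu x S⟩ ⟨fin, [], subst x (mu x S) S⟩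

/-- The configurations that violate a rule of subtyping. -/
inductive Bad (b : Bool) (P : Ty L → Prop) : Conf L → Prop
  | stuck (n l T w S) : ¬ S.Emits → Bad b P ⟨out n l T, w, S⟩
  | missing (n l T w m l' S i) : l i ∉ Set.range l' → Bad b P ⟨out n l T, w, out m l' S⟩
  | extra (n l T w m l' S j) : b = true → l' j ∉ Set.range l → Bad b P ⟨out n l T, w, out m l' S⟩
  | orphan (n l T w m l' S i) : w ≠ [] → ¬ P (T i) → Bad b P ⟨out n l T, w, out m l' S⟩
  | mismatch (n l T a w S i) : l i ≠ a → Bad b P ⟨inp n l T, a :: w, S⟩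
  | inpOut (n l T m l' S) : Bad b P ⟨inp n l T, [], out m l' S⟩
  | inpFin (n l T) : Bad b P ⟨inp n l T, [], fin⟩
  | inpInp (n l T m l' S i j) : l i ≠ l' j → Bad b P ⟨inp n l T, [], inp m l' S⟩
  | finQueue (a w S) : Bad b P ⟨fin, a :: w, S⟩
  | finOut (m l' S) : Bad b P ⟨fin, [], out m l' S⟩
  | finInp (m l' S) : Bad b P ⟨fin, [], inp m l' S⟩

/-- No violation can be reached in less than `k` moves. -/
def Safe (b : Bool) (P : Ty L → Prop) : ℕ → Conf L → Prop
  | 0, _ => True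
  | k + 1, c => ¬ Bad b P c ∧ ∀ c', Move c c' → Safe b P k c'

theorem Safe.not_bad {b : Bool} {P : Ty L → Prop} {c : Conf L} (h : ∀ k, Safe b P k c) :
    ¬ Bad b P c := (h 1).1

theorem Safe.move {b : Bool} {P : Ty L → Prop} {c c' : Conf L} (h : ∀ k, Safe b P k c)
    (hc : Move c c') (k : ℕ) : Safe b P k c' := (h (k + 1)).2 c' hc

end Conf

namespace Ty

open Conf

variable {L : Type*}

/-- A property that is preserved by unfolding recursions at the head can be transported to a type
with the same tree and no recursion at its head. -/
theorem exists_head {Q : Ty L → Prop} (hQ : ∀ x S, Q (mu x S) → Q (subst x (mu x S) S))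
    {S : Ty L} (hS : S.IsSession) (hi : S.SingleIn) (h : Q S) :
    ∃ S', S'.headMus = 0 ∧ TreeEq S S' ∧ S'.IsSession ∧ S'.SingleIn ∧ Q S' := by
  refine IsSession.head_induction (motive := fun S => S.SingleIn → Q S →
    ∃ S', S'.headMus = 0 ∧ TreeEq S S' ∧ S'.IsSession ∧ S'.SingleIn ∧ Q S')
    ?_ ?_ ?_ ?_ hS hi h
  · exact fun n l T h hi hq => ⟨_, rfl, TreeEq.refl _, h, hi, hq⟩
  · exact fun n l T h hi hq => ⟨_, rfl, TreeEq.refl _, h, hi, hq⟩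
  · intro x T hT ih hi hq
    obtain ⟨T', h1, h2, h3⟩ := ih (SingleIn.subst (T := T) hi hi) (hQ _ _ hq)
    exact ⟨T', h1, (treeEq_mu hT).symm.trans h2, h3⟩
  · exact fun hi hq => ⟨_, rfl, TreeEq.refl _, isSession_fin, hi, hq⟩

/-- If no violation is reachable, then the supertype reaches an output by putting its inputs into
the queue. -/
theorem safe_out_chain {b : Bool} {P : Ty L → Prop} {n : ℕ} {l : Fin n → L} {T : Fin n → Ty L}
    {w : List L} {S : Ty L} (hS : S.IsSession) (hi : S.SingleIn)
    (h : ∀ k, Safe b P k ⟨out n l T, w, S⟩) :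
    ∃ w' m l' S', (∀ k, Safe b P k ⟨out n l T, w ++ w', out m l' S'⟩) ∧
      TreeEq S (pre w' (out m l' S')) ∧ (out m l' S').IsSession ∧ (out m l' S').SingleIn := by
  have he : S.Emits := by
    by_contra he
    exact Safe.not_bad h (Bad.stuck _ _ _ _ _ he)
  obtain ⟨A, q, l', U, hA⟩ := hS.emits_iff.1 he
  clear he
  induction A generalizing w S with
  | hole =>
    obtain ⟨S1, h1, h2, h3, h4, h5⟩ := exists_head
      (Q := fun S => ∀ k, Safe b P k ⟨out n l T, w, S⟩)
      (fun x S h => Safe.move h (Move.outMu ..)) hS hi h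
    obtain ⟨S', rfl⟩ := eq_out_of_headMus h1 ((h2 []).symm.trans (hA []))
    exact ⟨[], _, _, S', by simpa using h5, h2, h3, h4⟩
  | inp m lA A ih =>
    obtain ⟨S1, h1, h2, h3, h4, h5⟩ := exists_head
      (Q := fun S => ∀ k, Safe b P k ⟨out n l T, w, S⟩)
      (fun x S h => Safe.move h (Move.outMu ..)) hS hi h
    obtain ⟨S', rfl⟩ := eq_inp_of_headMus h1 ((h2 []).symm.trans (hA []))
    obtain ⟨rfl, h4⟩ := h4
    obtain ⟨w', m', l', S'', h6, h7, h8⟩ := ih 0 ((isSession_inp.1 h3).2.2 0) (h4 0)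
      (Safe.move h5 (Move.outInp _ _ _ _ _ _ _ 0)) _ _ _ ((h2.symm.trans hA).inp_inv 0)
    refine ⟨lA 0 :: w', m', l', S'', by simpa using h6, h2.trans ?_, h8⟩
    rw [inp_one_eq 0]
    exact treeEq_inp fun _ => h7

/-- The pairs `(T, U)` such that `U` has the tree of `pre w S` for some configuration `⟨T, w, S⟩` from
which no violation is reachable form a relation whose pairs meet `SubCond`. -/
theorem sub_of_safe {b : Bool} {P : Ty L → Prop} {T S : Ty L} (hT : T.IsSession)
    (hTi : T.SingleIn) (hS : S.IsSession) (hSi : S.SingleIn)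
    (h : ∀ k, Safe b P k ⟨T, [], S⟩) : Sub b P T S := by
  refine ⟨fun T U => T.IsSession ∧ T.SingleIn ∧ U.IsSession ∧ ∃ w S, S.IsSession ∧ S.SingleIn ∧
    (∀ k, Safe b P k ⟨T, w, S⟩) ∧ TreeEq U (pre w S), ?_,
    hT, hTi, hS, [], S, hS, hSi, h, TreeEq.refl _⟩
  clear h hSi hS hTi hT T S
  rintro T U ⟨hT, hTi, hU, w, S, hS, hSi, h, hUS⟩
  cases T with
  | mu x T =>
    exact ⟨hT, hU, ⟨hT.subst_mu, SingleIn.subst (T := T) hTi hTi, hU, w, S, hS, hSi,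
      Safe.move h (Move.mu ..), hUS⟩, by simp⟩
  | var x => exact absurd hT.closed (by simp [FreeIn])
  | fin =>
    refine ⟨hT, hU, ?_, by simp⟩
    cases w with
    | cons a w => exact (Safe.not_bad h (Bad.finQueue ..)).elim
    | nil =>
    obtain ⟨S1, h1, h2, h3, h4, h5⟩ := exists_head (Q := fun S => ∀ k, Safe b P k ⟨fin, [], S⟩)
      (fun x S h => Safe.move h (Move.finMu ..)) hS hSi h
    refine hU.unfold_eq_fin ((hUS []).trans ((h2 []).trans ?_))
    cases S1 with
    | mu x S => simp [headMus] at h1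
    | var x => exact absurd h3.closed (by simp [FreeIn])
    | fin => rfl
    | out n l S => exact (Safe.not_bad h5 (Bad.finOut ..)).elim
    | inp n l S => exact (Safe.not_bad h5 (Bad.finInp ..)).elim
  | inp n l T =>
    refine ⟨hT, hU, ?_, by simp⟩
    obtain ⟨rfl, hTi⟩ := hTi
    have hsT := (isSession_inp.1 hT).2.2
    cases w with
    | cons a w =>
      obtain ⟨k, U', hk, hU'⟩ := hU.unfold_of_treeEq_inp hUS
      have hl (i) : l i = a := by
        by_contra hne
        exact Safe.not_bad h (Bad.mismatch _ _ _ _ _ _ i hne)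
      refine ⟨k, 1, fun _ => a, U', hk, ?_, by simp, fun i j _ => ⟨hsT i, hTi i, ?_, w, S, hS, hSi,
        Safe.move h (Move.pop ..), hU' j⟩⟩
      · rintro _ ⟨j, rfl⟩
        exact ⟨0, hl 0⟩
      · exact (isSession_inp.1 (hk ▸ hU.unfold k)).2.2 j
    | nil =>
      obtain ⟨S1, h1, h2, h3, h4, h5⟩ := exists_head
        (Q := fun S => ∀ k, Safe b P k ⟨inp 1 l T, [], S⟩)
        (fun x S h => Safe.move h (Move.inpMu ..)) hS hSi h
      cases S1 with
      | mu x S => simp [headMus] at h1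
      | var x => exact absurd h3.closed (by simp [FreeIn])
      | fin => exact (Safe.not_bad h5 (Bad.inpFin ..)).elim
      | out n l S => exact (Safe.not_bad h5 (Bad.inpOut ..)).elim
      | inp m l' S' =>
        obtain ⟨k, U', hk, hU'⟩ := hU.unfold_of_treeEq_inp (hUS.trans h2)
        have hl (j) : l 0 = l' j := by
          by_contra hne
          exact Safe.not_bad h5 (Bad.inpInp _ _ _ _ _ _ 0 j hne)
        refine ⟨k, m, l', U', hk, ?_, by simp, fun i j _ => ⟨hsT i, hTi i, ?_, [], S' j,
          (isSession_inp.1 h3).2.2 j, h4.2 j, Safe.move h5 (Move.inpInp ..), hU' j⟩⟩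
        · rintro _ ⟨j, rfl⟩
          exact ⟨0, hl j⟩
        · exact (isSession_inp.1 (hk ▸ hU.unfold k)).2.2 j
  | out n l T =>
    obtain ⟨w', m, l', S', h1, h2, h3, h4⟩ := safe_out_chain hS hSi h
    have hUS' : TreeEq U (pre (w ++ w') (out m l' S')) := by
      rw [pre_append']
      exact hUS.trans (treeEq_pre w h2)
    have hr : Set.range l ⊆ Set.range l' := by
      rintro _ ⟨i, rfl⟩
      by_contra hne
      exact Safe.not_bad h1 (Bad.missing _ _ _ _ _ _ _ i hne)
    refine ⟨hT, hU, ?_, ?_⟩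
    · obtain ⟨k, V, hk, hV⟩ := hU.unfold_of_treeEq_fill
        (A := chain (w ++ w')) (q := fun _ => m) (l := fun _ => l') (S' := fun _ => S')
        (by rwa [fill_chain])
      refine ⟨k, _, _, _, V, hk, fun _ => hr, ?_, ?_, by simp⟩
      · rintro hb -
        refine hr.antisymm ?_
        rintro _ ⟨j, rfl⟩
        by_contra hne
        exact Safe.not_bad h1 (Bad.extra _ _ _ _ _ _ _ j hb hne)
      · intro i j hj
        obtain ⟨j0, hj0⟩ := hr ⟨i, rfl⟩
        obtain rfl : j = fun _ => j0 :=
          funext fun k => (isSession_out.1 h3).2.1 ((hj k).trans hj0.symm)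
        refine ⟨(isSession_out.1 hT).2.2 i, hTi i, fill_isSession_select (hk ▸ hU.unfold k) _,
          w ++ w', S' j0, (isSession_out.1 h3).2.2 j0, h4 j0,
          Safe.move h1 (Move.outOut _ _ _ _ _ _ _ _ _ hj0.symm), ?_⟩
        rw [← fill_chain]
        exact treeEq_fill fun k => hV k j0
    · rintro _ _ _ ⟨⟩ hi i
      by_contra hP
      exact Safe.not_bad h1 (Bad.orphan _ _ _ _ _ _ _ i (headInp_pre_out.1 (hi.congr hUS')) hP)

theorem TreeEq.out_cases {n m : ℕ} {l : Fin n → L} {l' : Fin m → L} {T : Fin n → Ty L}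
    {S : Fin m → Ty L} (h : TreeEq (out n l T) (out m l' S)) :
    Set.range l = Set.range l' ∧ ∀ j, ∃ i, l i = l' j ∧ TreeEq (T i) (S j) := by
  obtain ⟨rfl, hl⟩ : n = m ∧ HEq l l' := by
    have := h []
    simpa [tree, hnf, headMus] using this
  obtain rfl := eq_of_heq hl
  exact ⟨rfl, fun j => ⟨j, rfl, h.out_inv j⟩⟩

/-- A context filled with selections whose tree is a chain of inputs followed by a selection. -/
theorem fill_treeEq_pre {A : InCtx L} {q : A.Hole → ℕ} {l : ∀ k, Fin (q k) → L}
    {S : ∀ k, Fin (q k) → Ty L} {w : List L} {m : ℕ} {l' : Fin m → L} {S' : Fin m → Ty L}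
    (h : TreeEq (A.fill fun k => out (q k) (l k) (S k)) (pre w (out m l' S'))) :
    Nonempty A.Hole ∧ (∀ k, Set.range (l k) = Set.range l') ∧
      ∀ j, ∃ jA : ∀ k, Fin (q k), (∀ k, l k (jA k) = l' j) ∧
        TreeEq (A.fill fun k => S k (jA k)) (pre w (S' j)) := by
  induction A generalizing w with
  | hole =>
    cases w with
    | cons a w => cases h []
    | nil =>
      obtain ⟨h1, h2⟩ := TreeEq.out_cases h
      refine ⟨⟨()⟩, fun _ => h1, fun j => ?_⟩
      obtain ⟨i, hi, hi'⟩ := h2 j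
      exact ⟨fun _ => i, fun _ => hi, hi'⟩
  | inp n lA A ih =>
    cases w with
    | nil => cases h []
    | cons a w =>
      obtain rfl : n = 1 := by
        have := h []
        simp only [tree, hnf, headMus, InCtx.fill, pre, List.foldr, Function.iterate_zero, id] at this
        injection this
      obtain rfl : lA = fun _ => a := by
        have := h []
        simp only [tree, hnf, headMus, InCtx.fill, pre, List.foldr, Function.iterate_zero, id] at this
        injection this
      have h' := fun i => ih i (h.inp_inv i)
      choose h1 h2 h3 using h'
      refine ⟨(h1 0).map fun k => ⟨0, k⟩, fun k => h2 k.1 k.2, fun j => ?_⟩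
      choose jA hj1 hj2 using fun i => h3 i j
      exact ⟨fun k => jA k.1 k.2, fun k => hj1 k.1 k.2, treeEq_inp hj2⟩

/-- Each move preserves subtyping of `T` and the type that the queue and the rest of the supertype
stand for, and no pair of subtypes is a violation. -/
theorem safe_of_sub {b : Bool} {P : Ty L → Prop} (k : ℕ) {T S U : Ty L} {w : List L}
    (h : Sub b P T U) (hTi : T.SingleIn) (hS : S.IsSession) (hSi : S.SingleIn)
    (hUS : TreeEq U (pre w S)) : Safe b P k ⟨T, w, S⟩ := by
  induction k generalizing T S U w with
  | zero => trivial
  | succ k ih =>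
    obtain ⟨hT, hU, hst, hor⟩ := h.cond
    -- the data that the rule for an input provides
    have hinp : ∀ {n : ℕ} {l : Fin n → L} {T' : Fin n → Ty L}, T = inp n l T' →
        ∀ {m : ℕ} {l' : Fin m → L} {S' : Fin m → Ty L}, m = 1 → TreeEq U (inp m l' S') →
        ∀ i j, l i = l' j ∧ ∃ U', Sub b P (T' i) U' ∧ TreeEq U' (S' j) := by
      rintro n l T' rfl m l' S' rfl hU' i j
      obtain ⟨rfl, -⟩ := hTi
      obtain ⟨r, q, l'', S'', h1, h2, -, h4⟩ := hst
      have he := hU'.symm.trans (h1 ▸ (hU.treeEq_unfold r).symm)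
      obtain ⟨rfl, hl⟩ : 1 = q ∧ HEq l' l'' := by
        have := he []
        simpa [tree, hnf, headMus] using this
      obtain rfl := eq_of_heq hl
      obtain ⟨i', hi'⟩ := h2 ⟨j, rfl⟩
      rw [Subsingleton.elim i' i] at hi'
      exact ⟨hi', S'' j, h4 i j hi', (he.inp_inv j).symm⟩
    refine ⟨fun hb => ?_, fun c' hc => ?_⟩
    · generalize hc : (⟨T, w, S⟩ : Conf L) = c at hb
      cases hb with
      | stuck n l T w S he =>
        cases hc
        obtain ⟨r, A, q, l', S', h1, -⟩ := hst
        refine he ((pre_emits w S).1 ((hU.emits_congr (pre_isSession w hS) hUS).1 ?_))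
        exact Emits.of_unfold (h1 ▸ fill_out_emits A q l' S')
      | missing n l T w m l' S i hi =>
        cases hc
        obtain ⟨r, A, q, l'', S', h1, h2, -⟩ := hst
        obtain ⟨⟨k⟩, hr, -⟩ := fill_treeEq_pre (h1 ▸ (hU.treeEq_unfold r).trans hUS)
        exact hi (hr k ▸ h2 k ⟨i, rfl⟩)
      | extra n l T w m l' S j hb hj =>
        cases hc
        obtain ⟨r, A, q, l'', S', h1, h2, h3, -⟩ := hst
        obtain ⟨⟨k⟩, hr, -⟩ := fill_treeEq_pre (h1 ▸ (hU.treeEq_unfold r).trans hUS)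
        exact hj (by rw [h3 hb k, hr k]; exact ⟨j, rfl⟩)
      | orphan n l T w m l' S i hw hP =>
        cases hc
        exact hP (hor _ _ _ rfl ((headInp_pre_out.2 hw).congr hUS.symm) i)
      | mismatch n l T a w S i hi =>
        cases hc
        exact hi (hinp rfl rfl hUS i 0).1
      | inpOut n l T m l' S =>
        cases hc
        obtain ⟨r, q, l'', S'', h1, -⟩ := hst
        have he := hUS.symm.trans (h1 ▸ (hU.treeEq_unfold r).symm)
        cases he []
      | inpFin n l T =>
        cases hc
        obtain ⟨r, q, l'', S'', h1, -⟩ := hst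
        have he := hUS.symm.trans (h1 ▸ (hU.treeEq_unfold r).symm)
        cases he []
      | inpInp n l T m l' S i j hi =>
        cases hc
        exact hi (hinp rfl hSi.1 hUS i j).1
      | finQueue a w S =>
        cases hc
        obtain ⟨r, h1⟩ := hst
        have he := hUS.symm.trans (h1 ▸ (hU.treeEq_unfold r).symm)
        cases he []
      | finOut m l S =>
        cases hc
        obtain ⟨r, h1⟩ := hst
        have he := hUS.symm.trans (h1 ▸ (hU.treeEq_unfold r).symm)
        cases he []
      | finInp m l S =>
        cases hc
        obtain ⟨r, h1⟩ := hst
        have he := hUS.symm.trans (h1 ▸ (hU.treeEq_unfold r).symm)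
        cases he []
    · generalize hd : (⟨T, w, S⟩ : Conf L) = c at hc
      cases hc with
      | mu x T w S =>
        cases hd
        exact ih hst (SingleIn.subst (T := T) hTi hTi) hS hSi hUS
      | outMu n l T w x S =>
        cases hd
        exact ih h hTi hS.subst_mu (SingleIn.subst (T := S) hSi hSi)
          (hUS.trans (treeEq_pre w (treeEq_mu hS).symm))
      | outInp n l T w m l' S i =>
        cases hd
        obtain ⟨rfl, hSi⟩ := hSi
        refine ih h hTi ((isSession_inp.1 hS).2.2 i) (hSi i) ?_
        rwa [pre_append, ← inp_one_eq i]
      | outOut n l T w m l' S i j hij =>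
        cases hd
        obtain ⟨r, A, q, l'', S', h1, h2, -, h4, -⟩ := hst
        obtain ⟨-, -, hr⟩ := fill_treeEq_pre (h1 ▸ (hU.treeEq_unfold r).trans hUS)
        obtain ⟨jA, hj1, hj2⟩ := hr j
        exact ih (h4 i jA fun k => (hj1 k).trans hij.symm) (hTi i)
          ((isSession_out.1 hS).2.2 j) (hSi j) hj2
      | pop n l T a w S i =>
        cases hd
        obtain ⟨-, U', h1, h2⟩ := hinp rfl rfl hUS i 0
        exact ih h1 (hTi.2 i) hS hSi h2
      | inpMu n l T x S =>
        cases hd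
        exact ih h hTi hS.subst_mu (SingleIn.subst (T := S) hSi hSi)
          (hUS.trans (treeEq_mu hS).symm)
      | inpInp n l T m l' S i j =>
        cases hd
        obtain ⟨-, U', h1, h2⟩ := hinp rfl hSi.1 hUS i j
        exact ih h1 (hTi.2 i) ((isSession_inp.1 hS).2.2 j) (hSi.2 j) h2
      | finMu x S =>
        cases hd
        exact ih h hTi hS.subst_mu (SingleIn.subst (T := S) hSi hSi)
          (hUS.trans (treeEq_mu hS).symm)

theorem sub_iff_safe {b : Bool} {P : Ty L → Prop} {T S : Ty L} (hT : T.IsSession)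
    (hTi : T.SingleIn) (hS : S.IsSession) (hSi : S.SingleIn) :
    Sub b P T S ↔ ∀ k, Safe b P k ⟨T, [], S⟩ :=
  ⟨fun h k => safe_of_sub k h hTi hS hSi (TreeEq.refl _), sub_of_safe hT hTi hS hSi⟩

end Ty

/-! ### Short runs of one-counter systems -/

/-- A system with a counter that can be tested for zero: transitions at counter value zero, which
keep or increment the counter, and transitions at positive counter values, which keep, increment
or decrement it. -/
structure OneCounter (Q : Type*) where
  start : Q
  zflat : Q → Q → Prop
  zup : Q → Q → Prop
  flat : Q → Q → Prop
  up : Q → Q → Prop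
  down : Q → Q → Prop

namespace OneCounter

variable {Q : Type*} (M : OneCounter Q)

/-- `M.Reach k q h`: the state `q` with counter value `h` is reached by a run of length `k`. -/
inductive Reach : ℕ → Q → ℕ → Prop
  | start : Reach 0 M.start 0
  | zflat {k p q} : Reach k p 0 → M.zflat p q → Reach (k + 1) q 0
  | zup {k p q} : Reach k p 0 → M.zup p q → Reach (k + 1) q 1
  | flat {k p q h} : Reach k p (h + 1) → M.flat p q → Reach (k + 1) q (h + 1)
  | up {k p q h} : Reach k p (h + 1) → M.up p q → Reach (k + 1) q (h + 2)
  | down {k p q h} : Reach k p (h + 1) → M.down p q → Reach (k + 1) q h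

/-- Excursions: runs of a given length at positive counter values that return to the value they
started from without going below it. -/
inductive Exc : ℕ → Q → Q → Prop
  | refl (p) : Exc 0 p p
  | flat {k p r q} : Exc k p r → M.flat r q → Exc (k + 1) p q
  | peak {k m p r s t q} : Exc k p r → M.up r s → Exc m s t → M.down t q → Exc (k + m + 2) p q

variable {M}

theorem Exc.reach {k : ℕ} {p q : Q} (he : M.Exc k p q) {j h : ℕ} (hr : M.Reach j p (h + 1)) :
    M.Reach (j + k) q (h + 1) := by
  induction he generalizing j h with
  | refl p => exact hr
  | flat _ hf ih => exact (ih hr).flat hf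
  | @peak k m _ _ _ _ _ _ hu _ hd ih ih' =>
    have := (ih' ((ih hr).up hu)).down hd
    rwa [show j + k + 1 + m + 1 = j + (k + m + 2) by ring] at this

variable (M) in
/-- The facts about runs of length at most `n`: there is an excursion from one state to another, a
state is reached with counter value zero, a state is reached with a positive counter value. -/
def Fact (n : ℕ) : (Q × Q) ⊕ Q ⊕ Q → Prop
  | Sum.inl (p, q) => ∃ k ≤ n, M.Exc k p q
  | Sum.inr (Sum.inl q) => ∃ k ≤ n, M.Reach k q 0
  | Sum.inr (Sum.inr q) => ∃ k ≤ n, ∃ h, M.Reach k q (h + 1)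

theorem Fact.mono {n m : ℕ} (hnm : n ≤ m) {x : (Q × Q) ⊕ Q ⊕ Q} (h : M.Fact n x) :
    M.Fact m x := by
  rcases x with ⟨p, q⟩ | q | q
  all_goals
    obtain ⟨k, hk, h⟩ := h
    exact ⟨k, hk.trans hnm, h⟩

/-- An increasing sequence of sets cannot grow at each of the first `card α + 1` steps. -/
theorem exists_stable {α : Type*} [Fintype α] {f : ℕ → Finset α} (hf : Monotone f) :
    ∃ i ≤ Fintype.card α, f (i + 1) = f i := by
  by_contra! h
  have key : ∀ i ≤ Fintype.card α + 1, i ≤ (f i).card := by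
    intro i
    induction i with
    | zero => simp
    | succ i ih =>
      intro hi
      have hlt : f i ⊂ f (i + 1) :=
        lt_of_le_of_ne (hf i.le_succ) (h i (by omega)).symm
      exact (ih (by omega)).trans_lt (Finset.card_lt_card hlt)
  have := (key _ le_rfl).trans (Finset.card_le_univ _)
  omega

variable (M) in
/-- The structure of a run that ends with counter value `h`: for each level below `h` the last
transition that leaves it upwards, followed by an excursion. -/
def Good (n : ℕ) : ℕ → Q → Prop
  | 0, q => M.Fact n (Sum.inr (Sum.inl q))
  | h + 1, q => ∃ p r, Good n h p ∧ ((h = 0 ∧ M.zup p r) ∨ (h ≠ 0 ∧ M.up p r)) ∧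
      M.Fact n (Sum.inl (r, q))

/-- If the length bounds `n` and `2 * n + 2` admit the same facts, then every run can be replaced
by one of length at most `n`. -/
theorem Reach.good {n : ℕ} (hn : ∀ x, M.Fact (2 * n + 2) x → M.Fact n x) {k h : ℕ} {q : Q}
    (hr : M.Reach k q h) : M.Good n h q := by
  induction hr with
  | start => exact ⟨0, Nat.zero_le _, Reach.start⟩
  | @zflat k p q _ hz ih =>
    obtain ⟨k', hk', h'⟩ := ih
    exact hn _ ⟨k' + 1, by omega, h'.zflat hz⟩
  | @zup k p q _ hz ih =>
    exact ⟨p, q, ih, Or.inl ⟨rfl, hz⟩, 0, Nat.zero_le _, Exc.refl _⟩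
  | @flat k p q h _ hf ih =>
    obtain ⟨p', r, h1, h2, k', hk', h3⟩ := ih
    exact ⟨p', r, h1, h2, hn _ ⟨k' + 1, by omega, h3.flat hf⟩⟩
  | @up k p q h _ hu ih =>
    exact ⟨p, q, ih, Or.inr ⟨by omega, hu⟩, 0, Nat.zero_le _, Exc.refl _⟩
  | @down k p q h _ hd ih =>
    obtain ⟨p', r, h1, h2, k', hk', h3⟩ := ih
    cases h with
    | zero =>
      obtain ⟨j, hj, h1⟩ := h1
      have hz : M.zup p' r := by simpa using h2
      exact hn _ ⟨j + 1 + k' + 1, by omega, (h3.reach (h1.zup hz)).down hd⟩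
    | succ h =>
      obtain ⟨p'', r', h4, h5, j, hj, h6⟩ := h1
      have hu : M.up p' r := by simpa using h2
      exact ⟨p'', r', h4, h5, hn _ ⟨j + k' + 2, by omega, h6.peak hu h3 hd⟩⟩

theorem Good.fact {n : ℕ} (hn : ∀ x, M.Fact (2 * n + 2) x → M.Fact n x) {h : ℕ} {q : Q}
    (hg : M.Good n (h + 1) q) : M.Fact n (Sum.inr (Sum.inr q)) := by
  induction h generalizing q with
  | zero =>
    obtain ⟨p, r, ⟨j, hj, h1⟩, h2, k, hk, h3⟩ := hg
    have hz : M.zup p r := by simpa using h2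
    exact hn _ ⟨j + 1 + k, by omega, 0, h3.reach (h1.zup hz)⟩
  | succ h ih =>
    obtain ⟨p, r, h1, h2, k, hk, h3⟩ := hg
    obtain ⟨j, hj, h', h1⟩ := ih h1
    have hu : M.up p r := by simpa using h2
    exact hn _ ⟨j + 1 + k, by omega, h' + 1, h3.reach (h1.up hu)⟩

/-- Every state that is reachable with a zero (positive) counter value is so within a number of
steps that depends on the number of states only: among the sets of facts with the length bounds
`4 ^ i` two consecutive ones are equal, and then no further facts arise. -/
theorem Reach.exists_short [Fintype Q] {k h : ℕ} {q : Q} (hr : M.Reach k q h) :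
    ∃ k' ≤ 4 ^ (Fintype.card Q * Fintype.card Q + (Fintype.card Q + Fintype.card Q)),
      ∃ h', (h' = 0 ↔ h = 0) ∧ M.Reach k' q h' := by
  classical
  obtain ⟨i, hi, hfix⟩ := exists_stable
    (f := fun i => Finset.univ.filter (M.Fact (4 ^ i))) (by
      intro i j hij x hx
      simp only [Finset.mem_filter, Finset.mem_univ, true_and] at hx ⊢
      exact hx.mono (Nat.pow_le_pow_right (by norm_num) hij))
  have hn : ∀ x, M.Fact (2 * 4 ^ i + 2) x → M.Fact (4 ^ i) x := by
    intro x hx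
    -- `2 * n + 2 ≤ 4 * n` for `1 ≤ n`
    have h1 : 1 ≤ 4 ^ i := Nat.one_le_pow _ _ (by norm_num)
    have h2 : M.Fact (4 ^ (i + 1)) x := hx.mono (by rw [pow_succ]; omega)
    have : x ∈ Finset.univ.filter (M.Fact (4 ^ (i + 1))) := by simpa using h2
    rw [hfix] at this
    simpa using this
  have hle : 4 ^ i ≤ 4 ^ (Fintype.card Q * Fintype.card Q +
      (Fintype.card Q + Fintype.card Q)) :=
    Nat.pow_le_pow_right (by norm_num) (by simpa using hi)
  have hg := hr.good hn
  cases h with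
  | zero =>
    obtain ⟨k', hk', h'⟩ := hg
    exact ⟨k', hk'.trans hle, 0, Iff.rfl, h'⟩
  | succ h =>
    obtain ⟨k', hk', h', h''⟩ := hg.fact hn
    exact ⟨k', hk'.trans hle, h' + 1, by simp, h''⟩

end OneCounter

/-! ### Violations are found after boundedly many moves -/

namespace Ty

variable {L : Type*}

/-- The type is an output selection. -/
def IsOut (T : Ty L) : Prop := ∃ n l T', T = out n l T'

/-- The type `T` is an input branching with the alternative `T'` labelled `a`. -/
def InpAlt (T : Ty L) (a : L) (T' : Ty L) : Prop :=
  ∃ n l U i, T = inp n l U ∧ a = l i ∧ T' = U i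

theorem InpAlt.label_unique {T T₁ T₂ : Ty L} {a₁ a₂ : L} (hT : T.SingleIn)
    (h₁ : T.InpAlt a₁ T₁) (h₂ : T.InpAlt a₂ T₂) : a₁ = a₂ := by
  obtain ⟨n, l, U, i, rfl, rfl, rfl⟩ := h₁
  obtain ⟨n', l', U', i', ⟨⟩, rfl, rfl⟩ := h₂
  obtain ⟨rfl, -⟩ := hT
  rw [Subsingleton.elim i i']

/-- The types reached by one step: unfolding a recursion or choosing an alternative. -/
inductive Succ : Ty L → Ty L → Prop
  | mu (x T) : Succ (mu x T) (subst x (mu x T) T)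
  | out (n l T i) : Succ (out n l T) (T i)
  | inp (n l T i) : Succ (inp n l T) (T i)

end Ty

namespace Conf

open Ty

variable {L : Type*}

/-- Configurations reached from `c₀` by a given number of moves. -/
inductive Reach (c₀ : Conf L) : ℕ → Conf L → Prop
  | refl : Reach c₀ 0 c₀
  | step {k c c'} : Reach c₀ k c → Move c c' → Reach c₀ (k + 1) c'

theorem Safe.of_reach {b : Bool} {P : Ty L → Prop} {c₀ c : Conf L} {j m : ℕ}
    (h : Safe b P (j + m) c₀) (hr : Reach c₀ j c) : Safe b P m c := by
  induction hr generalizing m with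
  | refl => simpa using h
  | @step k c c' _ hm ih =>
    have : Safe b P (m + 1) c := ih (by rwa [show k + (m + 1) = k + 1 + m by ring])
    exact this.2 _ hm

theorem safe_of_not_bad {b : Bool} {P : Ty L → Prop} {c₀ : Conf L}
    (h : ∀ j c, Reach c₀ j c → ¬ Bad b P c) (m : ℕ) : Safe b P m c₀ := by
  suffices key : ∀ m j c, Reach c₀ j c → Safe b P m c from key m 0 c₀ Reach.refl
  intro m
  induction m with
  | zero => intros; trivial
  | succ m ih => exact fun j c hr => ⟨h j c hr, fun c' hm => ih (j + 1) c' (hr.step hm)⟩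

/-- A move keeps the queue, appends a letter to it, or takes its first letter. -/
theorem Move.cases_queue {T T' S S' : Ty L} {w w' : List L}
    (h : Move ⟨T, w, S⟩ ⟨T', w', S'⟩) :
    (w' = w ∧ Move ⟨T, w, S⟩ ⟨T', w, S'⟩) ∨
      (∃ a, IsOut T ∧ T' = T ∧ S.InpAlt a S' ∧ w' = w ++ [a]) ∨
      (∃ a a', T.InpAlt a T' ∧ S' = S ∧ w = a' :: w') := by
  generalize hc : (⟨T, w, S⟩ : Conf L) = c at h
  generalize hc' : (⟨T', w', S'⟩ : Conf L) = c' at h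
  cases h
  case outInp =>
    cases hc; cases hc'
    exact Or.inr (Or.inl ⟨_, ⟨_, _, _, rfl⟩, rfl, ⟨_, _, _, _, rfl, rfl, rfl⟩, rfl⟩)
  case pop =>
    cases hc; cases hc'
    exact Or.inr (Or.inr ⟨_, _, ⟨_, _, _, _, rfl, rfl, rfl⟩, rfl, rfl⟩)
  case outOut => cases hc; cases hc'; exact Or.inl ⟨rfl, Move.outOut _ _ _ _ _ _ _ _ _ ‹_›⟩
  all_goals cases hc; cases hc'; exact Or.inl ⟨rfl, by constructor⟩

theorem Move.push {T S S' : Ty L} {a : L} (w : List L) (hT : IsOut T) (hS : S.InpAlt a S') :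
    Move ⟨T, w, S⟩ ⟨T, w ++ [a], S'⟩ := by
  obtain ⟨n, l, T, rfl⟩ := hT
  obtain ⟨m, l', U, i, rfl, rfl, rfl⟩ := hS
  constructor

theorem Move.popAlt {T T' S : Ty L} {a a' : L} (w : List L) (hT : T.InpAlt a T') :
    Move ⟨T, a' :: w, S⟩ ⟨T', w, S⟩ := by
  obtain ⟨m, l', U, i, rfl, rfl, rfl⟩ := hT
  constructor

/-- A move that leaves a non-empty queue unchanged does not depend on the queue. -/
theorem Move.quiet_congr {T T' S S' : Ty L} {w v : List L}
    (h : Move ⟨T, w, S⟩ ⟨T', w, S'⟩) (hw : w ≠ []) :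
    Move ⟨T, v, S⟩ ⟨T', v, S'⟩ := by
  generalize hc : (⟨T, w, S⟩ : Conf L) = c at h
  generalize hc' : (⟨T', w, S'⟩ : Conf L) = c' at h
  cases h
  case outInp => cases hc; simp at hc'
  case pop => cases hc; simp at hc'
  case outOut => cases hc; cases hc'; exact Move.outOut _ _ _ _ _ _ _ _ _ ‹_›
  all_goals
    cases hc; cases hc'
    first
      | exact (hw rfl).elim
      | constructor

theorem Move.succ_sub {c c' : Conf L} (h : Move c c') :
    c'.sub = c.sub ∨ Succ c.sub c'.sub := by
  cases h <;> first | exact Or.inl rfl | exact Or.inr (by constructor)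

theorem Move.succ_sup {c c' : Conf L} (h : Move c c') :
    c'.sup = c.sup ∨ Succ c.sup c'.sup := by
  cases h <;> first | exact Or.inl rfl | exact Or.inr (by constructor)

variable (X Y : Finset (Ty L))

/-- The states of the one-counter system behind the queue machine: the two types, and possibly a
type that has put a letter into the queue which is tracked from then on. -/
abbrev QState : Type _ := X × Y × Option Y

/-- The one-counter system behind the queue machine. Its counter is the length of the queue, or,
as soon as a letter of the queue is tracked, the number of letters in front of the tracked
letter. -/
def counter (T₀ : X) (S₀ : Y) : OneCounter (QState X Y) where
  start := (T₀, S₀, none)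
  zflat := fun (T, S, o) (T', S', o') =>
    (o = none ∧ o' = none ∧ Move ⟨T.1, [], S.1⟩ ⟨T'.1, [], S'.1⟩) ∨
    (o = none ∧ o' = some S ∧ T' = T ∧ IsOut T.1 ∧ ∃ a, S.1.InpAlt a S'.1) ∨
    (o ≠ none ∧ o' = o ∧ ((∃ w ≠ [], Move ⟨T.1, w, S.1⟩ ⟨T'.1, w, S'.1⟩) ∨
      (T' = T ∧ IsOut T.1 ∧ ∃ a, S.1.InpAlt a S'.1)))
  zup := fun (T, S, o) (T', S', o') =>
    o = none ∧ o' = none ∧ T' = T ∧ IsOut T.1 ∧ ∃ a, S.1.InpAlt a S'.1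
  flat := fun (T, S, o) (T', S', o') =>
    (o' = o ∧ ∃ w ≠ [], Move ⟨T.1, w, S.1⟩ ⟨T'.1, w, S'.1⟩) ∨
    (o = none ∧ o' = some S ∧ T' = T ∧ IsOut T.1 ∧ ∃ a, S.1.InpAlt a S'.1) ∨
    (o ≠ none ∧ o' = o ∧ T' = T ∧ IsOut T.1 ∧ ∃ a, S.1.InpAlt a S'.1)
  up := fun (T, S, o) (T', S', o') =>
    o = none ∧ o' = none ∧ T' = T ∧ IsOut T.1 ∧ ∃ a, S.1.InpAlt a S'.1
  down := fun (T, S, o) (T', S', o') => o' = o ∧ S' = S ∧ ∃ a, T.1.InpAlt a T'.1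

variable {X Y}

/-- Runs of the queue machine are runs of the one-counter system, which can moreover track any
letter of the queue from the moment on when it has been put there. -/
theorem Reach.counter (hX : ∀ T ∈ X, ∀ T', Succ T T' → T' ∈ X)
    (hY : ∀ T ∈ Y, ∀ T', Succ T T' → T' ∈ Y) {T₀ : X} {S₀ : Y} {k : ℕ} {c : Conf L}
    (h : Reach ⟨T₀.1, [], S₀.1⟩ k c) : ∃ (hT : c.sub ∈ X) (hS : c.sup ∈ Y),
      (counter X Y T₀ S₀).Reach k (⟨c.sub, hT⟩, ⟨c.sup, hS⟩, none) c.queue.length ∧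
      ∀ x a y, c.queue = x ++ a :: y → ∃ r : Y, (∃ r', r.1.InpAlt a r') ∧
        (counter X Y T₀ S₀).Reach k (⟨c.sub, hT⟩, ⟨c.sup, hS⟩, some r) x.length := by
  induction h with
  | refl => exact ⟨T₀.2, S₀.2, OneCounter.Reach.start, by simp⟩
  | @step k c c' _ hm ih =>
    obtain ⟨hT, hS, h1, h2⟩ := ih
    have hT' : c'.sub ∈ X := by
      rcases hm.succ_sub with h | h
      · rwa [h]
      · exact hX _ hT _ h
    have hS' : c'.sup ∈ Y := by
      rcases hm.succ_sup with h | h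
      · rwa [h]
      · exact hY _ hS _ h
    refine ⟨hT', hS', ?_⟩
    obtain ⟨T, w, S⟩ := c
    obtain ⟨T', w', S'⟩ := c'
    simp only at h1 h2 hT hS hT' hS' ⊢
    rcases hm.cases_queue with ⟨rfl, hm⟩ | ⟨a, hO, rfl, hI, rfl⟩ | ⟨a, a', hI, rfl, rfl⟩
    · constructor
      · cases w' with
        | nil => exact h1.zflat (Or.inl ⟨rfl, rfl, hm⟩)
        | cons b w => exact OneCounter.Reach.flat h1 (Or.inl ⟨rfl, _, by simp, hm⟩)
      · intro x a y hw
        obtain ⟨r, hr, h3⟩ := h2 x a y hw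
        refine ⟨r, hr, ?_⟩
        cases x with
        | nil =>
          exact h3.zflat (Or.inr (Or.inr ⟨by simp, rfl, Or.inl ⟨_, by simp [hw], hm⟩⟩))
        | cons b x =>
          exact OneCounter.Reach.flat h3 (Or.inl ⟨rfl, _, by simp [hw], hm⟩)
    · constructor
      · cases w with
        | nil => exact h1.zup ⟨rfl, rfl, rfl, hO, a, hI⟩
        | cons b w =>
          rw [List.length_append]
          exact OneCounter.Reach.up h1 ⟨rfl, rfl, rfl, hO, a, hI⟩
      · intro x a' y hw
        rcases List.eq_nil_or_concat' y with rfl | ⟨y, a'', rfl⟩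
        · -- the letter just put into the queue
          obtain ⟨rfl, rfl⟩ : w = x ∧ a = a' := by
            have := List.append_inj' hw rfl
            simpa using this
          refine ⟨⟨S, hS⟩, ⟨S', hI⟩, ?_⟩
          cases w with
          | nil => exact h1.zflat (Or.inr (Or.inl ⟨rfl, rfl, rfl, hO, a, hI⟩))
          | cons b w =>
            exact OneCounter.Reach.flat h1 (Or.inr (Or.inl ⟨rfl, rfl, rfl, hO, a, hI⟩))
        · obtain ⟨hw, -⟩ : w = x ++ a' :: y ∧ [a] = [a''] :=
            List.append_inj' (by rw [hw]; simp) rfl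
          obtain ⟨r, hr, h3⟩ := h2 x a' y hw
          refine ⟨r, hr, ?_⟩
          cases x with
          | nil =>
            exact h3.zflat (Or.inr (Or.inr ⟨by simp, rfl, Or.inr ⟨rfl, hO, a, hI⟩⟩))
          | cons b x =>
            exact OneCounter.Reach.flat h3 (Or.inr (Or.inr ⟨by simp, rfl, rfl, hO, a, hI⟩))
    · constructor
      · exact OneCounter.Reach.down h1 ⟨rfl, rfl, a, hI⟩
      · intro x b y hw
        obtain ⟨r, hr, h3⟩ := h2 (a' :: x) b y (by rw [hw]; rfl)
        exact ⟨r, hr, OneCounter.Reach.down h3 ⟨rfl, rfl, a, hI⟩⟩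

/-- Runs of the one-counter system come from runs of the queue machine, since moves do not depend
on the letters in the queue. -/
theorem reach_of_counter {T₀ : X} {S₀ : Y} {k h : ℕ} {s : QState X Y}
    (hr : (counter X Y T₀ S₀).Reach k s h) :
    (s.2.2 = none → ∃ w, w.length = h ∧ Reach ⟨T₀.1, [], S₀.1⟩ k ⟨s.1.1, w, s.2.1.1⟩) ∧
    ∀ r, s.2.2 = some r → ∃ x a y, x.length = h ∧ (∃ r', r.1.InpAlt a r') ∧
      Reach ⟨T₀.1, [], S₀.1⟩ k ⟨s.1.1, x ++ a :: y, s.2.1.1⟩ := by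
  induction hr with
  | start => exact ⟨fun _ => ⟨[], rfl, Reach.refl⟩, by simp [counter]⟩
  | @zflat k p q _ hz ih =>
    obtain ⟨T, S, o⟩ := p
    obtain ⟨T', S', o'⟩ := q
    obtain ⟨ih1, ih2⟩ := ih
    simp only at ih1 ih2 ⊢
    rcases hz with ⟨rfl, rfl, hm⟩ | ⟨rfl, rfl, rfl, hO, a, hI⟩ | ⟨ho, rfl, hz⟩
    · refine ⟨fun _ => ?_, by simp⟩
      obtain ⟨w, hw, hr⟩ := ih1 rfl
      obtain rfl := List.length_eq_zero_iff.1 hw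
      exact ⟨[], rfl, hr.step hm⟩
    · refine ⟨by simp, ?_⟩
      rintro _ ⟨⟩
      obtain ⟨w, hw, hr⟩ := ih1 rfl
      exact ⟨w, a, [], hw, ⟨_, hI⟩, hr.step (Move.push w hO hI)⟩
    · refine ⟨fun h => (ho h).elim, fun r hr => ?_⟩
      obtain ⟨x, a, y, hx, ha, hr⟩ := ih2 r hr
      rcases hz with ⟨w, hw, hm⟩ | ⟨rfl, hO, b, hI⟩
      · exact ⟨x, a, y, hx, ha, hr.step (hm.quiet_congr hw)⟩
      · refine ⟨x, a, y ++ [b], hx, ha, ?_⟩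
        have := hr.step (Move.push _ hO hI)
        simpa using this
  | @zup k p q _ hz ih =>
    obtain ⟨T, S, o⟩ := p
    obtain ⟨T', S', o'⟩ := q
    obtain ⟨ih1, ih2⟩ := ih
    obtain ⟨rfl, rfl, rfl, hO, a, hI⟩ := hz
    simp only at ih1 ih2 ⊢
    refine ⟨fun _ => ?_, by simp⟩
    obtain ⟨w, hw, hr⟩ := ih1 trivial
    exact ⟨w ++ [a], by simp [hw], hr.step (Move.push w hO hI)⟩
  | @flat k p q h _ hz ih =>
    obtain ⟨T, S, o⟩ := p
    obtain ⟨T', S', o'⟩ := q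
    obtain ⟨ih1, ih2⟩ := ih
    simp only at ih1 ih2 ⊢
    rcases hz with ⟨rfl, w', hw', hm⟩ | ⟨rfl, rfl, rfl, hO, a, hI⟩ | ⟨ho, rfl, rfl, hO, b, hI⟩
    · refine ⟨fun ho => ?_, fun r hr => ?_⟩
      · obtain ⟨w, hw, hr⟩ := ih1 ho
        exact ⟨w, hw, hr.step (hm.quiet_congr hw')⟩
      · obtain ⟨x, a, y, hx, ha, hr⟩ := ih2 r hr
        exact ⟨x, a, y, hx, ha, hr.step (hm.quiet_congr hw')⟩
    · refine ⟨by simp, ?_⟩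
      rintro _ ⟨⟩
      obtain ⟨w, hw, hr⟩ := ih1 rfl
      exact ⟨w, a, [], hw, ⟨_, hI⟩, hr.step (Move.push w hO hI)⟩
    · refine ⟨fun h => (ho h).elim, fun r hr => ?_⟩
      obtain ⟨x, a, y, hx, ha, hr⟩ := ih2 r hr
      refine ⟨x, a, y ++ [b], hx, ha, ?_⟩
      have := hr.step (Move.push _ hO hI)
      simpa using this
  | @up k p q h _ hz ih =>
    obtain ⟨T, S, o⟩ := p
    obtain ⟨T', S', o'⟩ := q
    obtain ⟨ih1, ih2⟩ := ih
    obtain ⟨rfl, rfl, rfl, hO, a, hI⟩ := hz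
    simp only at ih1 ih2 ⊢
    refine ⟨fun _ => ?_, by simp⟩
    obtain ⟨w, hw, hr⟩ := ih1 trivial
    exact ⟨w ++ [a], by simp [hw], hr.step (Move.push w hO hI)⟩
  | @down k p q h _ hz ih =>
    obtain ⟨T, S, o⟩ := p
    obtain ⟨T', S', o'⟩ := q
    obtain ⟨ih1, ih2⟩ := ih
    obtain ⟨rfl, rfl, b, hI⟩ := hz
    simp only at ih1 ih2 ⊢
    refine ⟨fun ho => ?_, fun r hr => ?_⟩
    · obtain ⟨w, hw, hr⟩ := ih1 ho
      cases w with
      | nil => simp at hw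
      | cons c w => exact ⟨w, by simpa using hw, hr.step (Move.popAlt w hI)⟩
    · obtain ⟨x, a, y, hx, ha, hr⟩ := ih2 r hr
      cases x with
      | nil => simp at hx
      | cons c x => exact ⟨x, a, y, by simpa using hx, ha, hr.step (Move.popAlt _ hI)⟩

/-- It suffices to look for violations up to a depth that depends only on the number of types that
occur on either side. -/
theorem safe_of_safe_bound {b : Bool} {P : Ty L → Prop}
    (hX : ∀ T ∈ X, ∀ T', Succ T T' → T' ∈ X) (hY : ∀ T ∈ Y, ∀ T', Succ T T' → T' ∈ Y)
    (hi : ∀ S ∈ Y, S.SingleIn) (T₀ : X) (S₀ : Y) {N : ℕ}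
    (hN : X.card * (Y.card * (Y.card + 1)) ≤ N)
    (h : Safe b P (4 ^ (N * N + (N + N)) + 1) ⟨T₀.1, [], S₀.1⟩) (k : ℕ) :
    Safe b P k ⟨T₀.1, [], S₀.1⟩ := by
  have hcard : Fintype.card (QState X Y) ≤ N := by
    simpa [QState] using hN
  have hpow : 4 ^ (Fintype.card (QState X Y) * Fintype.card (QState X Y) +
      (Fintype.card (QState X Y) + Fintype.card (QState X Y))) ≤ 4 ^ (N * N + (N + N)) :=
    Nat.pow_le_pow_right (by norm_num)
      (Nat.add_le_add (Nat.mul_le_mul hcard hcard) (Nat.add_le_add hcard hcard))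
  have hnot : ∀ j ≤ 4 ^ (Fintype.card (QState X Y) * Fintype.card (QState X Y) +
      (Fintype.card (QState X Y) + Fintype.card (QState X Y))), ∀ c,
      Reach ⟨T₀.1, [], S₀.1⟩ j c → ¬ Bad b P c := by
    intro j hj c hr
    obtain ⟨m, hm⟩ := Nat.exists_eq_add_of_le (hj.trans hpow)
    rw [hm, add_assoc] at h
    exact (h.of_reach hr).1
  refine safe_of_not_bad (fun j c hr hbad => ?_) k
  obtain ⟨hT, hS, h1, h2⟩ := hr.counter hX hY
  -- A mismatch with the first letter of the queue is found by tracking that letter, which is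
  -- determined by the type that has put it there. All other violations depend only on the two
  -- types and on whether the queue is empty.
  by_cases hmis : ∃ n l T a w i, c.sub = inp n l T ∧ c.queue = a :: w ∧ l i ≠ a
  · obtain ⟨n, l, T, a, w, i, hs, hq, hne⟩ := hmis
    obtain ⟨r, ⟨r', hra⟩, h3⟩ := h2 [] a w hq
    obtain ⟨k', hk', h', hh', h4⟩ := h3.exists_short
    obtain ⟨x, a', y, hx, ⟨r'', hra'⟩, h5⟩ := (reach_of_counter h4).2 r rfl
    obtain rfl := hra.label_unique (hi _ r.2) hra'
    obtain rfl := List.length_eq_zero_iff.1 (hx.trans (hh'.2 rfl))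
    simp only [hs] at h5
    exact hnot k' hk' _ h5 (Bad.mismatch _ _ _ _ _ _ i hne)
  · obtain ⟨k', hk', h', hh', h4⟩ := h1.exists_short
    obtain ⟨v, hv, h5⟩ := (reach_of_counter h4).1 rfl
    refine hnot k' hk' _ h5 ?_
    have hvw : v = [] ↔ c.queue = [] := by
      rw [← List.length_eq_zero_iff, hv, hh', List.length_eq_zero_iff]
    change Bad b P ⟨c.sub, v, c.sup⟩
    clear h1 h2 h4 h5 hT hS hr
    cases hbad with
    | stuck n l T w S he => exact Bad.stuck _ _ _ _ _ he
    | missing n l T w m l' S i hi => exact Bad.missing _ _ _ _ _ _ _ i hi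
    | extra n l T w m l' S j hb hj => exact Bad.extra _ _ _ _ _ _ _ j hb hj
    | orphan n l T w m l' S i hw hP => exact Bad.orphan _ _ _ _ _ _ _ i (fun h => hw (hvw.1 h)) hP
    | mismatch n l T a w S i hne => exact (hmis ⟨_, _, _, _, _, _, rfl, rfl, hne⟩).elim
    | inpOut => obtain rfl := hvw.2 rfl; constructor
    | inpFin => obtain rfl := hvw.2 rfl; constructor
    | inpInp n l T m l' S i j hne => obtain rfl := hvw.2 rfl; exact Bad.inpInp _ _ _ _ _ _ i j hne
    | finQueue =>
      cases v with
      | nil => simp at hvw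
      | cons a v => constructor
    | finOut => obtain rfl := hvw.2 rfl; constructor
    | finInp => obtain rfl := hvw.2 rfl; constructor

end Conf

namespace Ty

variable {L : Type*}

/-! ### The finitely many types reachable from a session type -/

/-- The types reachable from `msubst σ T` by unfolding recursions and choosing alternatives, up to
those that are reachable from the types in `σ`: one for each subterm that is not a variable. -/
def states : Ty L → (ℕ → Option (Ty L)) → List (Ty L)
  | out n l T, σ => msubst σ (out n l T) :: (List.ofFn fun i => (T i).states σ).flatten
  | inp n l T, σ => msubst σ (inp n l T) :: (List.ofFn fun i => (T i).states σ).flatten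
  | mu x T, σ =>
    msubst σ (mu x T) :: T.states (Function.update σ x (some (msubst σ (mu x T))))
  | var _, _ => []
  | fin, _ => [fin]

theorem msubst_mem_states {T : Ty L} {σ : ℕ → Option (Ty L)}
    (hT : T.FreeIn {x | (σ x).isSome}) : msubst σ T ∈ T.states σ ∨ ∃ x, msubst σ T ∈ σ x := by
  cases T with
  | var x =>
    obtain ⟨U, hU⟩ := Option.isSome_iff_exists.1 (show (σ x).isSome from hT)
    exact Or.inr ⟨x, by simp [msubst, hU]⟩
  | _ => exact Or.inl (by simp [states, msubst])

/-- The list of states is closed under steps, up to the types in `σ`. -/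
theorem succ_mem_states {T : Ty L} {σ : ℕ → Option (Ty L)} (hσ : ClosedEnv σ)
    (hT : T.FreeIn {x | (σ x).isSome}) (hc : (msubst σ T).FreeIn ∅) {U V : Ty L}
    (hU : U ∈ T.states σ) (hUV : Succ U V) : V ∈ T.states σ ∨ ∃ x, V ∈ σ x := by
  induction T generalizing σ with
  | out n l T ih =>
    simp only [states, List.mem_cons, List.mem_flatten, List.mem_ofFn] at hU ⊢
    have hsub {V : Ty L} {i : Fin n} (h : V ∈ (T i).states σ ∨ ∃ x, V ∈ σ x) :
        (V = msubst σ (out n l T) ∨ ∃ l, (∃ i, (T i).states σ = l) ∧ V ∈ l) ∨ ∃ x, V ∈ σ x :=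
      h.imp_left fun h => Or.inr ⟨_, ⟨i, rfl⟩, h⟩
    rcases hU with rfl | ⟨_, ⟨i, rfl⟩, hU⟩
    · simp only [msubst] at hUV
      cases hUV with
      | out n l T' i => exact hsub (msubst_mem_states (hT i))
    · exact hsub (ih i hσ (hT i) (hc i) hU)
  | inp n l T ih =>
    simp only [states, List.mem_cons, List.mem_flatten, List.mem_ofFn] at hU ⊢
    have hsub {V : Ty L} {i : Fin n} (h : V ∈ (T i).states σ ∨ ∃ x, V ∈ σ x) :
        (V = msubst σ (inp n l T) ∨ ∃ l, (∃ i, (T i).states σ = l) ∧ V ∈ l) ∨ ∃ x, V ∈ σ x :=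
      h.imp_left fun h => Or.inr ⟨_, ⟨i, rfl⟩, h⟩
    rcases hU with rfl | ⟨_, ⟨i, rfl⟩, hU⟩
    · simp only [msubst] at hUV
      cases hUV with
      | inp n l T' i => exact hsub (msubst_mem_states (hT i))
    · exact hsub (ih i hσ (hT i) (hc i) hU)
  | mu x T ih =>
    simp only [states, List.mem_cons] at hU ⊢
    have key := subst_msubst hσ x (msubst σ (mu x T)) T
    have hσ' := hσ.update (x := x) (o := some (msubst σ (mu x T))) (by rintro U ⟨⟩; exact hc)
    have hT' : T.FreeIn {y | (Function.update σ x (some (msubst σ (mu x T))) y).isSome} := by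
      refine FreeIn.mono (T := T) hT ?_
      rintro y (rfl | hy)
      · simp
      · by_cases hyx : y = x
        · subst hyx; simp
        · simpa [Function.update_of_ne hyx] using hy
    have hsub {V : Ty L} (h : V ∈ T.states (Function.update σ x (some (msubst σ (mu x T)))) ∨
        ∃ y, V ∈ Function.update σ x (some (msubst σ (mu x T))) y) :
        (V = msubst σ (mu x T) ∨
          V ∈ T.states (Function.update σ x (some (msubst σ (mu x T))))) ∨ ∃ x, V ∈ σ x := by
      rcases h with h | ⟨y, h⟩
      · exact Or.inl (Or.inr h)
      · by_cases hyx : y = x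
        · subst hyx
          simp only [Function.update_self, Option.mem_def, Option.some.injEq] at h
          exact Or.inl (Or.inl h.symm)
        · rw [Function.update_of_ne hyx] at h
          exact Or.inr ⟨y, h⟩
    rcases hU with rfl | hU
    · generalize hW : msubst σ (mu x T) = W at *
      rw [← hW] at hUV
      simp only [msubst] at hUV
      cases hUV with
      | mu x T' =>
        have : mu x (msubst (Function.update σ x none) T) = W := hW
        rw [this, key]
        exact hsub (msubst_mem_states hT')
    · refine hsub (ih hσ' hT' ?_ hU)
      rw [← key]
      exact FreeIn.subst (Γ := ∅) hc hc
  | var x => simp [states] at hU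
  | fin =>
    simp only [states, List.mem_singleton] at hU
    subst hU
    cases hUV

theorem sum_code_le_encode (l : List (ℕ × ℕ)) :
    (l.map fun p => p.2 + 1).sum ≤ Encodable.encode l := by
  induction l with
  | nil => simp
  | cons p l ih =>
    rw [List.map_cons, List.sum_cons, Encodable.encode_list_cons, Encodable.encode_prod_val]
    have h1 := Nat.add_le_pair (Nat.pair (Encodable.encode p.1) (Encodable.encode p.2))
      (Encodable.encode l)
    have h2 := Nat.add_le_pair (Encodable.encode p.1) (Encodable.encode p.2)
    simp only [Encodable.encode_nat] at h1 h2 ⊢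
    omega

theorem length_states_le [Encodable L] (T : Ty L) (σ : ℕ → Option (Ty L)) :
    (T.states σ).length ≤ T.code + 1 := by
  have key {n : ℕ} {l : Fin n → L} {T : Fin n → Ty L} {σ : ℕ → Option (Ty L)}
      (ih : ∀ i σ, ((T i).states σ).length ≤ (T i).code + 1) :
      ((List.ofFn fun i => (T i).states σ).flatten).length ≤ Encodable.encode
        (List.ofFn fun i => (Encodable.encode (l i), (T i).code)) := by
    refine le_trans ?_ (sum_code_le_encode _)
    rw [List.length_flatten, List.map_ofFn, List.map_ofFn, List.sum_ofFn, List.sum_ofFn]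
    exact Finset.sum_le_sum fun i _ => ih i σ
  induction T generalizing σ with
  | out n l T ih =>
    have := key (l := l) (σ := σ) ih
    have h := Nat.add_le_pair 3
      (Encodable.encode (List.ofFn fun i => (Encodable.encode (l i), (T i).code)))
    simp only [states, List.length_cons, code]
    omega
  | inp n l T ih =>
    have := key (l := l) (σ := σ) ih
    have h := Nat.add_le_pair 4
      (Encodable.encode (List.ofFn fun i => (Encodable.encode (l i), (T i).code)))
    simp only [states, List.length_cons, code]
    omega
  | mu x T ih =>
    have := ih (Function.update σ x (some (msubst σ (mu x T))))
    have h1 := Nat.add_le_pair 2 (Nat.pair x T.code)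
    have h2 := Nat.add_le_pair x T.code
    simp only [states, List.length_cons, code]
    omega
  | var x => simp [states]
  | fin => simp [states]

theorem Succ.singleIn {T T' : Ty L} (h : Succ T T') (hT : T.SingleIn) : T'.SingleIn := by
  cases h with
  | mu x T => exact SingleIn.subst (T := T) hT hT
  | out n l T i => exact hT i
  | inp n l T i => exact hT.2 i

theorem Succ.isSession {T T' : Ty L} (h : Succ T T') (hT : T.IsSession) :
    T'.IsSession := by
  cases h with
  | mu x T => exact hT.subst_mu
  | out n l T i => exact (isSession_out.1 hT).2.2 i
  | inp n l T i => exact (isSession_inp.1 hT).2.2 i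

/-- A session type reaches only finitely many types, and the code of the type bounds their number. -/
theorem IsSession.exists_states [Encodable L] {T : Ty L} (hT : T.IsSession) :
    ∃ X : Finset (Ty L), T ∈ X ∧ (∀ U ∈ X, ∀ V, Succ U V → V ∈ X) ∧ X.card ≤ T.code + 1 := by
  classical
  refine ⟨(T.states fun _ => none).toFinset, ?_, ?_,
    (List.toFinset_card_le _).trans (length_states_le _ _)⟩
  · have := msubst_mem_states (σ := fun _ => none) (T := T) (by simpa using hT.closed)
    rw [msubst_none] at this
    simpa using this
  · intro U hU V hUV
    have := succ_mem_states (σ := fun _ => none) (T := T) (by intro x U hU; simp at hU)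
      (by simpa using hT.closed) (by rw [msubst_none]; exact hT.closed) (by simpa using hU) hUV
    simpa using this

/-- The number of moves after which the queue machine started with types of the codes `t` and `s`
shows a violation if there is any. -/
def moveBound (t s : ℕ) : ℕ :=
  let N := (t + 1) * ((s + 1) * (s + 2))
  4 ^ (N * N + (N + N)) + 1

theorem sub_iff_safe_bound [Encodable L] {b : Bool} {P : Ty L → Prop} {T S : Ty L}
    (hT : T.IsSession) (hTi : T.SingleIn) (hS : S.IsSession) (hSi : S.SingleIn) :
    Sub b P T S ↔ Conf.Safe b P (moveBound T.code S.code) ⟨T, [], S⟩ := by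
  classical
  rw [sub_iff_safe hT hTi hS hSi]
  refine ⟨fun h => h _, fun h => ?_⟩
  obtain ⟨X, hX1, hX2, hX3⟩ := hT.exists_states
  obtain ⟨Y, hY1, hY2, hY3⟩ := hS.exists_states
  have hY3' : (Y.filter SingleIn).card ≤ S.code + 1 := (Finset.card_filter_le _ _).trans hY3
  refine Conf.safe_of_safe_bound (X := X) (Y := Y.filter SingleIn) hX2 ?_ ?_
    ⟨T, hX1⟩ ⟨S, Finset.mem_filter.2 ⟨hY1, hSi⟩⟩ ?_ h
  · intro U hU V hUV
    rw [Finset.mem_filter] at hU ⊢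
    exact ⟨hY2 U hU.1 V hUV, hUV.singleIn hU.2⟩
  · exact fun U hU => (Finset.mem_filter.1 hU).2
  · exact Nat.mul_le_mul hX3 (Nat.mul_le_mul hY3' (by omega))

end Ty

/-! ### Recursion over codes of types -/

namespace TyCode

open Primrec

/-- The constructor of the term with the given code. -/
def tag (c : ℕ) : ℕ := c.unpair.1

/-- The alternatives of the selection or branching with the given code, as pairs of the code of a
label and the code of a continuation. -/
def alts (c : ℕ) : List (ℕ × ℕ) :=
  ((Encodable.decode c.unpair.2 : Option (List (ℕ × ℕ)))).getD []

/-- The immediate subterms of the term with the given code, each paired with its label or with the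
variable bound at the recursion. The filter matters for junk codes only: it makes the recursion
over codes well-founded. -/
def kids (c : ℕ) : List (ℕ × ℕ) :=
  (if tag c = 2 then [c.unpair.2.unpair] else if tag c = 3 ∨ tag c = 4 then alts c else []).filter
    fun p => p.2 < c

variable {α σ : Type*}

/-- Recursion over the codes of terms. -/
def fold (F : α → ℕ → List (ℕ × σ) → σ) (a : α) (c : ℕ) : σ :=
  F a c ((kids c).attach.map fun p => (p.1.1, fold F a p.1.2))
termination_by c
decreasing_by
  have := p.2
  simp only [kids, List.mem_filter, decide_eq_true_eq] at this
  exact this.2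

theorem fold_eq (F : α → ℕ → List (ℕ × σ) → σ) (a : α) (c : ℕ) :
    fold F a c = F a c ((kids c).map fun p => (p.1, fold F a p.2)) := by
  rw [fold]
  congr 1
  exact List.attach_map_val (f := fun p : ℕ × ℕ => (p.1, fold F a p.2))

theorem primrec_tag : Primrec tag := fst.comp unpair

theorem primrec_alts : Primrec alts :=
  option_getD.comp (Primrec.decode.comp (snd.comp unpair)) (const [])

theorem primrec_kids : Primrec kids := by
  have h1 : Primrec fun c : ℕ => (if tag c = 2 then [c.unpair.2.unpair] else
      if tag c = 3 ∨ tag c = 4 then alts c else [] : List (ℕ × ℕ)) :=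
    Primrec.ite (Primrec.eq.comp primrec_tag (const 2))
      (list_cons.comp (unpair.comp (snd.comp unpair)) (const []))
      (Primrec.ite ((Primrec.eq.comp primrec_tag (const 3)).or
        (Primrec.eq.comp primrec_tag (const 4))) primrec_alts (const []))
  have h2 : PrimrecRel fun (p : ℕ × ℕ) (c : ℕ) => p.2 < c := nat_lt.comp (snd.comp fst) snd
  exact h2.listFilter.comp h1 Primrec.id

theorem primrec_fold [Primcodable α] [Primcodable σ] [Inhabited σ]
    {F : α → ℕ → List (ℕ × σ) → σ}
    (hF : Primrec fun x : α × ℕ × List (ℕ × σ) => F x.1 x.2.1 x.2.2) : Primrec₂ (fold F) := by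
  refine nat_strong_rec (fold F) (g := fun a l => some (F a l.length
    ((kids l.length).map fun p => (p.1, l.getD p.2 default)))) ?_ ?_
  · refine option_some.comp (hF.comp (Primrec.pair fst (Primrec.pair (list_length.comp snd) ?_)))
    refine list_map (primrec_kids.comp (list_length.comp snd)) ?_
    exact Primrec.pair (fst.comp snd)
      ((list_getD default).comp (snd.comp fst) (snd.comp snd))
  · intro a n
    rw [fold_eq]
    simp only [List.length_map, List.length_range, Option.some.injEq]
    congr 1
    refine List.map_congr_left fun p hp => ?_
    simp only [kids, List.mem_filter, decide_eq_true_eq] at hp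
    simp [List.getD, hp.2]

/-- Substitution on codes; the parameters are the variable and the code of the type that replaces
it. -/
def substC : ℕ × ℕ → ℕ → ℕ :=
  fold fun a c ys =>
    if tag c = 1 then (if c.unpair.2 = a.1 then a.2 else c)
    else if tag c = 2 then
      (if c.unpair.2.unpair.1 = a.1 then c else Nat.pair 2 (Encodable.encode ys.headI))
    else if tag c = 0 then c else Nat.pair (tag c) (Encodable.encode ys)

/-- Duality on codes. -/
def dualC : ℕ → ℕ :=
  fold (fun _ c ys =>
    if tag c = 2 then Nat.pair 2 (Encodable.encode ys.headI)
    else if tag c = 3 then Nat.pair 4 (Encodable.encode ys)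
    else if tag c = 4 then Nat.pair 3 (Encodable.encode ys) else c) ()

/-- `Ty.Emits` on codes. -/
def emitsC : ℕ → Bool :=
  fold (fun _ c ys => if tag c = 3 then true
    else if tag c = 2 ∨ tag c = 4 then decide (∀ y ∈ ys, y.2 = true) else false) ()

/-- `Ty.HasInput` on codes. -/
def hasInputC : ℕ → Bool :=
  fold (fun _ c ys => if tag c = 4 then true else decide (∃ y ∈ ys, y.2 = true)) ()

/-- `Ty.SingleIn` on codes. -/
def singleInC : ℕ → Bool :=
  fold (fun _ c ys => decide ((∀ y ∈ ys, y.2 = true) ∧ (tag c = 4 → ys.length = 1))) ()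

theorem primrec_substC : Primrec₂ substC := by
  refine primrec_fold ?_
  have hc : Primrec fun x : (ℕ × ℕ) × ℕ × List (ℕ × ℕ) => x.2.1 := fst.comp snd
  have ht := primrec_tag.comp hc
  have hr := snd.comp (unpair.comp hc)
  refine Primrec.ite (Primrec.eq.comp ht (const 1)) (Primrec.ite
    (Primrec.eq.comp hr (fst.comp fst)) (snd.comp fst) hc) ?_
  refine Primrec.ite (Primrec.eq.comp ht (const 2)) (Primrec.ite
    (Primrec.eq.comp (fst.comp (unpair.comp hr)) (fst.comp fst)) hc ?_) ?_
  · exact Primrec₂.natPair.comp (const 2) (Primrec.encode.comp (list_headI.comp (snd.comp snd)))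
  · exact Primrec.ite (Primrec.eq.comp ht (const 0)) hc
      (Primrec₂.natPair.comp ht (Primrec.encode.comp (snd.comp snd)))

theorem primrec_dualC : Primrec dualC := by
  refine (primrec_fold ?_).comp (const ()) Primrec.id
  have hc : Primrec fun x : Unit × ℕ × List (ℕ × ℕ) => x.2.1 := fst.comp snd
  have ht := primrec_tag.comp hc
  refine Primrec.ite (Primrec.eq.comp ht (const 2)) (Primrec₂.natPair.comp (const 2)
    (Primrec.encode.comp (list_headI.comp (snd.comp snd)))) ?_
  refine Primrec.ite (Primrec.eq.comp ht (const 3)) (Primrec₂.natPair.comp (const 4)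
    (Primrec.encode.comp (snd.comp snd))) ?_
  exact Primrec.ite (Primrec.eq.comp ht (const 4)) (Primrec₂.natPair.comp (const 3)
    (Primrec.encode.comp (snd.comp snd))) hc

theorem primrecPred_all : PrimrecPred fun x : Unit × ℕ × List (ℕ × Bool) =>
    ∀ y ∈ x.2.2, y.2 = true :=
  (PrimrecPred.forall_mem_list (p := fun y : ℕ × Bool => y.2 = true)
    (Primrec.eq.comp snd (const true))).comp (snd.comp snd)

theorem primrec_emitsC : Primrec emitsC := by
  refine (primrec_fold ?_).comp (const ()) Primrec.id
  have ht : Primrec fun x : Unit × ℕ × List (ℕ × Bool) => tag x.2.1 :=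
    primrec_tag.comp (fst.comp snd)
  exact Primrec.ite (Primrec.eq.comp ht (const 3)) (const true)
    (Primrec.ite ((Primrec.eq.comp ht (const 2)).or (Primrec.eq.comp ht (const 4)))
      primrecPred_all.decide (const false))

theorem primrec_hasInputC : Primrec hasInputC := by
  refine (primrec_fold ?_).comp (const ()) Primrec.id
  have ht : Primrec fun x : Unit × ℕ × List (ℕ × Bool) => tag x.2.1 :=
    primrec_tag.comp (fst.comp snd)
  exact Primrec.ite (Primrec.eq.comp ht (const 4)) (const true)
    ((PrimrecPred.exists_mem_list (p := fun y : ℕ × Bool => y.2 = true)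
      (Primrec.eq.comp snd (const true))).comp (snd.comp snd)).decide

theorem primrec_singleInC : Primrec singleInC := by
  refine (primrec_fold ?_).comp (const ()) Primrec.id
  have ht : Primrec fun x : Unit × ℕ × List (ℕ × Bool) => tag x.2.1 :=
    primrec_tag.comp (fst.comp snd)
  refine (primrecPred_all.and (q := fun x => tag x.2.1 = 4 → x.2.2.length = 1) ?_).decide
  refine ((Primrec.eq.comp ht (const 4)).not.or
    (Primrec.eq.comp (list_length.comp (snd.comp snd)) (const 1))).of_eq fun x => ?_
  tauto

end TyCode

namespace Ty

open TyCode

variable {L : Type*} [Encodable L]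

theorem tag_out {n : ℕ} {l : Fin n → L} {T : Fin n → Ty L} : tag (out n l T).code = 3 := by
  simp [tag, code]

theorem tag_inp {n : ℕ} {l : Fin n → L} {T : Fin n → Ty L} : tag (inp n l T).code = 4 := by
  simp [tag, code]

theorem tag_mu {x : ℕ} {T : Ty L} : tag (mu x T).code = 2 := by simp [tag, code]

theorem tag_var {x : ℕ} : tag (var x : Ty L).code = 1 := by simp [tag, code]

theorem tag_fin : tag (fin : Ty L).code = 0 := by simp [tag, code]

theorem alts_out {n : ℕ} {l : Fin n → L} {T : Fin n → Ty L} : alts (out n l T).code =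
    List.ofFn fun i => (Encodable.encode (l i), (T i).code) := by
  simp [alts, code]

theorem alts_inp {n : ℕ} {l : Fin n → L} {T : Fin n → Ty L} : alts (inp n l T).code =
    List.ofFn fun i => (Encodable.encode (l i), (T i).code) := by
  simp [alts, code]

theorem snd_lt_of_mem {l : List (ℕ × ℕ)} {p : ℕ × ℕ} (hp : p ∈ l) (k : ℕ) :
    p.2 < Nat.pair k (Encodable.encode l) := by
  have h1 := sum_code_le_encode l
  have h2 := List.single_le_sum (l := l.map fun p => p.2 + 1) (by simp) _
    (List.mem_map_of_mem hp)
  have h3 := Nat.right_le_pair k (Encodable.encode l)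
  omega

theorem kids_out {n : ℕ} {l : Fin n → L} {T : Fin n → Ty L} : kids (out n l T).code =
    List.ofFn fun i => (Encodable.encode (l i), (T i).code) := by
  simp only [kids, tag_out, alts_out]
  simp only [show (3 : ℕ) ≠ 2 by norm_num, if_false, true_or, if_true, List.filter_eq_self,
    decide_eq_true_eq]
  exact fun p hp => snd_lt_of_mem hp 3

theorem kids_inp {n : ℕ} {l : Fin n → L} {T : Fin n → Ty L} : kids (inp n l T).code =
    List.ofFn fun i => (Encodable.encode (l i), (T i).code) := by
  simp only [kids, tag_inp, alts_inp]
  simp only [show (4 : ℕ) ≠ 2 by norm_num, if_false, or_true, if_true, List.filter_eq_self,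
    decide_eq_true_eq]
  exact fun p hp => snd_lt_of_mem hp 4

theorem kids_mu {x : ℕ} {T : Ty L} : kids (mu x T).code = [(x, T.code)] := by
  have h1 := Nat.add_le_pair 2 (Nat.pair x T.code)
  have h2 := Nat.right_le_pair x T.code
  have h3 : T.code < Nat.pair 2 (Nat.pair x T.code) := by omega
  rw [kids, tag_mu]
  simp [code, h3]

theorem kids_var {x : ℕ} : kids (var x : Ty L).code = [] := by simp [kids, tag_var]

theorem kids_fin : kids (fin : Ty L).code = [] := by simp [kids, tag_fin]

theorem substC_code (x : ℕ) (U T : Ty L) :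
    substC (x, U.code) T.code = (subst x U T).code := by
  induction T with
  | out n l T ih =>
    rw [substC, fold_eq, ← substC, kids_out]
    simp [tag, subst, code, List.map_ofFn, Function.comp_def, ih]
  | inp n l T ih =>
    rw [substC, fold_eq, ← substC, kids_inp]
    simp [tag, subst, code, List.map_ofFn, Function.comp_def, ih]
  | mu y T ih =>
    rw [substC, fold_eq, ← substC, kids_mu]
    simp only [tag_mu, subst]
    by_cases hy : y = x
    · simp [hy, code]
    · simp [hy, code, ih]
  | var y =>
    rw [substC, fold_eq, ← substC, kids_var]
    simp only [tag_var, subst]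
    by_cases hy : y = x
    · simp [hy, code]
    · simp [hy, code]
  | fin =>
    rw [substC, fold_eq, ← substC, kids_fin]
    simp [tag_fin, subst]

theorem dualC_code (T : Ty L) : dualC T.code = T.dual.code := by
  induction T with
  | out n l T ih =>
    rw [dualC, fold_eq, ← dualC, kids_out]
    simp [tag, dual, code, List.map_ofFn, Function.comp_def, ih]
  | inp n l T ih =>
    rw [dualC, fold_eq, ← dualC, kids_inp]
    simp [tag, dual, code, List.map_ofFn, Function.comp_def, ih]
  | mu y T ih =>
    rw [dualC, fold_eq, ← dualC, kids_mu]
    simp [tag, dual, code, ih]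
  | var y =>
    rw [dualC, fold_eq, ← dualC, kids_var]
    simp [tag_var, dual]
  | fin =>
    rw [dualC, fold_eq, ← dualC, kids_fin]
    simp [tag_fin, dual]

theorem emitsC_code (T : Ty L) : emitsC T.code = true ↔ T.Emits := by
  induction T with
  | out n l T ih =>
    rw [emitsC, fold_eq]
    simp [tag_out, Emits]
  | inp n l T ih =>
    rw [emitsC, fold_eq, ← emitsC, kids_inp]
    simp [tag_inp, Emits, List.mem_ofFn, ih]
  | mu y T ih =>
    rw [emitsC, fold_eq, ← emitsC, kids_mu]
    simp [tag_mu, Emits, ih]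
  | var y =>
    rw [emitsC, fold_eq]
    simp [tag_var, Emits]
  | fin =>
    rw [emitsC, fold_eq]
    simp [tag_fin, Emits]

theorem hasInputC_code (T : Ty L) : hasInputC T.code = true ↔ T.HasInput := by
  induction T with
  | out n l T ih =>
    rw [hasInputC, fold_eq, ← hasInputC, kids_out]
    simp [tag_out, HasInput, List.mem_ofFn, ih]
  | inp n l T ih =>
    rw [hasInputC, fold_eq]
    simp [tag_inp, HasInput]
  | mu y T ih =>
    rw [hasInputC, fold_eq, ← hasInputC, kids_mu]
    simp [tag_mu, HasInput, ih]
  | var y =>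
    rw [hasInputC, fold_eq, kids_var]
    simp [tag_var, HasInput]
  | fin =>
    rw [hasInputC, fold_eq, kids_fin]
    simp [tag_fin, HasInput]

theorem singleInC_code (T : Ty L) : singleInC T.code = true ↔ T.SingleIn := by
  induction T with
  | out n l T ih =>
    rw [singleInC, fold_eq, ← singleInC, kids_out]
    simp [tag_out, SingleIn, List.mem_ofFn, ih]
  | inp n l T ih =>
    rw [singleInC, fold_eq, ← singleInC, kids_inp]
    simp [tag_inp, SingleIn, List.mem_ofFn, ih, and_comm]
  | mu y T ih =>
    rw [singleInC, fold_eq, ← singleInC, kids_mu]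
    simp [tag_mu, SingleIn, ih]
  | var y =>
    rw [singleInC, fold_eq, kids_var]
    simp [tag_var, SingleIn]
  | fin =>
    rw [singleInC, fold_eq, kids_fin]
    simp [tag_fin, SingleIn]

end Ty

/-! ### The queue machine on codes -/

namespace TyCode

open Primrec

/-- Codes of configurations of the queue machine. -/
abbrev CodeConf : Type := ℕ × List ℕ × ℕ

/-- The code of the unfolding of the recursion with the given code. -/
def unfoldC (c : ℕ) : ℕ := substC (c.unpair.2.unpair.1, c) c.unpair.2.unpair.2

/-- The successors of a configuration in which an output meets an output; `none` stands for a
violation. -/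
def outStep (b : Bool) (P : ℕ → Bool) (c : CodeConf) : List (Option CodeConf) :=
  ((alts c.1).flatMap fun p =>
    if (∀ q ∈ alts c.2.2, q.1 ≠ p.1) ∨ (c.2.1 ≠ [] ∧ P p.2 = false) then [none]
    else (alts c.2.2).flatMap fun q =>
      if q.1 = p.1 then [some (p.2, c.2.1, q.2)] else []) ++
  (alts c.2.2).flatMap fun q =>
    if b = true ∧ ∀ p ∈ alts c.1, p.1 ≠ q.1 then [none] else []

/-- The successors of a configuration in which an input meets an input while the queue is empty;
`none` stands for a violation. -/
def inpStep (c : CodeConf) : List (Option CodeConf) :=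
  (alts c.1).flatMap fun p => (alts c.2.2).map fun q =>
    if p.1 = q.1 then some (p.2, c.2.1, q.2) else none

/-- The successors of a configuration; `none` stands for a violation. -/
def stepC (b : Bool) (P : ℕ → Bool) (c : CodeConf) : List (Option CodeConf) :=
  if tag c.1 = 2 then [some (unfoldC c.1, c.2)]
  else if tag c.1 = 3 then
    if emitsC c.2.2 = false then [none]
    else if tag c.2.2 = 2 then [some (c.1, c.2.1, unfoldC c.2.2)]
    else if tag c.2.2 = 4 then (alts c.2.2).map fun q => some (c.1, c.2.1 ++ [q.1], q.2)
    else outStep b P c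
  else if tag c.1 = 4 then
    if c.2.1 = [] then
      if tag c.2.2 = 2 then [some (c.1, c.2.1, unfoldC c.2.2)]
      else if tag c.2.2 = 4 then inpStep c
      else [none]
    else (alts c.1).map fun p =>
      if p.1 = c.2.1.headI then some (p.2, c.2.1.tail, c.2.2) else none
  else
    if c.2.1 = [] ∧ tag c.2.2 = 2 then [some (c.1, c.2.1, unfoldC c.2.2)]
    else if c.2.1 = [] ∧ tag c.2.2 = 0 then [] else [none]

/-- One step of the queue machine on a list of configurations; violations persist. -/
def stepAll (b : Bool) (P : ℕ → Bool) (l : List (Option CodeConf)) : List (Option CodeConf) :=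
  l.flatMap fun o => o.elim [none] (stepC b P)

/-- The decision procedure for subtyping of single-in types. -/
def subC (b : Bool) (P : ℕ → Bool) (t s : ℕ) : Bool :=
  singleInC t && singleInC s &&
    decide (none ∉ (stepAll b P)^[Ty.moveBound t s] [some (t, [], s)])

theorem primrec_unfoldC : Primrec unfoldC := by
  have h := unpair.comp (snd.comp unpair)
  exact primrec_substC.comp (Primrec.pair (fst.comp h) Primrec.id) (snd.comp h)

theorem primrecRel_forall_ne : PrimrecRel fun (l : List (ℕ × ℕ)) (a : ℕ) => ∀ q ∈ l, q.1 ≠ a :=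
  PrimrecRel.forall_mem_list (R := fun (q : ℕ × ℕ) (a : ℕ) => q.1 ≠ a)
    (Primrec.eq.comp (fst.comp fst) snd).not

theorem primrec_outStep (b : Bool) {P : ℕ → Bool} (hP : Primrec P) : Primrec (outStep b P) := by
  refine list_append.comp (list_flatMap (primrec_alts.comp fst) ?_)
    (list_flatMap (primrec_alts.comp (snd.comp snd)) ?_)
  · have hc : Primrec fun x : CodeConf × (ℕ × ℕ) => x.1 := fst
    refine Primrec.ite (PrimrecPred.or ?_ (PrimrecPred.and ?_ ?_)) (const [none]) ?_
    · exact primrecRel_forall_ne.comp (primrec_alts.comp (snd.comp (snd.comp hc))) (fst.comp snd)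
    · exact (Primrec.eq.comp (fst.comp (snd.comp hc)) (const [])).not
    · exact Primrec.eq.comp (hP.comp (snd.comp snd)) (const false)
    · refine list_flatMap (primrec_alts.comp (snd.comp (snd.comp hc))) ?_
      refine Primrec.ite (Primrec.eq.comp (fst.comp snd) (fst.comp (snd.comp fst))) ?_ (const [])
      refine list_cons.comp (option_some.comp (Primrec.pair (snd.comp (snd.comp fst))
        (Primrec.pair ?_ (snd.comp snd)))) (const [])
      exact fst.comp (snd.comp (fst.comp fst))
  · refine Primrec.ite (PrimrecPred.and ?_ ?_) (const [none]) (const [])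
    · exact Primrec.eq.comp (const b) (const true)
    · exact primrecRel_forall_ne.comp (primrec_alts.comp (fst.comp fst)) (fst.comp snd)

theorem primrec_inpStep : Primrec inpStep := by
  refine list_flatMap (primrec_alts.comp fst) (list_map
    (primrec_alts.comp (snd.comp (snd.comp fst))) ?_)
  refine Primrec.ite (Primrec.eq.comp (fst.comp (snd.comp fst)) (fst.comp snd)) ?_ (const none)
  exact option_some.comp (Primrec.pair (snd.comp (snd.comp fst)) (Primrec.pair
    (fst.comp (snd.comp (fst.comp fst))) (snd.comp snd)))

theorem primrec_stepC (b : Bool) {P : ℕ → Bool} (hP : Primrec P) : Primrec (stepC b P) := by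
  have ht : Primrec fun c : CodeConf => tag c.1 := primrec_tag.comp fst
  have hs : Primrec fun c : CodeConf => tag c.2.2 := primrec_tag.comp (snd.comp snd)
  have hq : Primrec fun c : CodeConf => c.2.1 := fst.comp snd
  have hu : Primrec fun c : CodeConf =>
      ([some (c.1, c.2.1, unfoldC c.2.2)] : List (Option CodeConf)) :=
    list_cons.comp (option_some.comp (Primrec.pair fst (Primrec.pair hq
      (primrec_unfoldC.comp (snd.comp snd))))) (const [])
  have hnil : PrimrecPred fun c : CodeConf => c.2.1 = [] := Primrec.eq.comp hq (const [])
  refine Primrec.ite (Primrec.eq.comp ht (const 2)) (list_cons.comp (option_some.comp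
    (Primrec.pair (primrec_unfoldC.comp fst) snd)) (const [])) ?_
  refine Primrec.ite (Primrec.eq.comp ht (const 3)) ?_ ?_
  · refine Primrec.ite (Primrec.eq.comp (primrec_emitsC.comp (snd.comp snd)) (const false))
      (const [none]) (Primrec.ite (Primrec.eq.comp hs (const 2)) hu ?_)
    refine Primrec.ite (Primrec.eq.comp hs (const 4)) (list_map
      (primrec_alts.comp (snd.comp snd)) ?_) (primrec_outStep b hP)
    exact option_some.comp (Primrec.pair (fst.comp fst) (Primrec.pair (list_concat.comp
      (fst.comp (snd.comp fst)) (fst.comp snd)) (snd.comp snd)))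
  refine Primrec.ite (Primrec.eq.comp ht (const 4)) ?_ ?_
  · refine Primrec.ite hnil (Primrec.ite (Primrec.eq.comp hs (const 2)) hu
      (Primrec.ite (Primrec.eq.comp hs (const 4)) primrec_inpStep (const [none]))) ?_
    refine list_map (primrec_alts.comp fst) (Primrec.ite (Primrec.eq.comp (fst.comp snd)
      (list_headI.comp (fst.comp (snd.comp fst)))) ?_ (const none))
    exact option_some.comp (Primrec.pair (snd.comp snd) (Primrec.pair (list_tail.comp
      (fst.comp (snd.comp fst))) (snd.comp (snd.comp fst))))
  · exact Primrec.ite (hnil.and (Primrec.eq.comp hs (const 2))) hu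
      (Primrec.ite (hnil.and (Primrec.eq.comp hs (const 0))) (const []) (const [none]))

theorem primrec_stepAll (b : Bool) {P : ℕ → Bool} (hP : Primrec P) : Primrec (stepAll b P) := by
  refine list_flatMap Primrec.id ?_
  exact (option_casesOn snd (const [none]) ((primrec_stepC b hP).comp snd).to₂).of_eq
    fun x => by cases x.2 <;> rfl

theorem primrec_moveBound : Primrec₂ Ty.moveBound := by
  have hpow : Primrec₂ ((· ^ ·) : ℕ → ℕ → ℕ) := Primrec₂.unpaired'.1 Nat.Primrec.pow
  have hN : Primrec fun x : ℕ × ℕ => (x.1 + 1) * ((x.2 + 1) * (x.2 + 2)) :=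
    nat_mul.comp (Primrec.succ.comp fst) (nat_mul.comp (Primrec.succ.comp snd)
      (Primrec.succ.comp (Primrec.succ.comp snd)))
  exact Primrec.succ.comp (hpow.comp (const 4) (nat_add.comp (nat_mul.comp hN hN)
    (nat_add.comp hN hN)))

theorem primrec_subC (b : Bool) {P : ℕ → Bool} (hP : Primrec P) : Primrec₂ (subC b P) := by
  refine Primrec.and.comp (Primrec.and.comp (primrec_singleInC.comp fst)
    (primrec_singleInC.comp snd)) (PrimrecPred.decide ?_)
  have hiter : Primrec fun x : ℕ × ℕ =>
      (stepAll b P)^[Ty.moveBound x.1 x.2] [some (x.1, [], x.2)] :=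
    nat_iterate (h := fun _ => stepAll b P) primrec_moveBound
      (list_cons.comp (option_some.comp (Primrec.pair fst (Primrec.pair (const []) snd)))
        (const [])) ((primrec_stepAll b hP).comp snd).to₂
  have hmem : PrimrecPred fun l : List (Option CodeConf) => ∀ o ∈ l, o ≠ none :=
    PrimrecPred.forall_mem_list (Primrec.eq.comp Primrec.id (const none)).not
  refine (hmem.comp hiter).of_eq fun x => ?_
  exact ⟨fun h hn => h _ hn rfl, fun h o ho hn => h (hn ▸ ho)⟩

theorem none_mem_outStep {b : Bool} {P : ℕ → Bool} {c : CodeConf} :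
    none ∈ outStep b P c ↔
      (∃ p ∈ alts c.1, (∀ q ∈ alts c.2.2, q.1 ≠ p.1) ∨ (c.2.1 ≠ [] ∧ P p.2 = false)) ∨
      ∃ q ∈ alts c.2.2, b = true ∧ ∀ p ∈ alts c.1, p.1 ≠ q.1 := by
  rw [outStep, List.mem_append, List.mem_flatMap, List.mem_flatMap]
  refine or_congr (exists_congr fun p => and_congr_right fun _ => ?_)
    (exists_congr fun q => and_congr_right fun _ => ?_)
  · split_ifs with h
    · exact ⟨fun _ => h, fun _ => by simp⟩
    · refine ⟨fun h' => ?_, fun h' => (h h').elim⟩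
      obtain ⟨q, -, hq⟩ := List.mem_flatMap.1 h'
      split_ifs at hq <;> simp at hq
  · split_ifs with h
    · exact ⟨fun _ => h, fun _ => by simp⟩
    · exact ⟨fun h' => by simp at h', fun h' => (h h').elim⟩

theorem some_mem_outStep {b : Bool} {P : ℕ → Bool} {c d : CodeConf} (h : none ∉ outStep b P c) :
    some d ∈ outStep b P c ↔
      ∃ p ∈ alts c.1, ∃ q ∈ alts c.2.2, q.1 = p.1 ∧ d = (p.2, c.2.1, q.2) := by
  rw [none_mem_outStep, not_or] at h
  rw [outStep, List.mem_append, List.mem_flatMap, List.mem_flatMap]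
  constructor
  · rintro (⟨p, hp, hd⟩ | ⟨q, hq, hd⟩)
    · rw [if_neg fun h' => h.1 ⟨p, hp, h'⟩] at hd
      obtain ⟨q, hq, hd⟩ := List.mem_flatMap.1 hd
      split_ifs at hd with hpq
      · exact ⟨p, hp, q, hq, hpq, by simpa using hd⟩
      · simp at hd
    · rw [if_neg fun h' => h.2 ⟨q, hq, h'⟩] at hd
      simp at hd
  · rintro ⟨p, hp, q, hq, hpq, rfl⟩
    refine Or.inl ⟨p, hp, ?_⟩
    rw [if_neg fun h' => h.1 ⟨p, hp, h'⟩]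
    exact List.mem_flatMap.2 ⟨q, hq, by simp [hpq]⟩

/-- The iterated step function treats the members of the list independently. -/
theorem stepAll_iterate_none (b : Bool) (P : ℕ → Bool) (k : ℕ) (l : List (Option CodeConf)) :
    none ∈ (stepAll b P)^[k] l ↔ ∃ o ∈ l, none ∈ (stepAll b P)^[k] [o] := by
  induction k generalizing l with
  | zero => simp
  | succ k ih =>
    simp only [Function.iterate_succ_apply]
    rw [ih]
    have (o : Option CodeConf) := ih (stepAll b P [o])
    simp only [this]
    simp only [stepAll, List.mem_flatMap, List.mem_singleton, exists_eq_left]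
    constructor
    · rintro ⟨o', ⟨o, ho, ho'⟩, h⟩; exact ⟨o, ho, o', ho', h⟩
    · rintro ⟨o, ho, o', ho', h⟩; exact ⟨o', ⟨o, ho, ho'⟩, h⟩

theorem stepAll_iterate_none_self (b : Bool) (P : ℕ → Bool) (k : ℕ) :
    none ∈ (stepAll b P)^[k] [none] := by
  induction k with
  | zero => simp
  | succ k ih => simpa [Function.iterate_succ_apply, stepAll] using ih

end TyCode

namespace Conf

open Ty TyCode

variable {L : Type*} [Encodable L]

/-- The code of a configuration. -/
def code (c : Conf L) : CodeConf := (c.sub.code, c.queue.map Encodable.encode, c.sup.code)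

theorem unfoldC_code (x : ℕ) (T : Ty L) :
    unfoldC (mu x T).code = (subst x (mu x T) T).code := by
  rw [← substC_code]
  simp [unfoldC, Ty.code]

/-- The moves from a configuration whose subtype and supertype start with outputs. -/
theorem outStep_spec (b : Bool) {P : Ty L → Prop} {pc : ℕ → Bool}
    (hP : ∀ T, pc T.code = true ↔ P T) {n : ℕ} {l : Fin n → L} {T : Fin n → Ty L} {w : List L}
    {m : ℕ} {l' : Fin m → L} {S : Fin m → Ty L} :
    (none ∈ outStep b pc (code ⟨out n l T, w, out m l' S⟩) ↔
      Bad b P ⟨out n l T, w, out m l' S⟩) ∧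
    (¬ Bad b P ⟨out n l T, w, out m l' S⟩ →
      ∀ d, some d ∈ outStep b pc (code ⟨out n l T, w, out m l' S⟩) ↔
        ∃ c', Move ⟨out n l T, w, out m l' S⟩ c' ∧ d = code c') := by
  have hP' : ∀ T, pc T.code = false ↔ ¬ P T := fun T => by rw [← hP, Bool.not_eq_true]
  have hbad : Bad b P ⟨out n l T, w, out m l' S⟩ ↔
      (∃ i, (∀ j, l' j ≠ l i) ∨ (w ≠ [] ∧ ¬ P (T i))) ∨ (∃ j, b = true ∧ ∀ i, l i ≠ l' j) := by
    constructor
    · intro h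
      cases h with
      | stuck n l T w S he => exact (he trivial).elim
      | missing n l T w m l' S i hi => exact Or.inl ⟨i, Or.inl fun j hj => hi ⟨j, hj⟩⟩
      | extra n l T w m l' S j hb hj => exact Or.inr ⟨j, hb, fun i hi => hj ⟨i, hi⟩⟩
      | orphan n l T w m l' S i hw hP => exact Or.inl ⟨i, Or.inr ⟨hw, hP⟩⟩
    · rintro (⟨i, h | ⟨hw, h⟩⟩ | ⟨j, hb, h⟩)
      · exact Bad.missing _ _ _ _ _ _ _ i (by rintro ⟨j, hj⟩; exact h j hj)
      · exact Bad.orphan _ _ _ _ _ _ _ i hw h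
      · exact Bad.extra _ _ _ _ _ _ _ j hb (by rintro ⟨i, hi⟩; exact h i hi)
  have hmove (d : CodeConf) : (∃ c', Move ⟨out n l T, w, out m l' S⟩ c' ∧ d = code c') ↔
      ∃ i j, l' j = l i ∧ d = code ⟨T i, w, S j⟩ := by
    constructor
    · rintro ⟨c', hm, rfl⟩
      cases hm with
      | outOut n l T w m l' S i j h => exact ⟨i, j, h.symm, rfl⟩
    · rintro ⟨i, j, h, rfl⟩
      exact ⟨_, Move.outOut _ _ _ _ _ _ _ i j h.symm, rfl⟩
  have hdead : (∃ p ∈ alts (out n l T).code, (∀ q ∈ alts (out m l' S).code, q.1 ≠ p.1) ∨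
      (w.map Encodable.encode ≠ [] ∧ pc p.2 = false)) ↔
      ∃ i, (∀ j, l' j ≠ l i) ∨ (w ≠ [] ∧ ¬ P (T i)) := by
    simp [alts_out, List.mem_ofFn, hP']
  have hextra : (∃ q ∈ alts (out m l' S).code, b = true ∧
      ∀ p ∈ alts (out n l T).code, p.1 ≠ q.1) ↔ ∃ j, b = true ∧ ∀ i, l i ≠ l' j := by
    simp [alts_out, List.mem_ofFn]
  constructor
  · rw [hbad, none_mem_outStep]
    exact or_congr hdead hextra
  · intro hn d
    rw [hmove, some_mem_outStep]
    · simp [code, alts_out, List.mem_ofFn]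
    · rw [none_mem_outStep]
      exact fun h => hn (hbad.2 (h.imp hdead.1 hextra.1))

/-- The step function on codes computes the moves and detects the violations. -/
theorem stepC_spec (b : Bool) {P : Ty L → Prop} {pc : ℕ → Bool}
    (hP : ∀ T, pc T.code = true ↔ P T) {c : Conf L} (hT : c.sub.IsSession)
    (hS : c.sup.IsSession) :
    (none ∈ stepC b pc c.code ↔ Bad b P c) ∧
    (¬ Bad b P c → ∀ d, some d ∈ stepC b pc c.code ↔ ∃ c', Move c c' ∧ d = c'.code) := by
  obtain ⟨T, w, S⟩ := c
  simp only at hT hS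
  have single {d e : CodeConf} : some d ∈ [some e] ↔ d = e := by simp
  cases T with
  | var x => exact absurd hT.closed (by simp [FreeIn])
  | mu x T =>
    simp only [stepC, code, tag_mu, if_true, unfoldC_code]
    refine ⟨⟨by simp, by rintro ⟨⟩⟩, fun _ d => ?_⟩
    rw [single]
    constructor
    · rintro rfl
      exact ⟨_, Move.mu .., rfl⟩
    · rintro ⟨c', hm, rfl⟩
      cases hm
      rfl
  | out n l T =>
    by_cases he : S.Emits
    · have he' : emitsC S.code = true := (emitsC_code S).2 he
      cases S with
      | var x => exact absurd hS.closed (by simp [FreeIn])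
      | fin => exact he.elim
      | mu x S =>
        simp only [stepC, code, tag_out, he', Bool.true_eq_false, tag_mu, if_true, if_false, unfoldC_code,
          show (3 : ℕ) ≠ 2 by norm_num]
        refine ⟨⟨by simp, fun h => ?_⟩, fun _ d => ?_⟩
        · cases h with
          | stuck n l T w S h => exact (h he).elim
        rw [single]
        constructor
        · rintro rfl
          exact ⟨_, Move.outMu .., rfl⟩
        · rintro ⟨c', hm, rfl⟩
          cases hm
          rfl
      | inp m l' S =>
        simp only [stepC, code, tag_out, he', Bool.true_eq_false, tag_inp, if_true, if_false, alts_inp,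
          show (3 : ℕ) ≠ 2 by norm_num, show (4 : ℕ) ≠ 2 by norm_num]
        refine ⟨⟨by simp, fun h => ?_⟩, fun _ d => ?_⟩
        · cases h with
          | stuck n l T w S h => exact (h he).elim
        simp only [List.mem_map, List.mem_ofFn, exists_exists_eq_and, Option.some.injEq]
        constructor
        · rintro ⟨i, rfl⟩
          exact ⟨_, Move.outInp _ _ _ _ _ _ _ i, by simp⟩
        · rintro ⟨c', hm, rfl⟩
          cases hm with
          | outInp n l T w m l' S i => exact ⟨i, by simp⟩
      | out m l' S =>
        have : stepC b pc (code ⟨out n l T, w, out m l' S⟩) =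
            outStep b pc (code ⟨out n l T, w, out m l' S⟩) := by
          simp only [stepC, code, tag_out, he', Bool.true_eq_false, if_true, if_false,
            show (3 : ℕ) ≠ 2 by norm_num, show (3 : ℕ) ≠ 4 by norm_num]
        rw [this]
        exact outStep_spec b hP
    · have he' : emitsC S.code = false := by
        rw [← Bool.not_eq_true, emitsC_code]
        exact he
      have hbad : Bad b P ⟨out n l T, w, S⟩ := Bad.stuck _ _ _ _ _ he
      refine ⟨⟨fun _ => hbad, fun _ => ?_⟩, fun h => (h hbad).elim⟩
      simp [stepC, code, tag_out, he']
  | inp n l T =>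
    cases w with
    | cons a w =>
      simp only [stepC, code, tag_inp, if_true, if_false, alts_inp, List.map_cons, reduceCtorEq,
        show (4 : ℕ) ≠ 2 by norm_num, show (4 : ℕ) ≠ 3 by norm_num, List.headI_cons,
        List.tail_cons, List.mem_map, List.mem_ofFn, exists_exists_eq_and, Encodable.encode_inj]
      constructor
      · constructor
        · rintro ⟨i, hi⟩
          split_ifs at hi with h
          exact Bad.mismatch _ _ _ _ _ _ i fun h' => h (by rw [h'])
        · intro h
          cases h with
          | mismatch n l T a w S i hi => exact ⟨i, if_neg fun h => hi (Encodable.encode_inj.1 h)⟩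
      · intro hn d
        constructor
        · rintro ⟨i, hi⟩
          split_ifs at hi with h
          exact ⟨_, Move.pop _ _ _ _ _ _ i, by simpa using hi.symm⟩
        · rintro ⟨c', hm, rfl⟩
          cases hm with
          | pop n l T a w S i =>
            refine ⟨i, ?_⟩
            rw [if_pos]
            by_contra hne
            exact hn (Bad.mismatch _ _ _ _ _ _ i fun h => hne (by rw [h]))
    | nil =>
      cases S with
      | var x => exact absurd hS.closed (by simp [FreeIn])
      | fin =>
        simp only [stepC, code, tag_inp, tag_fin, if_true, if_false, List.map_nil,
          show (4 : ℕ) ≠ 2 by norm_num, show (4 : ℕ) ≠ 3 by norm_num,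
          show (0 : ℕ) ≠ 2 by norm_num, show (0 : ℕ) ≠ 4 by norm_num]
        exact ⟨⟨fun _ => by constructor, fun _ => by simp⟩, fun h => (h (by constructor)).elim⟩
      | out m l' S =>
        simp only [stepC, code, tag_inp, tag_out, if_true, if_false, List.map_nil,
          show (4 : ℕ) ≠ 2 by norm_num, show (4 : ℕ) ≠ 3 by norm_num,
          show (3 : ℕ) ≠ 2 by norm_num, show (3 : ℕ) ≠ 4 by norm_num]
        exact ⟨⟨fun _ => by constructor, fun _ => by simp⟩, fun h => (h (by constructor)).elim⟩
      | mu x S =>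
        simp only [stepC, code, tag_inp, tag_mu, if_true, if_false, List.map_nil, unfoldC_code,
          show (4 : ℕ) ≠ 2 by norm_num, show (4 : ℕ) ≠ 3 by norm_num]
        refine ⟨⟨by simp, by rintro ⟨⟩⟩, fun _ d => ?_⟩
        rw [single]
        constructor
        · rintro rfl
          exact ⟨_, Move.inpMu .., rfl⟩
        · rintro ⟨c', hm, rfl⟩
          cases hm
          rfl
      | inp m l' S =>
        simp only [stepC, inpStep, code, tag_inp, if_true, if_false, List.map_nil, alts_inp,
          show (4 : ℕ) ≠ 2 by norm_num, show (4 : ℕ) ≠ 3 by norm_num, List.mem_flatMap,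
          List.mem_map, List.mem_ofFn, exists_exists_eq_and, Encodable.encode_inj]
        constructor
        · constructor
          · rintro ⟨i, j, hi⟩
            split_ifs at hi with h
            exact Bad.inpInp _ _ _ _ _ _ i j fun h' => h (by rw [h'])
          · intro h
            cases h with
            | inpInp n l T m l' S i j hi =>
              exact ⟨i, j, if_neg fun h => hi (Encodable.encode_inj.1 h)⟩
        · intro hn d
          constructor
          · rintro ⟨i, j, hi⟩
            split_ifs at hi with h
            exact ⟨_, Move.inpInp _ _ _ _ _ _ i j, by simpa using hi.symm⟩
          · rintro ⟨c', hm, rfl⟩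
            cases hm with
            | inpInp n l T m l' S i j =>
              refine ⟨i, j, ?_⟩
              rw [if_pos]
              · rfl
              by_contra hne
              exact hn (Bad.inpInp _ _ _ _ _ _ i j fun h => hne (by rw [h]))
  | fin =>
    cases w with
    | cons a w =>
      simp only [stepC, code, tag_fin, if_false, List.map_cons, reduceCtorEq, false_and,
        show (0 : ℕ) ≠ 2 by norm_num, show (0 : ℕ) ≠ 3 by norm_num, show (0 : ℕ) ≠ 4 by norm_num]
      exact ⟨⟨fun _ => by constructor, fun _ => by simp⟩, fun h => (h (by constructor)).elim⟩
    | nil =>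
      simp only [stepC, code, tag_fin, if_false, List.map_nil, true_and,
        show (0 : ℕ) ≠ 2 by norm_num, show (0 : ℕ) ≠ 3 by norm_num, show (0 : ℕ) ≠ 4 by norm_num]
      cases S with
      | var x => exact absurd hS.closed (by simp [FreeIn])
      | fin =>
        simp only [tag_fin, if_true, if_false, show (0 : ℕ) ≠ 2 by norm_num]
        refine ⟨⟨by simp, by rintro ⟨⟩⟩, fun _ d => ⟨by simp, ?_⟩⟩
        rintro ⟨c', hm, -⟩
        cases hm
      | out m l' S =>
        simp only [tag_out, if_false, show (3 : ℕ) ≠ 2 by norm_num, show (3 : ℕ) ≠ 0 by norm_num]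
        exact ⟨⟨fun _ => by constructor, fun _ => by simp⟩, fun h => (h (by constructor)).elim⟩
      | inp m l' S =>
        simp only [tag_inp, if_false, show (4 : ℕ) ≠ 2 by norm_num, show (4 : ℕ) ≠ 0 by norm_num]
        exact ⟨⟨fun _ => by constructor, fun _ => by simp⟩, fun h => (h (by constructor)).elim⟩
      | mu x S =>
        simp only [tag_mu, if_true, unfoldC_code]
        refine ⟨⟨by simp, by rintro ⟨⟩⟩, fun _ d => ?_⟩
        rw [single]
        constructor
        · rintro rfl
          exact ⟨_, Move.finMu .., rfl⟩
        · rintro ⟨c', hm, rfl⟩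
          cases hm
          rfl

theorem safe_iff_stepAll (b : Bool) {P : Ty L → Prop} {pc : ℕ → Bool}
    (hP : ∀ T, pc T.code = true ↔ P T) (k : ℕ) {c : Conf L} (hT : c.sub.IsSession)
    (hS : c.sup.IsSession) :
    Safe b P k c ↔ none ∉ (stepAll b pc)^[k] [some c.code] := by
  induction k generalizing c with
  | zero => simp [Safe]
  | succ k ih =>
    obtain ⟨h1, h2⟩ := stepC_spec b hP hT hS
    have hst : stepAll b pc [some c.code] = stepC b pc c.code := by simp [stepAll]
    rw [Function.iterate_succ_apply, hst, stepAll_iterate_none]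
    have hmove {c' : Conf L} (hm : Move c c') :
        Safe b P k c' ↔ none ∉ (stepAll b pc)^[k] [some c'.code] := by
      refine ih ?_ ?_
      · rcases hm.succ_sub with h | h
        · rwa [h]
        · exact h.isSession hT
      · rcases hm.succ_sup with h | h
        · rwa [h]
        · exact h.isSession hS
    constructor
    · rintro ⟨hb, hs⟩ ⟨o, ho, hn⟩
      cases o with
      | none => exact hb (h1.1 ho)
      | some d =>
        obtain ⟨c', hm, rfl⟩ := (h2 hb d).1 ho
        exact (hmove hm).1 (hs c' hm) hn
    · intro h
      have hb : ¬ Bad b P c := fun hb =>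
        h ⟨none, h1.2 hb, stepAll_iterate_none_self b pc k⟩
      exact ⟨hb, fun c' hm => (hmove hm).2 fun hn =>
        h ⟨_, (h2 hb _).2 ⟨c', hm, rfl⟩, hn⟩⟩

end Conf

/-! ### Decidability -/

namespace Ty

open TyCode

variable {L : Type*} [Encodable L]

/-- The decision procedure is correct on codes of session types. -/
theorem subC_code (b : Bool) {P : Ty L → Prop} {pc : ℕ → Bool}
    (hP : ∀ T, pc T.code = true ↔ P T) {T S : Ty L} (hT : T.IsSession) (hS : S.IsSession) :
    subC b pc T.code S.code = true ↔ Sub b P T S ∧ T.SingleIn ∧ S.SingleIn := by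
  simp only [subC, Bool.and_eq_true, singleInC_code, decide_eq_true_eq]
  constructor
  · rintro ⟨⟨hTi, hSi⟩, h⟩
    exact ⟨(sub_iff_safe_bound hT hTi hS hSi).2 ((Conf.safe_iff_stepAll b hP _
      (c := ⟨T, [], S⟩) hT hS).2 h), hTi, hSi⟩
  · rintro ⟨h, hTi, hSi⟩
    exact ⟨⟨hTi, hSi⟩, (Conf.safe_iff_stepAll b hP _ (c := ⟨T, [], S⟩) hT hS).1
      ((sub_iff_safe_bound hT hTi hS hSi).1 h)⟩

theorem emitsC_dualC_code (T : Ty L) : emitsC (dualC T.code) = true ↔ T.EmitsDual := by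
  rw [dualC_code, emitsC_code]
  rfl

/-- The decision procedure for dual closed subtyping of single-in types, applied to the duals,
decides it for single-out types. -/
theorem subC_dual_code {T S : Ty L} (hT : T.IsSession) (hS : S.IsSession) :
    subC false (fun c => emitsC (dualC c)) (dualC S.code) (dualC T.code) = true ↔
      DSub T S ∧ T.SingleOut ∧ S.SingleOut := by
  rw [dualC_code, dualC_code, subC_code false emitsC_dualC_code hS.dual hT.dual, dual_singleIn,
    dual_singleIn, and_comm (a := S.SingleOut)]
  exact and_congr_left' dSub_dual_iff

end Ty

open Ty TyCode in
theorem mainTheorem2 {L : Type*} [Encodable L] :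
    DecidableOnSessionTypes (L := L) (AsyncSubtype { sin := true }) ∧
    DecidableOnSessionTypes (L := L)
      (fun T S => AsyncSubtype { sin := true } T S ∨ AsyncSubtype { sout := true } T S) ∧
    DecidableOnSessionTypes (L := L) (AsyncSubtype { sin := true, tout := true }) ∧
    (IsDualClosedSubtypingRel (L := L) DualClosedSinOrSout ∧
      DecidableOnSessionTypes (L := L) DualClosedSinOrSout) := by
  have hin (b : Bool) : Primrec₂ (subC b hasInputC) := primrec_subC b primrec_hasInputC
  have hem : Primrec₂ (subC false fun c => emitsC (dualC c)) :=
    primrec_subC false (primrec_emitsC.comp primrec_dualC)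
  have hdual : Primrec₂ fun t s => subC false (fun c => emitsC (dualC c)) (dualC s) (dualC t) :=
    hem.comp (primrec_dualC.comp Primrec.snd) (primrec_dualC.comp Primrec.fst)
  have hsin (b : Bool) {T S : Ty L} (hT : T.IsSession) (hS : S.IsSession) :
      subC b hasInputC T.code S.code = true ↔ AsyncSubtype { sin := true, tout := b } T S :=
    (subC_code b hasInputC_code hT hS).trans asyncSubtype_singleIn_iff.symm
  refine ⟨⟨_, (hin false).to_comp, fun T S hT hS => hsin false hT hS⟩,
    ⟨_, Primrec₂.to_comp (Primrec.or.comp₂ (hin false) hdual), fun T S hT hS => ?_⟩,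
    ⟨_, (hin true).to_comp, fun T S hT hS => hsin true hT hS⟩,
    isDualClosedSubtypingRel_sinOrSout,
    ⟨_, Primrec₂.to_comp (Primrec.or.comp₂ hem hdual), fun T S hT hS => ?_⟩⟩
  · simp only [Bool.or_eq_true]
    rw [hsin false hT hS, subC_dual_code hT hS, asyncSubtype_singleOut_iff]
  · simp only [Bool.or_eq_true]
    rw [subC_code false emitsC_dualC_code hT hS, subC_dual_code hT hS, DualClosedSinOrSout,
      dualClosedSubtype_iff]
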